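/- A temporal graph $\mathcal G=\langle G_1,\dots,G_L\rangle$ on a finite vertex set $V$ is a sequence of $L$ graphs on $V$ (its snapshots; $L$ is its lifetime); its underlying graph consists of all edges that occur in some snapshot. $\mathcal G$ is always-connected if every $G_t$ is connected, and $k$-edge-deficient if the underlying graph has a spanning tree $T$ such that, for every $t$, at most $k$ edges of $T$ are missing in $G_t$. A temporal walk from $v$ traverses edges $\{v_0,v_1\},\{v_1,v_2\},\dots,\{v_{\ell-1},v_\ell\}$ with $v_0=v$ in time steps $1\le t_1<\dots<t_\ell\le L$, where $\{v_{i-1},v_i\}$ is an edge of $G_{t_i}$. $\mathcal G$ is explored from $v$ in at most $B$ steps by such a walk if the walk visits all vertices and $\ell\le B$ and $t_\ell\le B$ (the latter if $\ell\ge1$). There is an absolute constant $C>0$ such that the following holds. For integers $k,n\ge 1$ put $B(n,k)=C\,n\,k\log(k+1)$, which is $O(nk\log k)$ for $k\ge2$. Let $\mathcal G$ be an always-connected $k$-edge-deficient temporal graph on $n$ vertices with lifetime $L\ge B(n,k)$. 1. For every vertex $v$, $\mathcal G$ can be explored from $v$ in at most $B(n,k)$ steps. 2. There is a Las Vegas algorithm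 (independent of $k$, $n$ and $\mathcal G$) which, given any such $\mathcal G$ and a vertex $v$, computes an exploration of $\mathcal G$ from $v$ in at most $B(n,k)$ steps: whenever it halts its output is correct, and its expected running time is at most a fixed polynomial in the size of the input. 3. There is a deterministic algorithm which, given any such $\mathcal G$ and a vertex $v$, computes an exploration of $\mathcal G$ from $v$ in at most $B(n,k)$ steps, and whose running time is, for every fixed $k$, at most a polynomial (depending on $k$) in the size of the input. -/

import Mathlib

open scoped ENNReal

/-! ## Temporal graphs -/

/-- A temporal graph with lifetime `L` on the vertex set `V`: a sequence of `L` graphs on `V`.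
The snapshot at time step `t ∈ {1, …, L}` is `G (t - 1)`. -/
abbrev TemporalGraph (V : Type*) (L : ℕ) := Fin L → SimpleGraph V

namespace TemporalGraph

variable {V : Type*} {L : ℕ}

/-- The underlying graph: its edges are those that appear in at least one snapshot. -/
def underlying (G : TemporalGraph V L) : SimpleGraph V := ⨆ i, G i

/-- Every snapshot is connected. -/
def AlwaysConnected (G : TemporalGraph V L) : Prop := ∀ i, (G i).Connected

/-- All but at most `k` edges of `F` are present in `H`. -/
def SnapshotDeficient (k : ℕ) (F H : SimpleGraph V) : Prop :=
  (F.edgeSet \ H.edgeSet).encard ≤ k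

/-- All snapshots are `k`-edge-deficient with respect to one spanning tree of the underlying
graph. -/
def EdgeDeficient (k : ℕ) (G : TemporalGraph V L) : Prop :=
  ∃ T : SimpleGraph V, T ≤ G.underlying ∧ T.IsTree ∧ ∀ i, SnapshotDeficient k T (G i)

/-- A temporal walk starting at `v`: vertices `v = v₀, v₁, …, v_ℓ` and strictly increasing time
steps, such that the edge `v_i v_{i+1}` is present in the snapshot in which it is traversed.
The time step of the `i`-th move is `time i + 1`. -/
structure Walk (G : TemporalGraph V L) (v : V) where
  length : ℕ
  vertex : Fin (length + 1) → V
  time : Fin length → Fin L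
  start : vertex 0 = v
  time_strictMono : StrictMono time
  adj : ∀ i : Fin length, (G (time i)).Adj (vertex i.castSucc) (vertex i.succ)

/-- The walk visits all vertices, has at most `B` edges, and makes all its moves during the time
steps `1, …, ⌊B⌋`. -/
def Walk.ExploresWithin {G : TemporalGraph V L} {v : V} (W : G.Walk v) (B : ℝ) : Prop :=
  Function.Surjective W.vertex ∧ (W.length : ℝ) ≤ B ∧
    ∀ i, (((W.time i : ℕ) + 1 : ℕ) : ℝ) ≤ B

end TemporalGraph

/-! ## A random access machine with coin flips

Programs work on registers and arrays of natural numbers (all initially `0` outside the input).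
Every elementary operation costs one step.  The only arithmetic operations are addition and
truncated subtraction, so that numbers have at most linearly many bits in the number of steps plus
the number of bits of the input, and polynomial time is the usual polynomial time. -/

namespace RAM

/-- A memory state; `coins` is the number of coin flips made so far. -/
structure State where
  reg : ℕ → ℕ
  arr : ℕ → ℕ → ℕ
  coins : ℕ

/-- Expressions; `cell A e` reads the array `A` at the index `e`. -/
inductive Exp
  | const (c : ℕ)
  | reg (x : ℕ)
  | cell (A : ℕ) (e : Exp)
  | add (e₁ e₂ : Exp)
  | sub (e₁ e₂ : Exp)

/-- The value of an expression. -/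
def Exp.eval (s : State) : Exp → ℕ
  | .const c => c
  | .reg x => s.reg x
  | .cell A e => s.arr A (e.eval s)
  | .add e₁ e₂ => e₁.eval s + e₂.eval s
  | .sub e₁ e₂ => e₁.eval s - e₂.eval s

/-- The number of steps needed to evaluate an expression. -/
def Exp.cost : Exp → ℕ
  | .const _ => 1
  | .reg _ => 1
  | .cell _ e => e.cost + 1
  | .add e₁ e₂ => e₁.cost + e₂.cost + 1
  | .sub e₁ e₂ => e₁.cost + e₂.cost + 1

/-- Programs.  `assign x e` writes `e` to the register `x`, `store A e₁ e₂` writes `e₂` to the array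
`A` at the index `e₁`, `flip x` writes a random bit to the register `x`, and `cond`, `loop` test
whether the value of an expression is nonzero. -/
inductive Program
  | skip
  | assign (x : ℕ) (e : Exp)
  | store (A : ℕ) (e₁ e₂ : Exp)
  | flip (x : ℕ)
  | seq (c₁ c₂ : Program)
  | cond (e : Exp) (c₁ c₂ : Program)
  | loop (e : Exp) (c : Program)

/-- A program is deterministic if it flips no coins. -/
def Program.Deterministic : Program → Prop
  | .flip _ => False
  | .seq c₁ c₂ => c₁.Deterministic ∧ c₂.Deterministic
  | .cond _ c₁ c₂ => c₁.Deterministic ∧ c₂.Deterministic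
  | .loop _ c => c.Deterministic
  | _ => True

def State.setReg (s : State) (x a : ℕ) : State :=
  { s with reg := Function.update s.reg x a }

def State.setCell (s : State) (A i a : ℕ) : State :=
  { s with arr := Function.update s.arr A (Function.update (s.arr A) i a) }

/-- `Run ω c s s' t`: when the outcomes of the coin flips are `ω 0, ω 1, …`, the program `c`, started
in `s`, halts in `s'` after exactly `t` steps. -/
inductive Run (ω : ℕ → Bool) : Program → State → State → ℕ → Prop
  | skip (s : State) : Run ω .skip s s 1
  | assign (s : State) (x : ℕ) (e : Exp) :
      Run ω (.assign x e) s (s.setReg x (e.eval s)) (e.cost + 1)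
  | store (s : State) (A : ℕ) (e₁ e₂ : Exp) :
      Run ω (.store A e₁ e₂) s (s.setCell A (e₁.eval s) (e₂.eval s)) (e₁.cost + e₂.cost + 1)
  | flip (s : State) (x : ℕ) :
      Run ω (.flip x) s { s.setReg x (ω s.coins).toNat with coins := s.coins + 1 } 1
  | seq {s s' s'' : State} {c₁ c₂ : Program} {t₁ t₂ : ℕ} :
      Run ω c₁ s s' t₁ → Run ω c₂ s' s'' t₂ → Run ω (.seq c₁ c₂) s s'' (t₁ + t₂)
  | cond_true {s s' : State} {e : Exp} {c₁ c₂ : Program} {t : ℕ} :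
      e.eval s ≠ 0 → Run ω c₁ s s' t → Run ω (.cond e c₁ c₂) s s' (e.cost + 1 + t)
  | cond_false {s s' : State} {e : Exp} {c₁ c₂ : Program} {t : ℕ} :
      e.eval s = 0 → Run ω c₂ s s' t → Run ω (.cond e c₁ c₂) s s' (e.cost + 1 + t)
  | loop_true {s s' s'' : State} {e : Exp} {c : Program} {t₁ t₂ : ℕ} :
      e.eval s ≠ 0 → Run ω c s s' t₁ → Run ω (.loop e c) s' s'' t₂ →
        Run ω (.loop e c) s s'' (e.cost + 1 + t₁ + t₂)
  | loop_false {s : State} {e : Exp} {c : Program} :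
      e.eval s = 0 → Run ω (.loop e c) s s (e.cost + 1)

/-- For given coin flips, the final state and the number of steps are unique. -/
theorem Run.unique {ω : ℕ → Bool} {c : Program} {s s₁ : State} {t₁ : ℕ} (h₁ : Run ω c s s₁ t₁) :
    ∀ {s₂ : State} {t₂ : ℕ}, Run ω c s s₂ t₂ → s₁ = s₂ ∧ t₁ = t₂ := by
  induction h₁ with
  | skip s => intro _ _ h; cases h; exact ⟨rfl, rfl⟩
  | assign s x e => intro _ _ h; cases h; exact ⟨rfl, rfl⟩
  | store s A e₁ e₂ => intro _ _ h; cases h; exact ⟨rfl, rfl⟩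
  | flip s x => intro _ _ h; cases h; exact ⟨rfl, rfl⟩
  | seq _ _ ih₁ ih₂ =>
    intro _ _ h
    cases h with
    | seq g₁ g₂ =>
      obtain ⟨rfl, rfl⟩ := ih₁ g₁
      obtain ⟨rfl, rfl⟩ := ih₂ g₂
      exact ⟨rfl, rfl⟩
  | cond_true he _ ih =>
    intro _ _ h
    cases h with
    | cond_true _ g => obtain ⟨rfl, rfl⟩ := ih g; exact ⟨rfl, rfl⟩
    | cond_false he' _ => exact absurd he' he
  | cond_false he _ ih =>
    intro _ _ h
    cases h with
    | cond_true he' _ => exact absurd he he'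
    | cond_false _ g => obtain ⟨rfl, rfl⟩ := ih g; exact ⟨rfl, rfl⟩
  | loop_true he _ _ ih₁ ih₂ =>
    intro _ _ h
    cases h with
    | loop_true _ g₁ g₂ =>
      obtain ⟨rfl, rfl⟩ := ih₁ g₁
      obtain ⟨rfl, rfl⟩ := ih₂ g₂
      exact ⟨rfl, rfl⟩
    | loop_false he' => exact absurd he' he
  | loop_false he =>
    intro _ _ h
    cases h with
    | loop_true he' _ _ => exact absurd he he'
    | loop_false _ => exact ⟨rfl, rfl⟩

/-- The number of steps until the program halts (`∞` if it does not halt). -/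
noncomputable def runTime (ω : ℕ → Bool) (c : Program) (s : State) : ℝ≥0∞ :=
  ⨅ (s' : State) (t : ℕ) (_ : Run ω c s s' t), (t : ℝ≥0∞)

/-- Independent fair coin flips. -/
noncomputable def fairCoins : MeasureTheory.Measure (ℕ → Bool) :=
  MeasureTheory.Measure.infinitePi fun _ => (PMF.uniformOfFintype Bool).toMeasure

/-- The expected number of steps. -/
noncomputable def expectedTime (c : Program) (s : State) : ℝ≥0∞ :=
  ∫⁻ ω, runTime ω c s ∂fairCoins

end RAM

/-! ## Input and output of an exploration algorithm -/

namespace TemporalGraph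

variable {n L : ℕ}

open Classical in
/-- The adjacency matrices of the snapshots, written into one array. -/
noncomputable def adjacencyArray (G : TemporalGraph (Fin n) L) (a : ℕ) : ℕ :=
  if ∃ (i : Fin L) (u w : Fin n), a = (i * n + u) * n + w ∧ (G i).Adj u w then 1 else 0

/-- The input: the registers `0, 1, 2` hold the number of vertices, the lifetime and the start
vertex, and the array `0` holds the adjacency matrices of the snapshots. -/
noncomputable def input (G : TemporalGraph (Fin n) L) (v : Fin n) : RAM.State where
  reg x := if x = 0 then n else if x = 1 then L else if x = 2 then v else 0
  arr A := if A = 0 then G.adjacencyArray else fun _ => 0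
  coins := 0

/-- The number of memory cells occupied by the input. -/
def inputSize (n L : ℕ) : ℕ := L * n * n + 3

/-- The final state `s` describes the temporal walk `W`: register `0` holds its length, the array
`1` the (zero-based) indices of the snapshots in which it moves, and the array `2` the vertices
that it moves to. -/
def Describes {G : TemporalGraph (Fin n) L} {v : Fin n} (s : RAM.State) (W : G.Walk v) : Prop :=
  s.reg 0 = W.length ∧
    ∀ i : Fin W.length, s.arr 1 i = (W.time i : ℕ) ∧ s.arr 2 i = (W.vertex i.succ : ℕ)

/-- With start state `G.input v` the program `P` never gives a wrong answer: for all outcomes of the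
coin flips, if it halts, then it has written an exploration schedule of `G` from `v` within the
time steps `1, …, ⌊B⌋`. -/
def Correct (P : RAM.Program) (G : TemporalGraph (Fin n) L) (v : Fin n) (B : ℝ) : Prop :=
  ∀ (ω : ℕ → Bool) (s : RAM.State) (t : ℕ), RAM.Run ω P (G.input v) s t →
    ∃ W : G.Walk v, Describes s W ∧ W.ExploresWithin B

end TemporalGraph

/-! ## Structured programs with bounded loops -/

namespace RAM

/-! Consider the first `H = 3nM` time steps and weigh a pair of vertices by the number of these
steps in which it is not an edge. The tree given by edge-deficiency has weight at most `kH`, hence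
so does a minimum spanning tree. A closed tour along the latter, using each edge twice, has fewer
than `2n` positions and weight at most `2kH`. Time is split into `M` phases of `3n` steps. In the
first `n` steps of a phase the explorer can get to any vertex, since every snapshot is connected; in
the other `2n` steps it follows the tour and moves forward whenever the next edge is present.

For each phase `j` the tour is cut into `r_j` consecutive segments, each being what a walker from
its first position covers in the `2n` steps. Walkers lose time only at missing edges, so `2n * r_j`
is at most `4n` plus the weight of the tour within phase `j`; summing gives `∑ r_j ≤ 5kM`. The first
positions of the segments of all phases are marked, which makes at most `5kM` marks. Each phase
greedily traverses a segment with the most remaining marks and removes them, which leaves at most a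
fraction `1 - 1/r_j ≤ exp(-1/r_j)`. By convexity `∑ 1/r_j ≥ M/(5k)`, so fewer than one mark is left
once `M ≥ 80 k log(k+1)`. A segment ends at the end of the tour or just before another mark. Hence
removing a mark means that everything from it up to the next mark has been visited, and without
marks the whole tour has been visited. Counting marks instead of positions is what gives `log k` and
not `log n`.

All of this is deterministic and computable, so one program without coin flips serves for both
algorithmic claims, with a time bound that does not depend on `k`. It tries `M = 1, 2, …` until no
mark is left, which certifies success without knowledge of `k`. It is written in a language of
bounded loops, for which `run_for` is the invariant rule and `exists_run` gives termination in
polynomial time. The combinatorial core is `SimpleGraph.exists_exchange` (minimum spanning tree),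
`card_starts_mul_le`, `card_sdiff_segment_le`, `neg_sum_inv_le` and `mul_exp_lt_one`; `phase_spec`,
`attempt_spec` and `main_spec` tie it to the program. -/

@[simp] theorem State.setReg_reg (s : State) (x a : ℕ) :
    (s.setReg x a).reg = Function.update s.reg x a := rfl

@[simp] theorem State.setReg_arr (s : State) (x a : ℕ) : (s.setReg x a).arr = s.arr := rfl

@[simp] theorem State.setCell_reg (s : State) (A i a : ℕ) : (s.setCell A i a).reg = s.reg := rfl

@[simp] theorem State.setCell_arr (s : State) (A i a : ℕ) :
    (s.setCell A i a).arr = Function.update s.arr A (Function.update (s.arr A) i a) := rfl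

attribute [simp] Exp.eval

/-- Structured commands.  The body of `forTo x e c` is executed for `x = 0, 1, …` as long as `x` is
less than the value of `e` and less than the value of register `1`. -/
inductive Cmd
  | skip
  | assign (x : ℕ) (e : Exp)
  | store (A : ℕ) (e₁ e₂ : Exp)
  | seq (c₁ c₂ : Cmd)
  | ite (e : Exp) (c₁ c₂ : Cmd)
  | forTo (x : ℕ) (e : Exp) (c : Cmd)

namespace Cmd

/-- The effect of a command on the memory. -/
def run : Cmd → State → State
  | skip, s => s
  | assign x e, s => s.setReg x (e.eval s)
  | store A e₁ e₂, s => s.setCell A (e₁.eval s) (e₂.eval s)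
  | seq c₁ c₂, s => c₂.run (c₁.run s)
  | ite e c₁ c₂, s => if e.eval s ≠ 0 then c₁.run s else c₂.run s
  | .forTo x e c, s =>
    (fun s => (c.run s).setReg x ((c.run s).reg x + 1))^[min (e.eval s) (s.reg 1)] (s.setReg x 0)

/-- Whether the command may write to the register `y`. -/
def writesReg : Cmd → ℕ → Bool
  | skip, _ => false
  | assign x _, y => x == y
  | store _ _ _, _ => false
  | seq c₁ c₂, y => c₁.writesReg y || c₂.writesReg y
  | ite _ c₁ c₂, y => c₁.writesReg y || c₂.writesReg y
  | .forTo x _ c, y => x == y || c.writesReg y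

/-- Whether the command may write to the array `B`. -/
def writesArr : Cmd → ℕ → Bool
  | skip, _ => false
  | assign _ _, _ => false
  | store A _ _, B => A == B
  | seq c₁ c₂, B => c₁.writesArr B || c₂.writesArr B
  | ite _ c₁ c₂, B => c₁.writesArr B || c₂.writesArr B
  | .forTo _ _ c, B => c.writesArr B

/-- Whether the command writes to none of the registers and arrays that the expression reads. -/
def fixes (c : Cmd) : Exp → Bool
  | .const _ => true
  | .reg x => !c.writesReg x
  | .cell A e => !c.writesArr A && c.fixes e
  | .add e₁ e₂ => c.fixes e₁ && c.fixes e₂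
  | .sub e₁ e₂ => c.fixes e₁ && c.fixes e₂

/-- Register `1` is never written, and loops change neither their variable nor their bound. -/
def WF : Cmd → Bool
  | skip => true
  | assign x _ => x != 1
  | store _ _ _ => true
  | seq c₁ c₂ => c₁.WF && c₂.WF
  | ite _ c₁ c₂ => c₁.WF && c₂.WF
  | .forTo x e c => c.WF && x != 1 && !c.writesReg x && (Cmd.forTo x e c).fixes e

/-- The sequential composition of a list of commands. -/
def block : List Cmd → Cmd
  | [] => skip
  | c :: l => seq c (block l)

/-- Translation into programs of the random access machine. -/
def toProgram : Cmd → Program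
  | skip => .skip
  | assign x e => .assign x e
  | store A e₁ e₂ => .store A e₁ e₂
  | seq c₁ c₂ => .seq c₁.toProgram c₂.toProgram
  | ite e c₁ c₂ => .cond e c₁.toProgram c₂.toProgram
  | .forTo x e c =>
    .seq (.assign x (.const 0))
      -- With truncated subtraction `e - (e - r)` is `min e r`, so the test is nonzero exactly while
      -- `x` is below both bounds.
      (.loop (.sub (.sub e (.sub e (.reg 1))) (.reg x))
        (.seq c.toProgram (.assign x (.add (.reg x) (.const 1)))))

open Polynomial in
/-- A bound on the number of steps in terms of the value of register `1`. -/
noncomputable def time : Cmd → Polynomial ℕ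
  | skip => 1
  | assign _ e => C (e.cost + 1)
  | store _ e₁ e₂ => C (e₁.cost + e₂.cost + 1)
  | seq c₁ c₂ => c₁.time + c₂.time
  | ite e c₁ c₂ => C (e.cost + 1) + c₁.time + c₂.time
  -- The test evaluates `e` twice and costs `2 * e.cost + 6`; the increment of the loop variable
  -- costs `4`. The summand outside the product pays for the initialisation and the last test.
  | .forTo _ e c => X * (C (2 * e.cost + 10) + c.time) + C (2 * e.cost + 10)

/-! ### Semantics and running time of bounded loops -/

theorem toProgram_deterministic (c : Cmd) : c.toProgram.Deterministic := by
  induction c with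
  | skip | assign | store => trivial
  | seq _ _ h₁ h₂ => exact ⟨h₁, h₂⟩
  | ite _ _ _ h₁ h₂ => exact ⟨h₁, h₂⟩
  | forTo _ _ _ h => exact ⟨trivial, h, trivial⟩

theorem run_reg (c : Cmd) {y : ℕ} (h : c.writesReg y = false) (s : State) :
    (c.run s).reg y = s.reg y := by
  induction c generalizing s with
  | skip => rfl
  | assign x e =>
    have : y ≠ x := by rintro rfl; simp [writesReg] at h
    simp [run, this]
  | store => rfl
  | seq c₁ c₂ h₁ h₂ =>
    simp only [writesReg, Bool.or_eq_false_iff] at h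
    rw [run, h₂ h.2, h₁ h.1]
  | ite e c₁ c₂ h₁ h₂ =>
    simp only [writesReg, Bool.or_eq_false_iff] at h
    rw [run]
    split
    exacts [h₁ h.1 s, h₂ h.2 s]
  | forTo x e c ih =>
    simp only [writesReg, Bool.or_eq_false_iff] at h
    have hy : y ≠ x := by rintro rfl; simp at h
    rw [run]
    generalize min (e.eval s) (s.reg 1) = N
    induction N with
    | zero => simp [hy]
    | succ N hN => rw [Function.iterate_succ_apply', State.setReg_reg,
        Function.update_of_ne hy, ih h.2, hN]

theorem run_arr (c : Cmd) {B : ℕ} (h : c.writesArr B = false) (s : State) :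
    (c.run s).arr B = s.arr B := by
  induction c generalizing s with
  | skip => rfl
  | assign x e => rfl
  | store A e₁ e₂ =>
    have : B ≠ A := by rintro rfl; simp [writesArr] at h
    simp [run, this]
  | seq c₁ c₂ h₁ h₂ =>
    simp only [writesArr, Bool.or_eq_false_iff] at h
    rw [run, h₂ h.2, h₁ h.1]
  | ite e c₁ c₂ h₁ h₂ =>
    simp only [writesArr, Bool.or_eq_false_iff] at h
    rw [run]
    split
    exacts [h₁ h.1 s, h₂ h.2 s]
  | forTo x e c ih =>
    rw [run]
    generalize min (e.eval s) (s.reg 1) = N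
    induction N with
    | zero => simp
    | succ N hN => rw [Function.iterate_succ_apply', State.setReg_arr, ih h, hN]

/-- The states agree except for the registers and arrays to which `c` may write. -/
structure Frame (c : Cmd) (s s' : State) : Prop where
  reg : ∀ y, c.writesReg y = false → s'.reg y = s.reg y
  arr : ∀ B, c.writesArr B = false → s'.arr B = s.arr B

theorem frame_run (c : Cmd) (s : State) : c.Frame s (c.run s) :=
  ⟨fun _ h => c.run_reg h s, fun _ h => c.run_arr h s⟩

theorem eval_eq_of_fixes {c : Cmd} {e : Exp} (h : c.fixes e) {s s' : State}
    (hf : c.Frame s s') : e.eval s' = e.eval s := by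
  induction e with
  | const => rfl
  | reg x => exact hf.reg x (by simpa [fixes] using h)
  | cell A e ih =>
    simp only [fixes, Bool.and_eq_true, Bool.not_eq_true'] at h
    simp [hf.arr A h.1, ih h.2]
  | add e₁ e₂ h₁ h₂ | sub e₁ e₂ h₁ h₂ =>
    simp only [fixes, Bool.and_eq_true] at h
    simp [h₁ h.1, h₂ h.2]

theorem WF.writesReg_one {c : Cmd} (h : c.WF) : c.writesReg 1 = false := by
  induction c with
  | skip | store => rfl
  | assign x e => simpa [WF, writesReg] using h
  | seq _ _ h₁ h₂ | ite _ _ _ h₁ h₂ =>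
    simp only [WF, Bool.and_eq_true] at h
    simp [writesReg, h₁ h.1, h₂ h.2]
  | forTo x e c ih =>
    simp only [WF, Bool.and_eq_true, bne_iff_ne] at h
    simp [writesReg, ih h.1.1.1, h.1.1.2]

/-- The states reached during a loop. -/
theorem iterate_frame {x : ℕ} (e : Exp) {c : Cmd} (hx : c.writesReg x = false) (s : State)
    (i : ℕ) :
    let s' := (fun s => (c.run s).setReg x ((c.run s).reg x + 1))^[i] (s.setReg x 0)
    s'.reg x = i ∧ (Cmd.forTo x e c).Frame s s' := by
  induction i with
  | zero =>
    refine ⟨by simp, fun y hy => ?_, fun B _ => by simp⟩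
    have : y ≠ x := by rintro rfl; simp [writesReg] at hy
    simp [this]
  | succ i ih =>
    simp only [Function.iterate_succ_apply']
    refine ⟨?_, fun y hy => ?_, fun B hB => ?_⟩
    · rw [State.setReg_reg, Function.update_self, run_reg c hx, ih.1]
    · have h1 : y ≠ x := by rintro rfl; simp [writesReg] at hy
      rw [State.setReg_reg, Function.update_of_ne h1, run_reg c, ih.2.reg y hy]
      simp only [writesReg, Bool.or_eq_false_iff] at hy
      exact hy.2
    · rw [State.setReg_arr, run_arr c hB, ih.2.arr B hB]

/-- The invariant rule for loops. -/
theorem run_for {x : ℕ} {e : Exp} {c : Cmd} {s : State} {N : ℕ} (I : ℕ → State → Prop)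
    (hx : c.writesReg x = false) (hN : e.eval s = N) (hL : N ≤ s.reg 1)
    (zero : I 0 (s.setReg x 0))
    (step : ∀ i s', i < N → s'.reg x = i →
      (Cmd.forTo x e c).Frame s s' →
      I i s' → I (i + 1) ((c.run s').setReg x (i + 1))) :
    I N ((Cmd.forTo x e c).run s) := by
  rw [run, hN, min_eq_left hL]
  have key : ∀ i ≤ N, I i
      ((fun s => (c.run s).setReg x ((c.run s).reg x + 1))^[i] (s.setReg x 0)) := by
    intro i hi
    induction i with
    | zero => exact zero
    | succ i ih =>
      have hf := iterate_frame e hx s i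
      have := step i _ hi hf.1 hf.2 (ih (by omega))
      rw [Function.iterate_succ_apply']
      rw [run_reg c hx, hf.1]
      exact this
  exact key N le_rfl

/-- A loop makes at most as many iterations as the value of register `1`, and this value never
changes. Hence the polynomial `time`, evaluated there, bounds the number of steps of all nested
loops. -/
theorem exists_run (ω : ℕ → Bool) {c : Cmd} (h : c.WF) (s : State) :
    ∃ t, Run ω c.toProgram s (c.run s) t ∧ t ≤ c.time.eval (s.reg 1) := by
  induction c generalizing s with
  | skip => exact ⟨1, .skip s, by simp [time]⟩
  | assign x e => exact ⟨_, .assign s x e, by simp [time]⟩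
  | store A e₁ e₂ => exact ⟨_, .store s A e₁ e₂, by simp [time]⟩
  | seq c₁ c₂ h₁ h₂ =>
    simp only [WF, Bool.and_eq_true] at h
    obtain ⟨t₁, r₁, l₁⟩ := h₁ h.1 s
    obtain ⟨t₂, r₂, l₂⟩ := h₂ h.2 (c₁.run s)
    rw [run_reg c₁ (WF.writesReg_one h.1)] at l₂
    exact ⟨_, .seq r₁ r₂, by simp only [time, Polynomial.eval_add]; omega⟩
  | ite e c₁ c₂ h₁ h₂ =>
    simp only [WF, Bool.and_eq_true] at h
    by_cases he : e.eval s = 0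
    · obtain ⟨t₂, r₂, l₂⟩ := h₂ h.2 s
      refine ⟨e.cost + 1 + t₂, ?_, ?_⟩
      · rw [run, if_neg (by simpa using he)]; exact .cond_false he r₂
      · simp only [time, Polynomial.eval_add, Polynomial.eval_C]; omega
    · obtain ⟨t₁, r₁, l₁⟩ := h₁ h.1 s
      refine ⟨e.cost + 1 + t₁, ?_, ?_⟩
      · rw [run, if_pos he]; exact .cond_true he r₁
      · simp only [time, Polynomial.eval_add, Polynomial.eval_C]; omega
  | forTo x e c ih =>
    have hwf := h
    simp only [WF, Bool.and_eq_true, bne_iff_ne, Bool.not_eq_true'] at h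
    obtain ⟨⟨⟨hc, hx1⟩, hx⟩, hfix⟩ := h
    have h1 := WF.writesReg_one hwf
    set f : State → State := fun s => (c.run s).setReg x ((c.run s).reg x + 1) with hf
    set N := min (e.eval s) (s.reg 1) with hN
    set T := c.time.eval (s.reg 1) with hT
    set K := 2 * e.cost + 10 with hK
    have fr (i) : (f^[i] (s.setReg x 0)).reg x = i ∧
        (Cmd.forTo x e c).Frame s (f^[i] (s.setReg x 0)) :=
      iterate_frame e hx s i
    -- Induction on the number `d` of iterations still to be made, because `Run` builds a loop by
    -- prepending an iteration.
    have key : ∀ d ≤ N, ∃ t, Run ω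
        (.loop (.sub (.sub e (.sub e (.reg 1))) (.reg x))
          (.seq c.toProgram (.assign x (.add (.reg x) (.const 1)))))
        (f^[N - d] (s.setReg x 0)) (f^[N] (s.setReg x 0)) t ∧
          t ≤ d * (K + T) + (2 * e.cost + 6) := by
      intro d
      induction d with
      | zero =>
        intro _
        refine ⟨_, .loop_false ?_, by simp only [Exp.cost]; omega⟩
        rw [Nat.sub_zero]
        obtain ⟨f1, f2⟩ := fr N
        simp only [Exp.eval]
        rw [f1, f2.reg 1 h1, eval_eq_of_fixes hfix f2]
        omega
      | succ d ihd =>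
        intro hd
        obtain ⟨t, r, l⟩ := ihd (by omega)
        obtain ⟨f1, f2⟩ := fr (N - (d + 1))
        obtain ⟨t', r', l'⟩ := ih hc (f^[N - (d + 1)] (s.setReg x 0))
        have e1 : N - d = (N - (d + 1)) + 1 := by omega
        rw [e1, Function.iterate_succ_apply'] at r
        rw [f2.reg 1 h1] at l'
        refine ⟨_, .loop_true ?_ (.seq r' (.assign _ _ _)) r, ?_⟩
        · simp only [Exp.eval]
          rw [f1, f2.reg 1 h1, eval_eq_of_fixes hfix f2, Nat.sub_sub]
          rcases le_total (e.eval s) (s.reg 1) with h | h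
          · rw [min_eq_left h] at hN
            omega
          · rw [min_eq_right h] at hN
            omega
        · simp only [Exp.cost]
          rw [Nat.add_mul, one_mul]
          omega
    obtain ⟨t, r, l⟩ := key N le_rfl
    rw [Nat.sub_self] at r
    refine ⟨_, .seq (.assign _ _ _) r, ?_⟩
    have : N * (K + T) ≤ s.reg 1 * (K + T) := Nat.mul_le_mul_right _ (min_le_right _ _)
    simp only [time, Polynomial.eval_add, Polynomial.eval_mul, Polynomial.eval_C,
      Polynomial.eval_X, Exp.cost, ← hK, ← hT]
    omega

end Cmd

end RAM

/-! ## Walking along a tour -/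

namespace TemporalGraph

open Finset

section Tour

variable (E : ℕ → ℕ → ℕ → Prop) (p : ℕ → ℕ) (m D : ℕ)

open Classical in
/-- The number of time steps in `[t₀, t₀ + D)` in which `ux` is not an edge. -/
noncomputable def missing (t₀ D u x : ℕ) : ℕ :=
  ∑ d ∈ range D, if E (t₀ + d) u x then 0 else 1

open Classical in
/-- The position at time `t₀ + d` of a walker along the tour `p 0, …, p m`, who starts in position
`a` at time `t₀` and moves forward whenever possible. -/
noncomputable def walker (t₀ a : ℕ) : ℕ → ℕ
  | 0 => a
  | d + 1 =>
    if walker t₀ a d < m ∧ E (t₀ + d) (p (walker t₀ a d)) (p (walker t₀ a d + 1)) then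
      walker t₀ a d + 1
    else walker t₀ a d

/-- The tour is divided into segments such that walkers who start in the first positions of the
segments need time `D` for them.  This is the first position of the segment with number `i`. -/
noncomputable def segmentStart (t₀ : ℕ) : ℕ → ℕ
  | 0 => 0
  | i + 1 => walker E p m t₀ (segmentStart t₀ i) D + 1

open Classical in
/-- The first positions of the segments. -/
noncomputable def starts (t₀ : ℕ) : Finset ℕ :=
  {y ∈ range (m + 1) | ∃ i, segmentStart E p m D t₀ i = y}

variable {E p m D}

/-! ### Delays, segments and marks on the tour -/

theorem missing_add (t₀ D D' u x : ℕ) :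
    missing E t₀ (D + D') u x = missing E t₀ D u x + missing E (t₀ + D) D' u x := by
  unfold missing
  rw [sum_range_add]
  refine congrArg _ (sum_congr rfl fun d _ => ?_)
  rw [← add_assoc]

theorem missing_mono {t₀ D D' u x : ℕ} (h : D ≤ D') :
    missing E t₀ D u x ≤ missing E t₀ D' u x := by
  obtain ⟨e, rfl⟩ := Nat.exists_eq_add_of_le h
  rw [missing_add]
  exact Nat.le_add_right _ _

theorem missing_comm (hE : ∀ t u x, E t u x → E t x u) (t₀ D u x : ℕ) :
    missing E t₀ D u x = missing E t₀ D x u := by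
  unfold missing
  refine sum_congr rfl fun d _ => ?_
  rw [show E (t₀ + d) u x = E (t₀ + d) x u from propext ⟨hE _ _ _, hE _ _ _⟩]

theorem missing_le (t₀ D u x : ℕ) : missing E t₀ D u x ≤ D := by
  calc missing E t₀ D u x ≤ ∑ d ∈ range D, 1 := sum_le_sum fun d _ => by split <;> simp
    _ = D := by simp

theorem walker_le {t₀ a : ℕ} (ha : a ≤ m) (d : ℕ) : walker E p m t₀ a d ≤ m := by
  induction d with
  | zero => exact ha
  | succ d ih =>
    rw [walker]
    split <;> omega

theorem walker_le_succ (t₀ a d : ℕ) : walker E p m t₀ a d ≤ walker E p m t₀ a (d + 1) := by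
  rw [walker]
  split <;> omega

theorem walker_succ_le (t₀ a d : ℕ) : walker E p m t₀ a (d + 1) ≤ walker E p m t₀ a d + 1 := by
  rw [walker]
  split <;> omega

theorem le_walker (t₀ a d : ℕ) : a ≤ walker E p m t₀ a d := by
  induction d with
  | zero => exact le_rfl
  | succ d ih => exact ih.trans (walker_le_succ t₀ a d)

theorem walker_step (t₀ a d : ℕ) :
    p (walker E p m t₀ a (d + 1)) = p (walker E p m t₀ a d) ∨
      E (t₀ + d) (p (walker E p m t₀ a d)) (p (walker E p m t₀ a (d + 1))) := by
  rw [walker]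
  split
  · next h => exact .inr h.2
  · exact .inl rfl

theorem exists_walker_eq {t₀ a y : ℕ} (h : a ≤ y) (d : ℕ) (hd : y ≤ walker E p m t₀ a d) :
    ∃ d' ≤ d, walker E p m t₀ a d' = y := by
  induction d with
  | zero => exact ⟨0, le_rfl, by rw [walker] at *; omega⟩
  | succ d ih =>
    by_cases hy : y ≤ walker E p m t₀ a d
    · obtain ⟨d', h1, h2⟩ := ih hy
      exact ⟨d', by omega, h2⟩
    · exact ⟨d + 1, le_rfl, by have := walker_succ_le (E := E) (p := p) (m := m) t₀ a d; omega⟩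

/-- A walker is only delayed by missing edges. -/
theorem le_walker_add_missing {t₀ a d : ℕ} (h : walker E p m t₀ a d < m) :
    d + a ≤ walker E p m t₀ a d +
      ∑ q ∈ Ico a (walker E p m t₀ a d + 1), missing E t₀ d (p q) (p (q + 1)) := by
  induction d with
  | zero => simp [walker]
  | succ d ih =>
    have hmono : ∀ s : Finset ℕ, ∑ q ∈ s, missing E t₀ d (p q) (p (q + 1)) ≤
        ∑ q ∈ s, missing E t₀ (d + 1) (p q) (p (q + 1)) :=
      fun s => sum_le_sum fun q _ => missing_mono (Nat.le_succ d)
    have ha := le_walker (E := E) (p := p) (m := m) t₀ a d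
    have hlt : walker E p m t₀ a d < m := (walker_le_succ t₀ a d).trans_lt h
    have ih := ih hlt
    set w := walker E p m t₀ a d with hw
    -- Either the walker advances, or the edge in front of it, which already occurs in the sum, is
    -- missing once more.
    by_cases hE : E (t₀ + d) (p w) (p (w + 1))
    · have e1 : walker E p m t₀ a (d + 1) = w + 1 := by rw [walker, if_pos ⟨hlt, hE⟩]
      rw [e1, sum_Ico_succ_top (by omega)]
      have := hmono (Ico a (w + 1))
      omega
    · have e1 : walker E p m t₀ a (d + 1) = w := by rw [walker, if_neg (fun h => hE h.2)]
      rw [e1, sum_Ico_succ_top ha]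
      rw [sum_Ico_succ_top ha] at ih
      have := hmono (Ico a w)
      have e2 : missing E t₀ (d + 1) (p w) (p (w + 1)) =
          missing E t₀ d (p w) (p (w + 1)) + 1 := by
        rw [missing_add]; simp [missing, hE]
      omega

/-- Summing the delay bound over the first `i` segments. Since a segment starts one past the last
position of the previous walker, the edge at which that walker stopped is charged to the previous
segment only; the charged edges are distinct. -/
theorem mul_le_segmentStart {t₀ i : ℕ} (h : segmentStart E p m D t₀ i ≤ m) :
    i * D ≤ segmentStart E p m D t₀ i +
      ∑ q ∈ range (segmentStart E p m D t₀ i), missing E t₀ D (p q) (p (q + 1)) := by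
  induction i with
  | zero => simp
  | succ i ih =>
    rw [segmentStart] at h ⊢
    set a := segmentStart E p m D t₀ i with ha
    have h1 := le_walker (E := E) (p := p) (m := m) t₀ a D
    have h2 := le_walker_add_missing (E := E) (p := p) (m := m) (t₀ := t₀) (a := a) (d := D)
      (by omega)
    have h3 := ih (by omega)
    rw [← sum_range_add_sum_Ico _ (show a ≤ walker E p m t₀ a D + 1 by omega), Nat.add_mul,
      one_mul]
    omega

theorem le_segmentStart (t₀ i : ℕ) : i ≤ segmentStart E p m D t₀ i := by
  induction i with
  | zero => simp
  | succ i ih =>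
    rw [segmentStart]
    have := le_walker (E := E) (p := p) (m := m) t₀ (segmentStart E p m D t₀ i) D
    omega

theorem segmentStart_strictMono (t₀ : ℕ) : StrictMono (segmentStart E p m D t₀) :=
  strictMono_nat_of_lt_succ fun i => by
    rw [segmentStart]
    have := le_walker (E := E) (p := p) (m := m) t₀ (segmentStart E p m D t₀ i) D
    omega

theorem mem_starts {t₀ y : ℕ} :
    y ∈ starts E p m D t₀ ↔ y ≤ m ∧ ∃ i, segmentStart E p m D t₀ i = y := by
  simp [starts]

theorem zero_mem_starts (t₀ : ℕ) : 0 ∈ starts E p m D t₀ :=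
  mem_starts.2 ⟨Nat.zero_le _, 0, rfl⟩

/-- This is why a traversed segment reaches up to the next mark: the position following it is itself
marked. -/
theorem succ_walker_mem_starts {t₀ a : ℕ} (ha : a ∈ starts E p m D t₀)
    (h : walker E p m t₀ a D + 1 ≤ m) : walker E p m t₀ a D + 1 ∈ starts E p m D t₀ := by
  obtain ⟨_, i, rfl⟩ := mem_starts.1 ha
  exact mem_starts.2 ⟨h, i + 1, rfl⟩

/-- The segments tile the tour: take the last segment that starts at or before `y`. -/
theorem exists_starts {t₀ y : ℕ} (hy : y ≤ m) :
    ∃ a ∈ starts E p m D t₀, a ≤ y ∧ y ≤ walker E p m t₀ a D := by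
  have hex : ∃ i, y < segmentStart E p m D t₀ i := ⟨y + 1, le_segmentStart t₀ (y + 1)⟩
  classical
  obtain ⟨i, hi⟩ : ∃ i, Nat.find hex = i + 1 := by
    refine Nat.exists_eq_succ_of_ne_zero fun h => ?_
    have := Nat.find_spec hex
    rw [h] at this
    simp [segmentStart] at this
  have h1 := Nat.find_spec hex
  rw [hi, segmentStart] at h1
  have h2 := Nat.find_min hex (m := i) (by omega)
  exact ⟨_, mem_starts.2 ⟨by omega, i, rfl⟩, by omega, by omega⟩

/-- All segments but the last use up their full time `D` before position `m`, and this time is spent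
on at most `m` moves and on missing edges. -/
theorem card_starts_mul_le (t₀ : ℕ) :
    #(starts E p m D t₀) * D ≤ D + m + ∑ q ∈ range m, missing E t₀ D (p q) (p (q + 1)) := by
  have hex : ∃ i, m < segmentStart E p m D t₀ i := ⟨m + 1, le_segmentStart t₀ (m + 1)⟩
  classical
  obtain ⟨i, hi⟩ : ∃ i, Nat.find hex = i + 1 := by
    refine Nat.exists_eq_succ_of_ne_zero fun h => ?_
    have := Nat.find_spec hex
    rw [h] at this
    simp [segmentStart] at this
  have h1 := Nat.find_spec hex
  have h2 := Nat.find_min hex (m := i) (by omega)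
  rw [hi] at h1
  have hsub : starts E p m D t₀ ⊆ (range (i + 1)).image (segmentStart E p m D t₀) := by
    intro y hy
    obtain ⟨h3, l, rfl⟩ := mem_starts.1 hy
    refine mem_image.2 ⟨l, mem_range.2 ?_, rfl⟩
    exact (segmentStart_strictMono (E := E) (p := p) (m := m) (D := D) t₀).lt_iff_lt.1
      (h3.trans_lt h1)
  have hcard : #(starts E p m D t₀) ≤ i + 1 :=
    (card_le_card hsub).trans (card_image_le.trans (by simp))
  have h3 := mul_le_segmentStart (E := E) (p := p) (D := D) (t₀ := t₀) (i := i) (m := m) (by omega)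
  have h4 : ∑ q ∈ range (segmentStart E p m D t₀ i), missing E t₀ D (p q) (p (q + 1)) ≤
      ∑ q ∈ range m, missing E t₀ D (p q) (p (q + 1)) :=
    sum_le_sum_of_subset (range_subset_range.2 (by omega))
  calc _ ≤ (i + 1) * D := Nat.mul_le_mul_right _ hcard
    _ = i * D + D := by ring
    _ ≤ _ := by omega

/-- If the segment with the largest number of elements of `U` is removed, then `U` shrinks by a
factor that depends on the number of segments. -/
theorem card_sdiff_segment_le {t₀ a : ℕ} {U : Finset ℕ} (hU : U ⊆ range (m + 1))
    (ha : ∀ a' ∈ starts E p m D t₀, #(U ∩ Icc a' (walker E p m t₀ a' D)) ≤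
      #(U ∩ Icc a (walker E p m t₀ a D))) :
    (#(U \ Icc a (walker E p m t₀ a D)) : ℝ) ≤
      #U * Real.exp (-(1 / (#(starts E p m D t₀) : ℝ))) := by
  set S := starts E p m D t₀
  set I := Icc a (walker E p m t₀ a D)
  -- Pigeonhole: the segments cover the tour, and none contains more of `U` than the chosen one.
  have h1 : #U ≤ #S * #(U ∩ I) := by
    have : U ⊆ S.biUnion fun a' => U ∩ Icc a' (walker E p m t₀ a' D) := by
      intro y hy
      obtain ⟨a', h1, h2, h3⟩ := exists_starts (E := E) (p := p) (D := D) (t₀ := t₀)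
        (Nat.lt_succ_iff.1 (mem_range.1 (hU hy)))
      exact mem_biUnion.2 ⟨a', h1, mem_inter.2 ⟨hy, mem_Icc.2 ⟨h2, h3⟩⟩⟩
    exact (card_le_card this).trans (card_biUnion_le_card_mul _ _ _ ha)
  have hS : (0 : ℝ) < #S := by exact_mod_cast card_pos.2 ⟨0, zero_mem_starts t₀⟩
  have h2 : #(U \ I) + #(U ∩ I) = #U := card_sdiff_add_card_inter U I
  have h3 : (#U : ℝ) / #S ≤ #(U ∩ I) := by
    rw [div_le_iff₀ hS, mul_comm]; exact_mod_cast h1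
  have h4 : (#(U \ I) : ℝ) + #(U ∩ I) = #U := by exact_mod_cast h2
  have h5 := Real.add_one_le_exp (-(1 / (#S : ℝ)))
  calc (#(U \ I) : ℝ) ≤ #U - #U / #S := by linarith
    _ = #U * (-(1 / (#S : ℝ)) + 1) := by ring
    _ ≤ _ := mul_le_mul_of_nonneg_left h5 (Nat.cast_nonneg _)

end Tour

/-! ### Counting segments over all phases -/

section Phases

variable {E : ℕ → ℕ → ℕ → Prop} {p : ℕ → ℕ} {n m k M : ℕ}

/-- The windows in which the tour is followed are disjoint parts of the first `3 * n * M` time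
steps. -/
theorem sum_missing_le (n M u x : ℕ) :
    ∑ j ∈ range M, missing E (3 * n * j + n) (2 * n) u x ≤ missing E 0 (3 * n * M) u x := by
  induction M with
  | zero => simp
  | succ M ih =>
    rw [sum_range_succ, Nat.mul_succ, missing_add, zero_add,
      show 3 * n = n + 2 * n by ring, missing_add]
    rw [show 3 * n = n + 2 * n by ring] at ih
    omega

/-- A phase costs `2n + m ≤ 4n` plus its missing edges. In total this is at most `4nM + 6knM ≤ 5kM *
2n`, using `k ≥ 1`. -/
theorem sum_card_starts_le (hn : 0 < n) (hk : 1 ≤ k) (hm : m ≤ 2 * n)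
    (h : ∑ q ∈ range m, missing E 0 (3 * n * M) (p q) (p (q + 1)) ≤ 2 * k * (3 * n * M)) :
    ∑ j ∈ range M, #(starts E p m (2 * n) (3 * n * j + n)) ≤ 5 * k * M := by
  refine Nat.le_of_mul_le_mul_right (c := 2 * n) ?_ (by omega)
  rw [sum_mul]
  calc _ ≤ ∑ j ∈ range M, (4 * n +
        ∑ q ∈ range m, missing E (3 * n * j + n) (2 * n) (p q) (p (q + 1))) :=
        sum_le_sum fun j _ => (card_starts_mul_le _).trans (by omega)
    _ = M * (4 * n) + ∑ q ∈ range m, ∑ j ∈ range M,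
          missing E (3 * n * j + n) (2 * n) (p q) (p (q + 1)) := by
        rw [sum_add_distrib, sum_comm]; simp
    _ ≤ M * (4 * n) + ∑ q ∈ range m, missing E 0 (3 * n * M) (p q) (p (q + 1)) := by
        gcongr; exact sum_missing_le _ _ _ _
    _ ≤ M * (4 * n) + 2 * k * (3 * n * M) := by omega
    _ ≤ 5 * k * M * (2 * n) := by nlinarith [Nat.mul_le_mul_right (M * n) hk]

/-- The inequality between arithmetic and harmonic mean, in the form needed for the exponent. -/
theorem neg_sum_inv_le {r : ℕ → ℝ} {c : ℝ} (hr : ∀ j, 0 < r j) (hc : 0 < c)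
    (h : ∑ j ∈ range M, r j ≤ c * M) : -∑ j ∈ range M, 1 / r j ≤ -(M / c) := by
  -- The convex function `1 / r` lies above its tangent at `r = c`.
  have h1 : ∀ j ∈ range M, 2 / c - r j / c ^ 2 ≤ 1 / r j := by
    intro j _
    have := hr j
    rw [sub_le_iff_le_add, div_add_div _ _ (by positivity) (by positivity),
      div_le_div_iff₀ (by positivity) (by positivity)]
    nlinarith [mul_nonneg hc.le (sq_nonneg (c - r j))]
  have h2 := sum_le_sum h1
  rw [sum_sub_distrib, ← sum_div (range M) r, sum_const, card_range, nsmul_eq_mul] at h2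
  have h3 : (∑ j ∈ range M, r j) / c ^ 2 ≤ c * M / c ^ 2 := by gcongr
  have h4 : (M : ℝ) * (2 / c) - c * M / c ^ 2 = M / c := by field_simp; ring
  linarith

/-- With sufficiently many phases, everything is covered. -/
theorem mul_exp_lt_one {k M : ℕ} (hk : 1 ≤ k) (hM : 80 * (k * Real.log (k + 1)) ≤ M) :
    (5 * k * M : ℝ) * Real.exp (-(M / (5 * k : ℝ))) < 1 := by
  have hk' : (1 : ℝ) ≤ k := by exact_mod_cast hk
  set x : ℝ := M / (5 * k) with hx
  have hMx : (M : ℝ) = 5 * k * x := by rw [hx]; field_simp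
  have hx1 : 16 * Real.log (k + 1) ≤ x := by
    rw [hx, le_div_iff₀ (by positivity)]; linarith
  have h1 : x / 2 < Real.exp (x / 2) := by linarith [Real.add_one_le_exp (x / 2)]
  -- The quantity to be bounded is `(x / 2) * (50 * k ^ 2) * exp (-x)`. One factor `exp (x / 2)`
  -- absorbs `x / 2` and the other one absorbs `50 * k ^ 2`; the latter needs `x / 2 ≥ 8 * log (k +
  -- 1)`.
  have h2 : (50 * k ^ 2 : ℝ) ≤ Real.exp (x / 2) := by
    calc (50 * k ^ 2 : ℝ) ≤ (k + 1) ^ 8 := by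
          have : (2 : ℝ) ^ 6 ≤ (k + 1) ^ 6 := by gcongr; linarith
          calc (50 * k ^ 2 : ℝ) ≤ 2 ^ 6 * (k + 1) ^ 2 := by nlinarith
            _ ≤ (k + 1) ^ 6 * (k + 1) ^ 2 := by gcongr
            _ = (k + 1) ^ 8 := by ring
      _ = Real.exp (8 * Real.log (k + 1)) := by
          rw [mul_comm, Real.exp_mul, Real.exp_log (by positivity)]; norm_cast
      _ ≤ Real.exp (x / 2) := Real.exp_le_exp.2 (by linarith)
  have h3 : Real.exp (-x) * (Real.exp (x / 2) * Real.exp (x / 2)) = 1 := by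
    rw [← Real.exp_add, ← Real.exp_add]; simp
  have h4 := Real.exp_pos (-x)
  calc (5 * k * M : ℝ) * Real.exp (-x) = Real.exp (-x) * (x / 2 * (50 * k ^ 2)) := by
        rw [hMx]; ring
    _ < Real.exp (-x) * (Real.exp (x / 2) * Real.exp (x / 2)) := by
        refine mul_lt_mul_of_pos_left ?_ h4
        exact mul_lt_mul h1 h2 (by positivity) (Real.exp_pos _).le
    _ = 1 := h3

end Phases

end TemporalGraph

/-! ## Exchanging edges -/

open Classical in
/-- The total weight of the ordered pairs of adjacent vertices. -/
noncomputable def SimpleGraph.pairSum {V : Type*} [Fintype V] (w : V → V → ℕ) (F : SimpleGraph V) : ℕ :=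
  ∑ u, ∑ x, if F.Adj u x then w u x else 0

/-- Before it first enters `S`, the walk stays outside `S`, so it does not use the entering edge,
which has an end in `S`. -/
theorem SimpleGraph.Walk.exists_first_crossing {V : Type*} {F : SimpleGraph V} {S : Set V} {y s : V}
    (q : F.Walk y s) (hs : s ∈ S) (hy : y ∉ S) :
    ∃ a ∈ S, ∃ b ∉ S, F.Adj b a ∧ (F.deleteEdges {s(b, a)}).Reachable y b := by
  induction q with
  | nil => exact absurd hs hy
  | @cons y z s h q ih =>
    by_cases hz : z ∈ S
    · exact ⟨z, hz, y, hy, h, .refl _⟩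
    · obtain ⟨a, ha, b, hb, hab, hr⟩ := ih hs hz
      refine ⟨a, ha, b, hb, hab, .trans (SimpleGraph.Adj.reachable ?_) hr⟩
      rw [SimpleGraph.deleteEdges_adj]
      refine ⟨h, fun he => ?_⟩
      have : a ∈ s(y, z) := by
        rw [Set.mem_singleton_iff.1 he]; simp
      rcases Sym2.mem_iff.1 this with rfl | rfl
      exacts [hy ha, hz ha]

/-- If a cheapest edge `ux` that leaves `S` is contracted, then some edge, which is at least as
expensive, becomes redundant for reaching `S`. -/
theorem SimpleGraph.exists_exchange {V : Type*} [Fintype V] {w : V → V → ℕ} (hw : ∀ a b, w a b = w b a)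
    {F : SimpleGraph V} {S : Set V} (hF : ∀ y, ∃ s ∈ S, F.Reachable y s) {u x : V} (hx : x ∉ S)
    (hmin : ∀ a ∈ S, ∀ b ∉ S, w u x ≤ w a b) :
    ∃ F' : SimpleGraph V, (∀ y, ∃ s ∈ insert x S, F'.Reachable y s) ∧
      F'.pairSum w + 2 * w u x ≤ F.pairSum w := by
  classical
  obtain ⟨s, hs, ⟨q⟩⟩ := hF x
  obtain ⟨a, ha, b, hb, hab, hr⟩ := q.exists_first_crossing hs hx
  have hne : b ≠ a := by rintro rfl; exact hb ha
  refine ⟨F.deleteEdges {s(b, a)}, fun y => ?_, ?_⟩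
  · obtain ⟨s', hs', ⟨q'⟩⟩ := hF y
    induction q' with
    | nil => exact ⟨_, Set.mem_insert_of_mem _ hs', .refl _⟩
    | @cons y z _ h _ ih =>
      -- A walk that used the deleted edge either stands at `b`, which is still connected to `x`, or
      -- at `a`, which lies in `S`.
      by_cases he : s(y, z) = s(b, a)
      · have : y ∈ s(b, a) := by rw [← he]; simp
        rcases Sym2.mem_iff.1 this with rfl | rfl
        · exact ⟨x, Set.mem_insert _ _, hr.symm⟩
        · exact ⟨_, Set.mem_insert_of_mem _ ha, .refl _⟩
      · obtain ⟨s₁, h₁, h₂⟩ := ih hs'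
        refine ⟨s₁, h₁, .trans (SimpleGraph.Adj.reachable ?_) h₂⟩
        rw [SimpleGraph.deleteEdges_adj]
        exact ⟨h, he⟩
  · have key : ∀ c d, ((if (F.deleteEdges {s(b, a)}).Adj c d then w c d else 0) +
        ((if c = b then if d = a then w b a else 0 else 0) +
          if c = a then if d = b then w a b else 0 else 0)) =
        if F.Adj c d then w c d else 0 := by
      intro c d
      simp only [SimpleGraph.deleteEdges_adj, Set.mem_singleton_iff, Sym2.eq_iff]
      by_cases h1 : c = b ∧ d = a
      · obtain ⟨rfl, rfl⟩ := h1
        simp [hab, hne]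
      by_cases h2 : c = a ∧ d = b
      · obtain ⟨rfl, rfl⟩ := h2
        simp [hab.symm, hne.symm]
      have h3 : ¬(c = b ∧ d = a ∨ c = a ∧ d = b) := by tauto
      rw [if_congr (and_iff_left h3) rfl rfl]
      have e1 : (if c = b then if d = a then w b a else 0 else 0) = 0 := by
        split_ifs <;> tauto
      have e2 : (if c = a then if d = b then w a b else 0 else 0) = 0 := by
        split_ifs <;> tauto
      rw [e1, e2, add_zero, add_zero]
    have h1 : F.pairSum w = (F.deleteEdges {s(b, a)}).pairSum w + (w b a + w a b) := by
      unfold SimpleGraph.pairSum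
      simp_rw [← key, Finset.sum_add_distrib]
      simp [Finset.sum_ite_eq']
    have := hmin a ha b hb
    rw [h1, hw b a]
    omega

namespace TemporalGraph

open Finset

/-! ## Reachability in time -/

/-- The vertex `y` can be reached from `u` in the time steps `t, …, t + e - 1`. -/
def CanReach (E : ℕ → ℕ → ℕ → Prop) (n y : ℕ) : ℕ → ℕ → ℕ → Prop
  | _, 0, u => u = y
  | t, e + 1, u => CanReach E n y (t + 1) e u ∨ ∃ w < n, E t u w ∧ CanReach E n y (t + 1) e w

/-- Going back one time step, the set of vertices from which `y` can be reached never shrinks, and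
it gains a vertex unless it is everything, because some edge of the snapshot leaves it. So `n - 1`
steps suffice. -/
theorem canReach_of_connected {E : ℕ → ℕ → ℕ → Prop} {n y e t : ℕ} (hy : y < n)
    (hE : ∀ t' < t + e, ∀ S ⊆ range n, S.Nonempty → S ≠ range n →
      ∃ u < n, u ∉ S ∧ ∃ w ∈ S, E t' u w) (he : n ≤ e + 1) {u : ℕ} (hu : u < n) :
    CanReach E n y t e u := by
  classical
  have key : ∀ e t, (∀ t' < t + e, ∀ S ⊆ range n, S.Nonempty → S ≠ range n →
      ∃ u < n, u ∉ S ∧ ∃ w ∈ S, E t' u w) →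
      min n (e + 1) ≤ #{u ∈ range n | CanReach E n y t e u} := by
    intro e
    induction e with
    | zero =>
      intro t _
      have : 0 < #{u ∈ range n | CanReach E n y t 0 u} :=
        card_pos.2 ⟨y, mem_filter.2 ⟨mem_range.2 hy, rfl⟩⟩
      omega
    | succ e ih =>
      intro t hE
      have h1 := ih (t + 1) fun t' ht' => hE t' (by omega)
      set S := {u ∈ range n | CanReach E n y (t + 1) e u} with hS
      have hsub : S ⊆ {u ∈ range n | CanReach E n y t (e + 1) u} :=
        monotone_filter_right _ fun u _ h => Or.inl h
      by_cases hall : S = range n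
      · have := card_le_card hsub
        rw [hall, card_range] at this
        exact (min_le_left _ _).trans this
      · have hne : S.Nonempty := card_pos.1 (by omega)
        obtain ⟨u, hu, huS, w, hwS, hEuw⟩ := hE t (by omega) S (filter_subset _ _) hne hall
        have hw := mem_filter.1 hwS
        have : insert u S ⊆ {u ∈ range n | CanReach E n y t (e + 1) u} := by
          refine insert_subset (mem_filter.2 ⟨mem_range.2 hu, ?_⟩) hsub
          exact Or.inr ⟨w, mem_range.1 hw.1, hEuw, hw.2⟩
        have := card_le_card this
        rw [card_insert_of_notMem huS] at this
        omega
  have h1 := key e t hE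
  have h2 : {u ∈ range n | CanReach E n y t e u} = range n :=
    eq_of_subset_of_card_le (filter_subset _ _) (by rw [card_range]; omega)
  exact (mem_filter.1 (h2 ▸ mem_range.2 hu)).2

/-! ## Vertices as natural numbers -/

variable {n L : ℕ}

/-- Adjacency in the snapshot with index `t`, for vertices that are given as numbers. -/
def NatAdj (G : TemporalGraph (Fin n) L) (t u w : ℕ) : Prop :=
  ∃ (ht : t < L) (hu : u < n) (hw : w < n), (G ⟨t, ht⟩).Adj ⟨u, hu⟩ ⟨w, hw⟩

theorem NatAdj.symm {G : TemporalGraph (Fin n) L} (t u w : ℕ) (h : G.NatAdj t u w) :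
    G.NatAdj t w u := by
  obtain ⟨ht, hu, hw, h⟩ := h
  exact ⟨ht, hw, hu, h.symm⟩

-- Uniqueness of the digits `t, u, w` of the index, as `u` and `w` are less than `n`.
open Classical in
theorem adjacencyArray_apply (G : TemporalGraph (Fin n) L) (t : ℕ) {u w : ℕ} (hu : u < n)
    (hw : w < n) :
    G.adjacencyArray ((t * n + u) * n + w) = if G.NatAdj t u w then 1 else 0 := by
  unfold adjacencyArray
  refine if_congr ⟨?_, ?_⟩ rfl rfl
  · rintro ⟨i, u', w', h, hadj⟩
    have hn : 0 < n := by omega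
    have h1 : (t * n + u) * n + w = (i * n + u') * n + w' := h
    have e1 : t * n + u = i * n + u' := by
      have := congrArg (· / n) h1
      simpa [Nat.add_div_of_dvd_right, Nat.mul_add_div, mul_comm _ n, hn, hw,
        Nat.div_eq_of_lt] using this
    have e2 : w = w' := by rw [e1] at h1; omega
    have e3 : t = i := by
      have := congrArg (· / n) e1
      simpa [Nat.mul_add_div, mul_comm _ n, hn, hu, Nat.div_eq_of_lt] using this
    have e4 : u = u' := by rw [e3] at e1; omega
    subst e2 e3 e4
    exact ⟨i.2, hu, hw, hadj⟩
  · rintro ⟨ht, hu, hw, h⟩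
    exact ⟨⟨t, ht⟩, ⟨u, hu⟩, ⟨w, hw⟩, rfl, h⟩

theorem AlwaysConnected.exists_natAdj {G : TemporalGraph (Fin n) L} (hG : G.AlwaysConnected)
    {t : ℕ} (ht : t < L) {S : Finset ℕ} (hS : S ⊆ range n) (hne : S.Nonempty)
    (hS' : S ≠ range n) : ∃ u < n, u ∉ S ∧ ∃ w ∈ S, G.NatAdj t u w := by
  obtain ⟨w, hw⟩ := hne
  obtain ⟨u, hu, huS⟩ : ∃ u < n, u ∉ S := by
    by_contra! h
    exact hS' (subset_antisymm hS fun u hu => h u (mem_range.1 hu))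
  have hwn := mem_range.1 (hS hw)
  obtain ⟨q⟩ := (hG ⟨t, ht⟩).preconnected ⟨u, hu⟩ ⟨w, hwn⟩
  obtain ⟨d, -, h1, h2⟩ := q.exists_boundary_dart {a | (a : ℕ) ∉ S} huS (by simpa using hw)
  exact ⟨d.fst, d.fst.2, h1, d.snd, by simpa using h2, ht, d.fst.2, d.snd.2, d.adj⟩

/-- Double counting: each snapshot lacks at most `k` edges of `T`, and every edge counts as two
ordered pairs. -/
theorem pairSum_missing_le {G : TemporalGraph (Fin n) L} {T : SimpleGraph (Fin n)} {k H : ℕ}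
    (hT : ∀ i, SnapshotDeficient k T (G i)) (hH : H ≤ L) :
    T.pairSum (fun u x : Fin n => missing G.NatAdj 0 H u x) ≤ 2 * k * H := by
  classical
  have key : ∀ t ∈ range H, (∑ u : Fin n, ∑ x : Fin n,
      if T.Adj u x then (if G.NatAdj (0 + t) u x then 0 else 1) else 0) ≤ 2 * k := by
    intro t ht
    have htL : t < L := (mem_range.1 ht).trans_le hH
    have h1 : ∀ u : Fin n, (∑ x : Fin n,
        if T.Adj u x then (if G.NatAdj (0 + t) u x then 0 else 1) else 0) =
        (T \ G ⟨t, htL⟩).degree u := by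
      intro u
      rw [← SimpleGraph.card_neighborFinset_eq_degree, card_eq_sum_ones,
        SimpleGraph.neighborFinset_eq_filter, sum_filter]
      refine sum_congr rfl fun x _ => ?_
      have : G.NatAdj (0 + t) u x ↔ (G ⟨t, htL⟩).Adj u x := by
        rw [zero_add]
        exact ⟨fun ⟨_, _, _, h⟩ => h, fun h => ⟨htL, u.2, x.2, h⟩⟩
      simp only [SimpleGraph.sdiff_adj, this]
      split_ifs <;> tauto
    rw [sum_congr rfl fun u _ => h1 u, SimpleGraph.sum_degrees_eq_twice_card_edges]
    have h2 := hT ⟨t, htL⟩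
    rw [SnapshotDeficient, ← SimpleGraph.edgeSet_sdiff, ← SimpleGraph.coe_edgeFinset,
      Set.encard_coe_eq_coe_finsetCard] at h2
    refine Nat.mul_le_mul_left 2 (le_of_eq_of_le ?_ (Nat.cast_le.1 h2))
    congr!
  calc T.pairSum (fun u x : Fin n => missing G.NatAdj 0 H u x)
      = ∑ t ∈ range H, ∑ u : Fin n, ∑ x : Fin n,
        if T.Adj u x then (if G.NatAdj (0 + t) u x then 0 else 1) else 0 := by
        rw [sum_comm]
        unfold SimpleGraph.pairSum missing
        refine sum_congr rfl fun u _ => ?_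
        rw [sum_comm]
        refine sum_congr rfl fun x _ => ?_
        split_ifs <;> simp
    _ ≤ ∑ t ∈ range H, 2 * k := sum_le_sum key
    _ = 2 * k * H := by simp [mul_comm]

/-- A sequence of positions, in which consecutive positions are equal or adjacent, yields a
temporal walk. -/
theorem exists_walk_of_positions (G : TemporalGraph (Fin n) L) (v : Fin n) {pos τ : ℕ → ℕ}
    {H : ℕ} (hH : H ≤ L) (h0 : pos 0 = v)
    (hstep : ∀ t < H, pos (t + 1) = pos t ∨ G.NatAdj t (pos t) (pos (t + 1)))
    (hcov : ∀ x < n, ∃ t ≤ H, pos t = x)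
    (hτ : ∀ i < Nat.count (fun t => pos (t + 1) ≠ pos t) H, τ i < H ∧ pos (τ i + 1) ≠ pos (τ i) ∧
      Nat.count (fun t => pos (t + 1) ≠ pos t) (τ i) = i) :
    ∃ W : G.Walk v, W.length = Nat.count (fun t => pos (t + 1) ≠ pos t) H ∧
      (∀ i : Fin W.length, (W.time i : ℕ) = τ i ∧ (W.vertex i.succ : ℕ) = pos (τ i + 1)) ∧
      Function.Surjective W.vertex ∧ W.length ≤ H ∧ ∀ i, (W.time i : ℕ) + 1 ≤ H := by
  set P : ℕ → Prop := fun t => pos (t + 1) ≠ pos t with hP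
  have hlt : ∀ t ≤ H, pos t < n := by
    intro t
    induction t with
    | zero => intro _; rw [h0]; exact v.2
    | succ t ih =>
      intro ht
      rcases hstep t ht with h | ⟨_, _, h, _⟩
      · rw [h]; exact ih (by omega)
      · exact h
  set vert : ℕ → ℕ := fun i => if i = 0 then v else pos (τ (i - 1) + 1) with hvert
  have hcount : ∀ t, P t → t < H → τ (Nat.count P t) = t := by
    intro t ht htH
    have h1 := hτ (Nat.count P t) (Nat.count_strict_mono ht htH)
    exact Nat.count_injective h1.2.1 ht h1.2.2
  -- At time `t` the explorer has made as many moves as there were changes of position before `t`,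
  -- so waiting can be left out.
  have hpos : ∀ t ≤ H, pos t = vert (Nat.count P t) := by
    intro t
    induction t with
    | zero => intro _; simp [hvert, h0]
    | succ t ih =>
      intro ht
      by_cases h : P t
      · rw [Nat.count_succ, if_pos h]
        simp only [hvert, Nat.add_eq_zero_iff, one_ne_zero, and_false, if_false,
          Nat.add_sub_cancel]
        rw [hcount t h ht]
      · rw [Nat.count_succ, if_neg h, add_zero, ← ih (by omega)]
        exact not_not.1 h
  have hvlt : ∀ i ≤ Nat.count P H, vert i < n := by
    intro i hi
    simp only [hvert]
    split_ifs with h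
    · exact v.2
    · exact hlt _ (hτ (i - 1) (show i - 1 < Nat.count P H by omega)).1
  let W : G.Walk v :=
    { length := Nat.count P H
      vertex := fun i => ⟨vert i, hvlt i (Nat.lt_succ_iff.1 i.2)⟩
      time := fun i => ⟨τ i, (hτ i i.2).1.trans_le hH⟩
      start := by ext; simp [hvert]
      time_strictMono := by
        intro i j hij
        by_contra h
        have h1 := Nat.count_monotone P (not_lt.1 h)
        simp only at h1
        rw [(hτ i i.2).2.2, (hτ j j.2).2.2] at h1
        exact absurd hij (not_lt.2 h1)
      adj := by
        intro i
        obtain ⟨h1, h2, h3⟩ := hτ i i.2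
        obtain ⟨h4, h5, h6, h7⟩ := (hstep _ h1).resolve_left h2
        have e1 : vert (i.castSucc : ℕ) = pos (τ i) := by
          rw [hpos _ h1.le, h3]; rfl
        have e2 : vert (i.succ : ℕ) = pos (τ i + 1) := by simp [hvert]
        convert h7 using 2 }
  refine ⟨W, rfl, fun i => ⟨rfl, by simp [W, hvert]⟩, fun x => ?_, Nat.count_le P,
    fun i => (hτ i i.2).1⟩
  obtain ⟨t, ht, h⟩ := hcov x x.2
  refine ⟨⟨Nat.count P t, Nat.lt_succ_iff.2 (Nat.count_monotone P ht)⟩, Fin.ext ?_⟩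
  exact (hpos t ht).symm.trans h

end TemporalGraph

/-! ## The algorithm -/

namespace TemporalGraph

namespace Explore

open RAM RAM.Cmd RAM.Exp

/-! The registers `0, 1, 2` and the array `0` hold the input.  The array `3` is the table of the
multiples of `n`, register `3` tells whether the exploration has been found, register `4` is the
number of phases, register `5` the number of time steps of these phases. The array `4` and
register `7` are the tour and its last position, the array `6` the set of vertices on the tour, the
array `7` the marks, the array `8` the table for reachability, and the array `9` the sequence of
positions. -/

/-- Adjacency of `u` and `w` in the snapshot with index `t`. -/
def adjExp (t u w : Exp) : Exp := cell 0 (add (cell 3 (add (cell 3 t) u)) w)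

/-- Nonzero if and only if the values are different. -/
def neExp (e₁ e₂ : Exp) : Exp := add (sub e₁ e₂) (sub e₂ e₁)

/-- Twice the number of vertices. -/
def twiceExp : Exp := add (reg 0) (reg 0)

/-- Three times the number of vertices. -/
def thriceExp : Exp := add twiceExp (reg 0)

/-- Computes the multiples of `n`. -/
def multiples : Cmd :=
  block [assign 12 (const 0), assign 13 (const 0),
    .forTo 10 (reg 1) (.forTo 11 (reg 0) (block
      [store 3 (reg 12) (reg 13),
        assign 13 (add (reg 13) (reg 0)),
        assign 12 (add (reg 12) (const 1))]))]

/-- Computes the number of time steps in which an edge is missing. -/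
def weigh : Cmd :=
  block [assign 14 (const 0),
    .forTo 15 (reg 5) (assign 14
      (add (reg 14) (sub (const 1) (adjExp (reg 15) (reg 12) (reg 13)))))]

/-- Finds the cheapest edge between the tour and the rest. -/
def findCheapest : Cmd :=
  -- One more than any possible weight, so that the first candidate is always accepted.
  block [assign 16 (add (reg 5) (const 1)),
    .forTo 10 (add (reg 7) (const 1)) (.forTo 11 (reg 0) (ite (cell 6 (reg 11)) skip (block
      [assign 12 (cell 4 (reg 10)), assign 13 (reg 11), weigh,
        ite (sub (reg 16) (reg 14))
          (block [assign 16 (reg 14), assign 17 (reg 10), assign 18 (reg 11)]) skip])))]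

/-- Adds a detour over the cheapest edge to the tour. -/
def extendTour : Cmd :=
  block [.forTo 10 (add (reg 7) (const 3))
      (ite (sub (add (reg 17) (const 1)) (reg 10)) (store 5 (reg 10) (cell 4 (reg 10)))
        (ite (sub (reg 10) (add (reg 17) (const 1)))
          (store 5 (reg 10) (cell 4 (sub (reg 10) (const 2))))
          (store 5 (reg 10) (reg 18)))),
    .forTo 10 (add (reg 7) (const 3)) (store 4 (reg 10) (cell 5 (reg 10))),
    store 6 (reg 18) (const 1),
    assign 7 (add (reg 7) (const 2))]

/-- Computes a tour that traverses each edge of a minimum spanning tree twice. -/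
def buildTour : Cmd :=
  block [.forTo 10 (reg 0) (store 6 (reg 10) (const 0)),
    store 6 (reg 2) (const 1), store 4 (const 0) (reg 2), assign 7 (const 0),
    .forTo 19 (sub (reg 0) (const 1)) (seq findCheapest extendTour)]

/-- Follows the tour from the position in register `20`, starting at the time in register `21`, and
writes the positions to the array `A`. -/
def follow (A : ℕ) : Cmd :=
  block [assign 22 (reg 20),
    .forTo 23 twiceExp (block
      [ite (sub (reg 7) (reg 22))
          (ite (adjExp (add (reg 21) (reg 23)) (cell 4 (reg 22))
            (cell 4 (add (reg 22) (const 1)))) (assign 22 (add (reg 22) (const 1))) skip) skip,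
        store A (add (add (reg 21) (reg 23)) (const 1)) (cell 4 (reg 22))])]

/-- Executes a command for all segments. -/
def forSegments (c : Cmd) : Cmd :=
  block [assign 20 (const 0),
    -- The number of segments is not known in advance; `2n` iterations are enough since first
    -- positions strictly increase, and surplus iterations are skipped.
    .forTo 25 twiceExp (ite (sub (add (reg 7) (const 1)) (reg 20))
      (block [follow 10, c, assign 20 (add (reg 22) (const 1))]) skip)]

/-- Marks the first positions of the segments of all phases. -/
def markStarts : Cmd :=
  block [.forTo 10 twiceExp (store 7 (reg 10) (const 0)),
    assign 21 (reg 0),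
    .forTo 24 (reg 4) (block
      [forSegments (store 7 (reg 20) (const 1)),
        assign 21 (add (reg 21) thriceExp)])]

/-- Counts the marks of a segment, and compares with the best segment so far. -/
def compareSegment : Cmd :=
  block [assign 30 (const 0),
    .forTo 31 (sub (add (reg 22) (const 1)) (reg 20))
      (assign 30 (add (reg 30) (cell 7 (add (reg 20) (reg 31))))),
    ite (sub (reg 30) (reg 28)) (block [assign 28 (reg 30), assign 29 (reg 20)]) skip]

/-- Removes the marks of a segment. -/
def clearSegment : Cmd :=
  .forTo 31 (sub (add (reg 22) (const 1)) (reg 20))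
    (store 7 (add (reg 20) (reg 31)) (const 0))

/-- Computes the entry of the reachability table for the vertex in register `10` in the row in
register `33` from the next row. -/
def reachEntry : Cmd :=
  block [assign 34 (cell 8 (add (cell 3 (add (reg 33) (const 1))) (reg 10))),
    .forTo 11 (reg 0) (ite (adjExp (add (reg 27) (reg 33)) (reg 10) (reg 11))
      (ite (cell 8 (add (cell 3 (add (reg 33) (const 1))) (reg 11)))
        (assign 34 (const 1)) skip) skip),
    store 8 (add (cell 3 (reg 33)) (reg 10)) (reg 34)]

/-- Computes from where, and when, the first position of the best segment can be reached. -/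
def reachTable : Cmd :=
  block [.forTo 10 (reg 0) (ite (neExp (reg 10) (cell 4 (reg 29)))
      (store 8 (add (cell 3 (reg 0)) (reg 10)) (const 0))
      (store 8 (add (cell 3 (reg 0)) (reg 10)) (const 1))),
    .forTo 32 (reg 0) (block
      [assign 33 (sub (sub (reg 0) (const 1)) (reg 32)), .forTo 10 (reg 0) reachEntry])]

/-- Walks to the first position of the best segment. -/
def approach : Cmd :=
  .forTo 32 (reg 0) (block
    [assign 35 (reg 26),
      .forTo 11 (reg 0) (ite (adjExp (add (reg 27) (reg 32)) (reg 26) (reg 11))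
        (ite (cell 8 (add (cell 3 (add (reg 32) (const 1))) (reg 11)))
          (assign 35 (reg 11)) skip) skip),
      assign 26 (reg 35),
      store 9 (add (add (reg 27) (reg 32)) (const 1)) (reg 26)])

/-- A phase of the exploration. -/
def phase : Cmd :=
  block [assign 21 (add (reg 27) (reg 0)), assign 28 (const 0), assign 29 (const 0),
    forSegments compareSegment,
    -- The positions on the tour are recorded before the approach that precedes them in time; the
    -- two parts write to disjoint ranges of array `9`.
    assign 20 (reg 29), follow 9, clearSegment, reachTable, approach,
    assign 26 (cell 4 (reg 22)),
    assign 27 (add (reg 27) thriceExp)]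

/-- All phases of the exploration. -/
def phases : Cmd :=
  block [assign 26 (reg 2), assign 27 (const 0), store 9 (const 0) (reg 2),
    .forTo 24 (reg 4) phase]

/-- Tests whether all marks have been removed. -/
def testMarks : Cmd :=
  block [assign 30 (const 0),
    .forTo 31 twiceExp (assign 30 (add (reg 30) (cell 7 (reg 31)))),
    assign 3 (sub (const 1) (reg 30))]

/-- Attempts to find an exploration with the number of phases in register `4`. -/
def attempt : Cmd := block [buildTour, markStarts, phases, testMarks]

/-- Writes the sequence of moves. -/
def writeMoves : Cmd :=
  block [assign 37 (const 0),
    .forTo 38 (reg 5) (ite (neExp (cell 9 (add (reg 38) (const 1))) (cell 9 (reg 38)))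
      (block [store 1 (reg 37) (reg 38), store 2 (reg 37) (cell 9 (add (reg 38) (const 1))),
        assign 37 (add (reg 37) (const 1))]) skip),
    assign 0 (reg 37)]

/-- The exploration algorithm. -/
def main : Cmd :=
  block [multiples,
    -- The parameter `k` is unknown, so the number of phases grows by one per attempt until register
    -- `3` reports success.
    .forTo 36 (reg 1) (ite (reg 3) skip (block
      [assign 4 (add (reg 4) (const 1)), assign 5 (add (reg 5) thriceExp), attempt])),
    writeMoves]

/-- A finite syntactic check; it is what makes `exists_run` applicable to the whole algorithm. -/
theorem main_wf : main.WF = true := by decide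

/-! ### The environment -/

variable {n L : ℕ} {G : TemporalGraph (Fin n) L} {v : Fin n} {s s' : State}

/-- The input and the table of multiples are present. -/
structure Env (G : TemporalGraph (Fin n) L) (v : Fin n) (s : State) : Prop where
  -- Ensures that loops over vertices and over tour positions are not cut off by register `1`.
  three_mul_le : 3 * n ≤ L
  reg_zero : s.reg 0 = n
  reg_one : s.reg 1 = L
  reg_two : s.reg 2 = v
  arr_zero : s.arr 0 = G.adjacencyArray
  arr_three : ∀ i < L * n, s.arr 3 i = i * n

theorem Env.of_eq (h : Env G v s) (h0 : s'.reg 0 = s.reg 0) (h1 : s'.reg 1 = s.reg 1)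
    (h2 : s'.reg 2 = s.reg 2) (h3 : s'.arr 0 = s.arr 0) (h4 : s'.arr 3 = s.arr 3) :
    Env G v s' :=
  ⟨h.1, h0 ▸ h.2, h1 ▸ h.3, h2 ▸ h.4, h3 ▸ h.5, h4 ▸ h.6⟩

theorem Env.frame (h : Env G v s) {c : Cmd} (hf : c.Frame s s')
    (h0 : c.writesReg 0 = false := by rfl) (h1 : c.writesReg 1 = false := by rfl)
    (h2 : c.writesReg 2 = false := by rfl) (h3 : c.writesArr 0 = false := by rfl)
    (h4 : c.writesArr 3 = false := by rfl) : Env G v s' :=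
  h.of_eq (hf.reg _ h0) (hf.reg _ h1) (hf.reg _ h2) (hf.arr _ h3) (hf.arr _ h4)

theorem Env.run (h : Env G v s) (c : Cmd)
    (h0 : c.writesReg 0 = false := by rfl) (h1 : c.writesReg 1 = false := by rfl)
    (h2 : c.writesReg 2 = false := by rfl) (h3 : c.writesArr 0 = false := by rfl)
    (h4 : c.writesArr 3 = false := by rfl) : Env G v (c.run s) :=
  h.frame (frame_run c s) h0 h1 h2 h3 h4

theorem Env.setReg (h : Env G v s) (x : ℕ) {a : ℕ} (h0 : 0 ≠ x := by decide)
    (h1 : 1 ≠ x := by decide) (h2 : 2 ≠ x := by decide) : Env G v (s.setReg x a) :=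
  h.of_eq (Function.update_of_ne h0 _ _) (Function.update_of_ne h1 _ _)
    (Function.update_of_ne h2 _ _) rfl rfl

theorem Env.setCell (h : Env G v s) (A : ℕ) {i a : ℕ} (h0 : 0 ≠ A := by decide)
    (h3 : 3 ≠ A := by decide) : Env G v (s.setCell A i a) :=
  h.of_eq rfl rfl rfl (Function.update_of_ne h0 _ _) (Function.update_of_ne h3 _ _)

theorem Env.multiple (h : Env G v s) {i : ℕ} (hi : i < L) : s.arr 3 i = i * n :=
  h.arr_three i (hi.trans_le (Nat.le_mul_of_pos_right _ v.pos))

open Classical in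
theorem Env.eval_adjExp (h : Env G v s) {e₁ e₂ e₃ : Exp} {t u w : ℕ} (ht : e₁.eval s = t)
    (hu : e₂.eval s = u) (hw : e₃.eval s = w) (htL : t < L) (hun : u < n) (hwn : w < n) :
    (adjExp e₁ e₂ e₃).eval s = if G.NatAdj t u w then 1 else 0 := by
  simp only [adjExp, Exp.eval, ht, hu, hw]
  rw [h.multiple htL, h.arr_three, h.arr_zero, adjacencyArray_apply G _ hun hwn]
  calc t * n + u < t * n + n := by omega
    _ = (t + 1) * n := by ring
    _ ≤ L * n := Nat.mul_le_mul_right _ htL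

theorem eval_neExp (e₁ e₂ : Exp) : (neExp e₁ e₂).eval s ≠ 0 ↔ e₁.eval s ≠ e₂.eval s := by
  simp only [neExp, Exp.eval]
  omega

theorem Env.eval_twiceExp (h : Env G v s) : twiceExp.eval s = 2 * n := by
  simp only [twiceExp, Exp.eval, h.reg_zero]
  omega

theorem Env.eval_thriceExp (h : Env G v s) : thriceExp.eval s = 3 * n := by
  simp only [thriceExp, Exp.eval, h.eval_twiceExp, h.reg_zero]
  omega

/-- The machine cannot multiply, so addresses in the adjacency matrices are computed from a table
that is filled by repeated addition. -/
theorem multiples_env (hL : 3 * n ≤ L) : Env G v (multiples.run (G.input v)) := by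
  have hf := frame_run multiples (G.input v)
  refine ⟨hL, hf.reg 0 rfl, hf.reg 1 rfl, hf.reg 2 rfl, hf.arr 0 rfl, ?_⟩
  have key := run_for (x := 10) (e := reg 1) (N := L)
    (c := .forTo 11 (reg 0) (block
      [store 3 (reg 12) (reg 13), assign 13 (add (reg 13) (reg 0)),
        assign 12 (add (reg 12) (const 1))]))
    (s := ((G.input v).setReg 12 0).setReg 13 0)
    (fun i s => s.reg 12 = i * n ∧ s.reg 13 = i * n * n ∧ ∀ j < i * n, s.arr 3 j = j * n)
    rfl (by simp [input]) (by simp [input]) (by simp) ?_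
  · exact key.2.2
  · intro i s' hi hx hfr ⟨h1, h2, h3⟩
    have key2 := run_for (x := 11) (e := reg 0) (N := n)
      (c := block
        [store 3 (reg 12) (reg 13), assign 13 (add (reg 13) (reg 0)),
          assign 12 (add (reg 12) (const 1))])
      (s := s')
      (fun k s => s.reg 12 = i * n + k ∧ s.reg 13 = (i * n + k) * n ∧
        ∀ j < i * n + k, s.arr 3 j = j * n)
      rfl (by simp [hfr.reg 0 rfl, input]) (by rw [hfr.reg 1 rfl]; simp [input]; omega)
      (by simpa [h1, h2] using h3) ?_
    · simpa [Nat.succ_mul] using key2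
    · intro k s'' hk hx' hfr' ⟨g1, g2, g3⟩
      have h0 : s''.reg 0 = n := by rw [hfr'.reg 0 rfl, hfr.reg 0 rfl]; simp [input]
      refine ⟨by simp [block, run, g1, add_assoc], ?_, ?_⟩
      · simp [block, run, g2, h0]; ring
      · intro j hj
        simp only [block, run, State.setReg_arr, State.setCell_arr, Function.update_self,
          Exp.eval, g1, g2]
        rcases Nat.lt_succ_iff_lt_or_eq.1 (show j < (i * n + k) + 1 from hj) with hj | rfl
        · rw [Function.update_of_ne (by omega), g3 j hj]
        · simp

theorem weigh_spec (h : Env G v s) (hH : s.reg 5 ≤ L) (hu : s.reg 12 < n) (hx : s.reg 13 < n) :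
    (weigh.run s).reg 14 = missing G.NatAdj 0 (s.reg 5) (s.reg 12) (s.reg 13) := by
  have key := run_for (x := 15) (e := reg 5) (N := s.reg 5)
    (c := assign 14 (add (reg 14) (sub (const 1) (adjExp (reg 15) (reg 12) (reg 13)))))
    (s := s.setReg 14 0)
    (fun i s' => s'.reg 14 = missing G.NatAdj 0 i (s.reg 12) (s.reg 13))
    rfl (by simp) (by simpa [h.reg_one] using hH) (by simp [missing]) ?_
  · exact key
  · intro i s' hi hx' hfr ih
    have hE : Env G v s' := (h.setReg 14).frame hfr
    have e1 : s'.reg 12 = s.reg 12 := (hfr.reg 12 rfl).trans (by simp)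
    have e2 : s'.reg 13 = s.reg 13 := (hfr.reg 13 rfl).trans (by simp)
    simp only [run, Exp.eval]
    rw [hE.eval_adjExp (e₁ := reg 15) (e₂ := reg 12) (e₃ := reg 13) hx' e1 e2 (by omega) hu hx]
    simp only [State.setReg_reg, ne_eq, Nat.reduceEqDiff, not_false_eq_true,
      Function.update_of_ne, Function.update_self, ih]
    rw [missing_add]
    congr 1
    simp only [missing, Finset.range_one, Finset.sum_singleton, add_zero, zero_add]
    split_ifs <;> simp_all

/-! ### The tour -/

/-- The state of the search for the cheapest edge after the pairs in `R` have been considered. -/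
def Cheapest (G : TemporalGraph (Fin n) L) (p S : ℕ → ℕ) (H : ℕ) (R : ℕ → ℕ → Prop)
    (s : State) : Prop :=
  (∀ q y, R q y → y < n → S y = 0 → s.reg 16 ≤ missing G.NatAdj 0 H (p q) y) ∧
    (s.reg 16 = H + 1 ∨ R (s.reg 17) (s.reg 18) ∧ s.reg 18 < n ∧ S (s.reg 18) = 0 ∧
      s.reg 16 = missing G.NatAdj 0 H (p (s.reg 17)) (s.reg 18))

theorem findCheapest_spec (h : Env G v s) (hH : s.reg 5 ≤ L) (hm : s.reg 7 + 1 ≤ L)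
    (hp : ∀ q ≤ s.reg 7, s.arr 4 q < n) (hS : ∃ x < n, s.arr 6 x = 0) :
    let s' := findCheapest.run s
    s'.reg 17 ≤ s.reg 7 ∧ s'.reg 18 < n ∧ s.arr 6 (s'.reg 18) = 0 ∧
      ∀ q ≤ s.reg 7, ∀ y < n, s.arr 6 y = 0 →
        missing G.NatAdj 0 (s.reg 5) (s.arr 4 (s'.reg 17)) (s'.reg 18) ≤
          missing G.NatAdj 0 (s.reg 5) (s.arr 4 q) y := by
  set test : Cmd := ite (cell 6 (reg 11)) skip (block
      [assign 12 (cell 4 (reg 10)), assign 13 (reg 11), weigh,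
        ite (sub (reg 16) (reg 14))
          (block [assign 16 (reg 14), assign 17 (reg 10), assign 18 (reg 11)]) skip]) with htest
  set C := Cheapest G (s.arr 4) (s.arr 6) (s.reg 5) with hC
  have key := run_for (x := 10) (e := add (reg 7) (const 1)) (N := s.reg 7 + 1)
    (c := .forTo 11 (reg 0) test) (s := s.setReg 16 (s.reg 5 + 1))
    (fun i => C fun q _ => q < i)
    rfl (by simp) (by simpa [h.reg_one] using hm) (by simp [hC, Cheapest]) ?_
  · have e1 : (Cmd.forTo 10 (add (reg 7) (const 1)) (.forTo 11 (reg 0) test)).run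
      (s.setReg 16 (s.reg 5 + 1)) = findCheapest.run s := rfl
    rw [e1] at key
    obtain ⟨h1, h2⟩ := key
    obtain ⟨x, hx, hSx⟩ := hS
    have h3 := h1 0 x (Nat.succ_pos _) hx hSx
    have h4 := missing_le (E := G.NatAdj) 0 (s.reg 5) (s.arr 4 0) x
    -- A vertex outside the tour exists, and its weight is at most `s.reg 5`, so the initial value
    -- of register `16` has been replaced.
    obtain ⟨h5, h6, h7, h8⟩ := h2.resolve_left (by omega)
    exact ⟨Nat.lt_succ_iff.1 h5, h6, h7, fun q hq y hy hSy =>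
      h8 ▸ h1 q y (Nat.lt_succ_iff.2 hq) hy hSy⟩
  · intro i s₁ hi hx hfr hinv
    have hE₁ : Env G v s₁ := (h.setReg 16).frame hfr
    have key2 := run_for (x := 11) (e := reg 0) (N := n) (c := test) (s := s₁)
      (fun j => C fun q y => q < i ∨ q = i ∧ y < j)
      rfl (by simp [hE₁.reg_zero]) (by rw [hE₁.reg_one]; have := h.three_mul_le; omega)
      (by simpa [hC, Cheapest] using hinv) ?_
    · obtain ⟨h1, h2⟩ := key2
      refine ⟨fun q y hq hy hSy => h1 q y ?_ hy hSy, ?_⟩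
      · change q < i + 1 at hq
        omega
      · simp only [State.setReg_reg, ne_eq, Nat.reduceEqDiff, not_false_eq_true,
          Function.update_of_ne]
        refine h2.imp_right fun h3 => ⟨?_, h3.2⟩
        have := h3.1
        omega
    · intro j s₂ hj hx₂ hfr₂ hinv₂
      have hE₂ : Env G v s₂ := hE₁.frame hfr₂
      have r10 : s₂.reg 10 = i := (hfr₂.reg 10 rfl).trans hx
      have r5 : s₂.reg 5 = s.reg 5 := (hfr₂.reg 5 rfl).trans ((hfr.reg 5 rfl).trans (by simp))
      have a4 : s₂.arr 4 = s.arr 4 := (hfr₂.arr 4 rfl).trans (hfr.arr 4 rfl)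
      have a6 : s₂.arr 6 = s.arr 6 := (hfr₂.arr 6 rfl).trans (hfr.arr 6 rfl)
      obtain ⟨h1, h2⟩ := hinv₂
      by_cases hSj : s.arr 6 j = 0
      · have hw := weigh_spec (s := (s₂.setReg 12 (s.arr 4 i)).setReg 13 j)
          ((hE₂.setReg 12).setReg 13) (by simpa [r5] using hH)
          (by simpa using hp i (by omega)) (by simpa using hj)
        have hwf := frame_run weigh ((s₂.setReg 12 (s.arr 4 i)).setReg 13 j)
        set s₃ := weigh.run ((s₂.setReg 12 (s.arr 4 i)).setReg 13 j) with hs₃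
        have b16 : s₃.reg 16 = s₂.reg 16 := (hwf.reg 16 rfl).trans (by simp)
        have b17 : s₃.reg 17 = s₂.reg 17 := (hwf.reg 17 rfl).trans (by simp)
        have b18 : s₃.reg 18 = s₂.reg 18 := (hwf.reg 18 rfl).trans (by simp)
        have b10 : s₃.reg 10 = i := (hwf.reg 10 rfl).trans (by simp [r10])
        have b11 : s₃.reg 11 = j := (hwf.reg 11 rfl).trans (by simp [hx₂])
        simp only [State.setReg_reg, Function.update_self, ne_eq, Nat.reduceEqDiff,
          not_false_eq_true, Function.update_of_ne, r5] at hw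
        have hrun : test.run s₂ = if s₂.reg 16 - missing G.NatAdj 0 (s.reg 5) (s.arr 4 i) j ≠ 0
            then ((s₃.setReg 16 (missing G.NatAdj 0 (s.reg 5) (s.arr 4 i) j)).setReg 17 i).setReg
              18 j else s₃ := by
          rw [htest, run, if_neg (by simp [hx₂, a6, hSj])]
          simp only [block, run, Exp.eval, State.setReg_reg, r10, hx₂, a4, ← hs₃, hw, b16, b10,
            b11, ne_eq, Nat.reduceEqDiff, not_false_eq_true, Function.update_of_ne]
        rw [hrun]
        split_ifs with hlt
        · refine ⟨fun q y hq hy hSy => ?_, .inr ?_⟩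
          · simp only [State.setReg_reg, ne_eq, Nat.reduceEqDiff, not_false_eq_true,
              Function.update_of_ne, Function.update_self]
            by_cases hqy : q = i ∧ y = j
            · rw [hqy.1, hqy.2]
            · have := h1 q y (by omega) hy hSy
              omega
          · simp [hj, hSj]
        · refine ⟨fun q y hq hy hSy => ?_, ?_⟩
          · simp only [State.setReg_reg, ne_eq, Nat.reduceEqDiff, not_false_eq_true,
              Function.update_of_ne, b16]
            by_cases hqy : q = i ∧ y = j
            · rw [hqy.1, hqy.2]
              omega
            · exact h1 q y (by omega) hy hSy
          · simp only [State.setReg_reg, ne_eq, Nat.reduceEqDiff, not_false_eq_true,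
              Function.update_of_ne, b16, b17, b18]
            refine h2.imp_right fun h3 => ⟨?_, h3.2⟩
            have := h3.1
            omega
      · have hrun : test.run s₂ = s₂ := by
          rw [htest, run, if_pos (by simpa [hx₂, a6] using hSj)]
          rfl
        rw [hrun]
        refine ⟨fun q y hq hy hSy => ?_, ?_⟩
        · simp only [State.setReg_reg, ne_eq, Nat.reduceEqDiff, not_false_eq_true,
            Function.update_of_ne]
          have : ¬(q = i ∧ y = j) := by
            rintro ⟨-, rfl⟩
            exact hSj hSy
          exact h1 q y (by omega) hy hSy
        · simp only [State.setReg_reg, ne_eq, Nat.reduceEqDiff, not_false_eq_true,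
            Function.update_of_ne]
          refine h2.imp_right fun h3 => ⟨?_, h3.2⟩
          have := h3.1
          omega

/-- The tour `f`, with a detour from position `a` to `x`. -/
def detour (f : ℕ → ℕ) (a x i : ℕ) : ℕ :=
  if i ≤ a then f i else if i = a + 1 then x else f (i - 2)

/-- The detour replaces nothing: it inserts the two traversals of the edge between `f a` and `x`,
and shifts the rest by two positions. -/
theorem sum_detour (w : ℕ → ℕ → ℕ) (hw : ∀ a b, w a b = w b a) (f : ℕ → ℕ) (x : ℕ) {a m : ℕ}
    (ha : a ≤ m) : ∑ q ∈ Finset.range (m + 2), w (detour f a x q) (detour f a x (q + 1)) =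
      ∑ q ∈ Finset.range m, w (f q) (f (q + 1)) + 2 * w (f a) x := by
  obtain ⟨b, rfl⟩ := Nat.exists_eq_add_of_le ha
  rw [add_assoc, Finset.sum_range_add _ a (b + 2), Finset.sum_range_add _ a b,
    Finset.sum_range_succ' _ (b + 1), Finset.sum_range_succ' _ b]
  have h1 : ∀ q ∈ Finset.range a, w (detour f a x q) (detour f a x (q + 1)) =
      w (f q) (f (q + 1)) := by
    intro q hq
    have := Finset.mem_range.1 hq
    rw [detour, if_pos (by omega), detour, if_pos (by omega)]
  have h2 : ∀ q ∈ Finset.range b, w (detour f a x (a + (q + 1 + 1)))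
      (detour f a x (a + (q + 1 + 1) + 1)) = w (f (a + q)) (f (a + q + 1)) := by
    intro q _
    rw [detour, if_neg (by omega), if_neg (by omega), detour, if_neg (by omega),
      if_neg (by omega)]
    congr 2
  have h3 : detour f a x a = f a := if_pos le_rfl
  have h4 : detour f a x (a + 1) = x := by simp [detour]
  have h5 : detour f a x (a + 1 + 1) = f a := by simp [detour]
  rw [Finset.sum_congr rfl h1, Finset.sum_congr rfl h2]
  simp only [zero_add, add_zero, h3, h4, h5, ← add_assoc]
  rw [hw x (f a)]
  ring

theorem extendTour_spec (h : Env G v s) (hm : s.reg 7 + 3 ≤ L) :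
    let s' := extendTour.run s
    s'.reg 7 = s.reg 7 + 2 ∧ s'.arr 6 = Function.update (s.arr 6) (s.reg 18) 1 ∧
      ∀ i < s.reg 7 + 3, s'.arr 4 i = detour (s.arr 4) (s.reg 17) (s.reg 18) i := by
  set c₁ : Cmd := ite (sub (add (reg 17) (const 1)) (reg 10)) (store 5 (reg 10) (cell 4 (reg 10)))
        (ite (sub (reg 10) (add (reg 17) (const 1)))
          (store 5 (reg 10) (cell 4 (sub (reg 10) (const 2))))
          (store 5 (reg 10) (reg 18))) with hc₁
  set s₁ := (Cmd.forTo 10 (add (reg 7) (const 3)) c₁).run s with hs₁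
  have hf₁ := frame_run (.forTo 10 (add (reg 7) (const 3)) c₁) s
  rw [← hs₁] at hf₁
  have k₁ := run_for (x := 10) (e := add (reg 7) (const 3)) (N := s.reg 7 + 3) (c := c₁) (s := s)
    (fun i s' => ∀ j < i, s'.arr 5 j = detour (s.arr 4) (s.reg 17) (s.reg 18) j)
    rfl rfl (by simpa [h.reg_one] using hm) (by simp) fun i s' hi hx hfr ih j hj => by
      have e17 : s'.reg 17 = s.reg 17 := hfr.reg 17 rfl
      have e18 : s'.reg 18 = s.reg 18 := hfr.reg 18 rfl
      have e4 : s'.arr 4 = s.arr 4 := hfr.arr 4 rfl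
      have : c₁.run s' = s'.setCell 5 i (detour (s.arr 4) (s.reg 17) (s.reg 18) i) := by
        simp only [hc₁, run, Exp.eval, hx, e17, e18, e4, detour]
        split_ifs <;> first | rfl | omega
      rw [this]
      rcases Nat.lt_succ_iff_lt_or_eq.1 hj with hj | rfl
      · simpa [hj.ne] using ih j hj
      · simp
  have k₂ := run_for (x := 10) (e := add (reg 7) (const 3)) (N := s.reg 7 + 3)
    (c := store 4 (reg 10) (cell 5 (reg 10))) (s := s₁)
    (fun i s' => ∀ j < i, s'.arr 4 j = s₁.arr 5 j)
    rfl (by simp [hf₁.reg 7 rfl]) (by rw [hf₁.reg 1 rfl, h.reg_one]; exact hm) (by simp)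
    fun i s' hi hx hfr ih j hj => by
      have e5 : s'.arr 5 = s₁.arr 5 := hfr.arr 5 rfl
      rcases Nat.lt_succ_iff_lt_or_eq.1 hj with hj | rfl
      · simpa [run, hx, hj.ne] using ih j hj
      · simp [run, hx, e5]
  have hf₂ := frame_run (.forTo 10 (add (reg 7) (const 3)) (store 4 (reg 10) (cell 5 (reg 10)))) s₁
  set s₂ := (Cmd.forTo 10 (add (reg 7) (const 3)) (store 4 (reg 10) (cell 5 (reg 10)))).run s₁
  have e7 : s₂.reg 7 = s.reg 7 := (hf₂.reg 7 rfl).trans (hf₁.reg 7 rfl)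
  have e18 : s₂.reg 18 = s.reg 18 := (hf₂.reg 18 rfl).trans (hf₁.reg 18 rfl)
  have e6 : s₂.arr 6 = s.arr 6 := (hf₂.arr 6 rfl).trans (hf₁.arr 6 rfl)
  have hrun : extendTour.run s = (s₂.setCell 6 (s₂.reg 18) 1).setReg 7 (s₂.reg 7 + 2) := rfl
  rw [hrun]
  refine ⟨by simp [e7], by simp [e18, e6], fun i hi => ?_⟩
  simp only [State.setReg_arr, State.setCell_arr, ne_eq, Nat.reduceEqDiff, not_false_eq_true,
    Function.update_of_ne]
  rw [k₂ i hi, k₁ i hi]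

/-- The state of the construction of the tour after `i` steps; the graph `T` is used to bound the
weight. -/
def PartialTour (G : TemporalGraph (Fin n) L) (H : ℕ) (T : SimpleGraph (Fin n)) (i : ℕ)
    (s : State) : Prop :=
  s.reg 7 = 2 * i ∧ (∀ q ≤ 2 * i, s.arr 4 q < n ∧ s.arr 6 (s.arr 4 q) ≠ 0) ∧
    (∀ x < n, s.arr 6 x ≠ 0 → ∃ q ≤ 2 * i, s.arr 4 q = x) ∧
    Finset.card {x ∈ Finset.range n | s.arr 6 x ≠ 0} = i + 1 ∧
    ∃ F : SimpleGraph (Fin n), (∀ y, ∃ z ∈ {z : Fin n | s.arr 6 z ≠ 0}, F.Reachable y z) ∧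
      F.pairSum (fun u x : Fin n => missing G.NatAdj 0 H u x) +
        ∑ q ∈ Finset.range (2 * i), missing G.NatAdj 0 H (s.arr 4 q) (s.arr 4 (q + 1)) ≤
      T.pairSum (fun u x : Fin n => missing G.NatAdj 0 H u x)

theorem PartialTour.of_eq {H i : ℕ} {T : SimpleGraph (Fin n)} (h : PartialTour G H T i s)
    (h7 : s'.reg 7 = s.reg 7) (h4 : s'.arr 4 = s.arr 4) (h6 : s'.arr 6 = s.arr 6) :
    PartialTour G H T i s' := by
  unfold PartialTour
  rw [h7, h4, h6]
  exact h

/-- One step of Prim's algorithm. The tour becomes heavier by twice the cheapest leaving edge, and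
by `SimpleGraph.exists_exchange` the comparison graph `F` can give up at least as much while still
joining every vertex to the tour. -/
theorem PartialTour.extend {T : SimpleGraph (Fin n)} {i : ℕ} (h : Env G v s) (hH : s.reg 5 ≤ L)
    (hi : i < n - 1) (hs : PartialTour G (s.reg 5) T i s) :
    PartialTour G (s.reg 5) T (i + 1) ((seq findCheapest extendTour).run s) := by
  obtain ⟨h7, hp, hcov, hcard, F, hF, hsum⟩ := hs
  have hL := h.three_mul_le
  obtain ⟨y, hy, hSy⟩ : ∃ x < n, s.arr 6 x = 0 := by
    by_contra! hc
    rw [Finset.filter_true_of_mem fun x hx => hc x (Finset.mem_range.1 hx),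
      Finset.card_range] at hcard
    omega
  obtain ⟨ha, hx, hSx, hmin⟩ := findCheapest_spec h hH (by omega)
    (fun q hq => (hp q (by omega)).1) ⟨y, hy, hSy⟩
  have hf := frame_run findCheapest s
  set s₁ := findCheapest.run s
  have e7 : s₁.reg 7 = s.reg 7 := hf.reg 7 rfl
  have e4 : s₁.arr 4 = s.arr 4 := hf.arr 4 rfl
  have e6 : s₁.arr 6 = s.arr 6 := hf.arr 6 rfl
  obtain ⟨g7, g6, g4⟩ := extendTour_spec (h.frame hf) (by omega)
  have hrun : (seq findCheapest extendTour).run s = extendTour.run s₁ := rfl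
  rw [hrun]
  set s₂ := extendTour.run s₁
  rw [e7, h7] at g7 g4
  rw [e6] at g6
  rw [e4] at g4
  set a := s₁.reg 17
  set x := s₁.reg 18
  have hpa := hp a (by omega)
  have hS₂ : ∀ z, s₂.arr 6 z ≠ 0 ↔ z = x ∨ s.arr 6 z ≠ 0 := by
    intro z
    rw [g6]
    by_cases hz : z = x
    · simp [hz]
    · simp [hz]
  have hdet : ∀ q ≤ 2 * i + 2, detour (s.arr 4) a x q = x ∨
      ∃ q' ≤ 2 * i, detour (s.arr 4) a x q = s.arr 4 q' := by
    intro q hq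
    unfold detour
    split_ifs with h1 h2
    · exact .inr ⟨q, by omega, rfl⟩
    · exact .inl rfl
    · exact .inr ⟨q - 2, by omega, rfl⟩
  refine ⟨by omega, fun q hq => ?_, fun z hz hSz => ?_, ?_, ?_⟩
  · rw [g4 q (by omega), hS₂]
    rcases hdet q (by omega) with h1 | ⟨q', h1, h2⟩
    · exact ⟨by omega, .inl h1⟩
    · rw [h2]
      exact ⟨(hp q' h1).1, .inr (hp q' h1).2⟩
  · rcases (hS₂ z).1 hSz with rfl | h1
    · refine ⟨a + 1, by omega, ?_⟩
      rw [g4 _ (by omega)]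
      simp [detour]
    · obtain ⟨q, hq, rfl⟩ := hcov z hz h1
      by_cases hqa : q ≤ a
      · refine ⟨q, by omega, ?_⟩
        rw [g4 _ (by omega), detour, if_pos hqa]
      · refine ⟨q + 2, by omega, ?_⟩
        rw [g4 _ (by omega), detour, if_neg (by omega), if_neg (by omega), Nat.add_sub_cancel]
  · rw [← hcard, ← Finset.card_insert_of_notMem (a := x) (by simp [hSx])]
    congr 1
    ext z
    simp only [Finset.mem_filter, Finset.mem_insert, hS₂, Finset.mem_range]
    constructor
    · tauto
    · rintro (rfl | h1)
      exacts [⟨hx, .inl rfl⟩, ⟨h1.1, .inr h1.2⟩]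
  · set w : ℕ → ℕ → ℕ := missing G.NatAdj 0 (s.reg 5) with hw
    have hwc : ∀ a b, w a b = w b a := missing_comm NatAdj.symm 0 (s.reg 5)
    obtain ⟨F', hF', hle⟩ := SimpleGraph.exists_exchange (w := fun u x : Fin n => w u x)
      (u := ⟨s.arr 4 a, hpa.1⟩) (x := ⟨x, hx⟩) (fun a b => hwc a b) hF (by simpa using hSx)
      (by
        intro b hb c hc
        obtain ⟨q, hq, hqb⟩ := hcov b b.2 hb
        have := hmin q (by omega) c c.2 (by simpa using hc)
        rw [hqb] at this
        exact this)
    refine ⟨F', fun z => ?_, ?_⟩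
    · obtain ⟨z', h1, h2⟩ := hF' z
      refine ⟨z', (hS₂ z').2 ?_, h2⟩
      rcases h1 with rfl | h1
      exacts [.inl rfl, .inr h1]
    · have h1 : ∑ q ∈ Finset.range (2 * (i + 1)), w (s₂.arr 4 q) (s₂.arr 4 (q + 1)) =
          ∑ q ∈ Finset.range (2 * i + 2), w (detour (s.arr 4) a x q)
            (detour (s.arr 4) a x (q + 1)) := by
        refine Finset.sum_congr rfl fun q hq => ?_
        have := Finset.mem_range.1 hq
        rw [g4 _ (by omega), g4 _ (by omega)]
      rw [h1, sum_detour w hwc _ _ (by omega)]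
      simp only at hle
      omega

theorem buildTour_spec (h : Env G v s) (hH : s.reg 5 ≤ L) {T : SimpleGraph (Fin n)}
    (hT : T.Connected) :
    PartialTour G (s.reg 5) T (n - 1) (buildTour.run s) := by
  have hL := h.three_mul_le
  have hn := v.pos
  set s₁ := (Cmd.forTo 10 (reg 0) (store 6 (reg 10) (const 0))).run s with hs₁
  have k₁ := run_for (x := 10) (e := reg 0) (N := n) (c := store 6 (reg 10) (const 0)) (s := s)
    (fun i s' => ∀ j < i, s'.arr 6 j = 0)
    rfl h.reg_zero (by rw [h.reg_one]; omega) (by simp) fun i s' hi hx hfr ih j hj => by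
      rcases Nat.lt_succ_iff_lt_or_eq.1 hj with hj | rfl
      · simpa [run, hx, hj.ne] using ih j hj
      · simp [run, hx]
  have hf₁ := frame_run (.forTo 10 (reg 0) (store 6 (reg 10) (const 0))) s
  rw [← hs₁] at k₁ hf₁
  have hE₁ : Env G v s₁ := h.frame hf₁
  set s₂ := ((s₁.setCell 6 v 1).setCell 4 0 v).setReg 7 0 with hs₂
  have hE₂ : Env G v s₂ := ((hE₁.setCell 6).setCell 4).setReg 7
  have hrun : buildTour.run s =
      (Cmd.forTo 19 (sub (reg 0) (const 1)) (seq findCheapest extendTour)).run s₂ := by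
    have : s₂ = ((s₁.setCell 6 (s₁.reg 2) 1).setCell 4 0 (s₁.reg 2)).setReg 7 0 := by
      rw [hs₂, hE₁.reg_two]
    rw [this]
    rfl
  rw [hrun]
  refine run_for _ rfl (by simp [hE₂.reg_zero]) (by rw [hE₂.reg_one]; omega) ?_ ?_
  · have hS : ∀ z < n, s₂.arr 6 z ≠ 0 ↔ z = v := by
      intro z hz
      by_cases hzv : z = v
      · simp [hs₂, hzv]
      · simp [hs₂, hzv, k₁ z hz]
    refine PartialTour.of_eq (s := s₂) ?_ (by simp) rfl rfl
    refine ⟨by simp [hs₂], fun q hq => ?_, fun x hx hSx => ?_, ?_, T, fun y => ?_, by simp⟩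
    · obtain rfl : q = 0 := by omega
      have : s₂.arr 4 0 = v := by simp [hs₂]
      rw [this]
      exact ⟨v.2, (hS v v.2).2 rfl⟩
    · exact ⟨0, by omega, by rw [(hS x hx).1 hSx]; simp [hs₂]⟩
    · rw [Finset.card_eq_one]
      refine ⟨v, ?_⟩
      ext z
      simp only [Finset.mem_filter, Finset.mem_range, Finset.mem_singleton]
      constructor
      · exact fun hz => (hS z hz.1).1 hz.2
      · rintro rfl
        exact ⟨v.2, (hS v v.2).2 rfl⟩
    -- Initially the comparison graph is `T` itself and the tour has weight zero.
    · exact ⟨v, (hS v v.2).2 rfl, hT.preconnected y v⟩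
  · intro i s' hi _ hfr ih
    have r5 : s'.reg 5 = s.reg 5 := by
      rw [hfr.reg 5 rfl, hs₂, State.setReg_reg, Function.update_of_ne (by decide)]
      exact hf₁.reg 5 rfl
    rw [← r5] at ih ⊢
    exact (PartialTour.extend (hE₂.frame hfr) (by omega) hi ih).of_eq (by simp) rfl rfl

/-! ### Segments -/

/-- The memory contains a sequence of fewer than `2 * n` edges, to be used as a tour. -/
structure HasTour (n : ℕ) (s : State) : Prop where
  reg_lt : s.reg 7 < 2 * n
  arr_lt : ∀ q ≤ s.reg 7, s.arr 4 q < n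

theorem HasTour.of_eq (h : HasTour n s) (h7 : s'.reg 7 = s.reg 7)
    (h4 : s'.arr 4 = s.arr 4) : HasTour n s' :=
  ⟨h7 ▸ h.1, h7 ▸ h4 ▸ h.2⟩

/-- The array is a parameter because the command is used both for trial walks (array `10`) and for
the actual exploration (array `9`). The entry at the starting time is not written; it is supplied by
the approach. -/
theorem follow_spec {A : ℕ} (hA₀ : A ≠ 0) (hA₃ : A ≠ 3) (hA₄ : A ≠ 4) (h : Env G v s)
    (hT : HasTour n s) (ha : s.reg 20 ≤ s.reg 7) (ht : s.reg 21 + 2 * n ≤ L) :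
    let s' := (follow A).run s
    let w := walker G.NatAdj (s.arr 4) (s.reg 7) (s.reg 21) (s.reg 20)
    s'.reg 22 = w (2 * n) ∧ (∀ d < 2 * n, s'.arr A (s.reg 21 + d + 1) = s.arr 4 (w (d + 1))) ∧
      ∀ i, i ≤ s.reg 21 ∨ s.reg 21 + 2 * n < i → s'.arr A i = s.arr A i := by
  intro s₁ w
  set move : Cmd := ite (sub (reg 7) (reg 22))
          (ite (adjExp (add (reg 21) (reg 23)) (cell 4 (reg 22))
            (cell 4 (add (reg 22) (const 1)))) (assign 22 (add (reg 22) (const 1))) skip) skip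
    with hmove
  have h' : Env G v (s.setReg 22 (s.reg 20)) := h.setReg 22
  refine run_for (x := 23) (e := twiceExp) (N := 2 * n) (s := s.setReg 22 (s.reg 20))
    (c := block [move, store A (add (add (reg 21) (reg 23)) (const 1)) (cell 4 (reg 22))])
    (fun i s' => s'.reg 22 = w i ∧ (∀ d < i, s'.arr A (s.reg 21 + d + 1) = s.arr 4 (w (d + 1))) ∧
      ∀ i, i ≤ s.reg 21 ∨ s.reg 21 + 2 * n < i → s'.arr A i = s.arr A i)
    rfl h'.eval_twiceExp (by rw [h'.reg_one]; omega) ?_ ?_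
  · simp [w, walker]
  · intro i s₂ hi hx hfr ⟨ih22, ihA, ihA'⟩
    have hE : Env G v s₂ := h'.frame hfr (h3 := by simp [writesArr, block, move, hA₀])
      (h4 := by simp [writesArr, block, move, hA₃])
    have e4 : s₂.arr 4 = s.arr 4 := hfr.arr 4 (by simp [writesArr, block, move, hA₄])
    have e7 : s₂.reg 7 = s.reg 7 := (hfr.reg 7 rfl).trans (by simp)
    have e21 : s₂.reg 21 = s.reg 21 := (hfr.reg 21 rfl).trans (by simp)
    have hwle : w i ≤ s.reg 7 := walker_le ha i
    have hrun : move.run s₂ = s₂ ∧ w (i + 1) = w i ∨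
        move.run s₂ = s₂.setReg 22 (w (i + 1)) := by
      by_cases h1 : w i < s.reg 7
      · have e : move.run s₂ = (ite (adjExp (add (reg 21) (reg 23)) (cell 4 (reg 22))
            (cell 4 (add (reg 22) (const 1)))) (assign 22 (add (reg 22) (const 1))) skip).run
            s₂ := by
          rw [hmove, run, if_pos]
          simp only [Exp.eval, e7, ih22]
          omega
        rw [e, run, hE.eval_adjExp (t := s.reg 21 + i) (u := s.arr 4 (w i))
          (w := s.arr 4 (w i + 1)) (by simp [e21, hx]) (by simp [e4, ih22])
          (by simp [e4, ih22]) (by omega) (hT.arr_lt _ h1.le) (hT.arr_lt _ h1)]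
        by_cases h2 : G.NatAdj (s.reg 21 + i) (s.arr 4 (w i)) (s.arr 4 (w i + 1))
        · right
          have : w (i + 1) = w i + 1 := if_pos ⟨h1, h2⟩
          rw [if_pos h2, if_pos one_ne_zero, this]
          simp [run, ih22]
        · left
          have : w (i + 1) = w i := if_neg fun h => h2 h.2
          rw [if_neg h2]
          exact ⟨rfl, this⟩
      · left
        have e : move.run s₂ = s₂ := by
          rw [hmove, run, if_neg]
          · rfl
          · simp only [Exp.eval, e7, ih22]
            omega
        have : w (i + 1) = w i := if_neg fun h => h1 h.1
        exact ⟨e, this⟩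
    have hrun' : (block [move,
        store A (add (add (reg 21) (reg 23)) (const 1)) (cell 4 (reg 22))]).run s₂ =
        (s₂.setReg 22 (w (i + 1))).setCell A (s.reg 21 + i + 1) (s.arr 4 (w (i + 1))) := by
      rcases hrun with ⟨h1, h2⟩ | h1
      · have : s₂.setReg 22 (w (i + 1)) = s₂ := by
          rw [h2, ← ih22]
          simp [State.setReg]
        rw [this]
        simp only [block, run, h1, Exp.eval, e21, hx, e4, ih22, h2]
      · simp [block, run, h1, e21, hx, e4]
    rw [hrun']
    refine ⟨by simp, fun d hd => ?_, fun j hj => ?_⟩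
    · rcases Nat.lt_succ_iff_lt_or_eq.1 hd with hd | rfl
      · simpa [hd.ne] using ihA d hd
      · simp
    · have : j ≠ s.reg 21 + i + 1 := by omega
      simpa [this] using ihA' j hj

/-- An invariant rule for loops over segments. The invariant is indexed by the set of first
positions already handled; by `congr` it may not depend on the working registers and the array of
the trial walks. -/
theorem forSegments_spec {c : Cmd} (h : Env G v s) (hT : HasTour n s)
    (ht : s.reg 21 + 2 * n ≤ L)
    (hreg : ∀ y ∈ [0, 1, 2, 7, 20, 21, 22, 25], c.writesReg y = false)
    (harr : ∀ B ∈ [0, 3, 4], c.writesArr B = false)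
    (J : Finset ℕ → State → Prop)
    (congr : ∀ A s₁ s₂, (∀ y, y ∉ [20, 22, 23, 25] → s₂.reg y = s₁.reg y) →
      (∀ B ≠ 10, s₂.arr B = s₁.arr B) → J A s₁ → J A s₂)
    (zero : J ∅ s)
    (step : ∀ A, ∀ a ∈ starts G.NatAdj (s.arr 4) (s.reg 7) (2 * n) (s.reg 21), ∀ s₁,
      Env G v s₁ → (forSegments c).Frame s s₁ → s₁.reg 20 = a →
      s₁.reg 22 = walker G.NatAdj (s.arr 4) (s.reg 7) (s.reg 21) a (2 * n) →
      J A s₁ → J (insert a A) (c.run s₁)) :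
    J (starts G.NatAdj (s.arr 4) (s.reg 7) (2 * n) (s.reg 21)) ((forSegments c).run s) := by
  set S := starts G.NatAdj (s.arr 4) (s.reg 7) (2 * n) (s.reg 21) with hS
  set st := segmentStart G.NatAdj (s.arr 4) (s.reg 7) (2 * n) (s.reg 21) with hst
  have hmono : StrictMono st := segmentStart_strictMono _
  set b : Cmd := block [follow 10, c, assign 20 (add (reg 22) (const 1))] with hb
  set body : Cmd := ite (sub (add (reg 7) (const 1)) (reg 20)) b skip with hbody
  have h' : Env G v (s.setReg 20 0) := h.setReg 20
  have hwr : ∀ y ∈ [0, 1, 2, 7, 21, 25], body.writesReg y = false := by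
    intro y hy
    have h1 := hreg y (by fin_cases hy <;> simp)
    have h2 : (follow 10).writesReg y = false := by fin_cases hy <;> rfl
    have h3 : (20 == y) = false := by fin_cases hy <;> rfl
    simp [hbody, hb, writesReg, block, h1, h2, h3]
  have hwa : ∀ B ∈ [0, 3, 4], body.writesArr B = false := by
    intro B hB
    have h1 := harr B hB
    have h2 : (follow 10).writesArr B = false := by fin_cases hB <;> rfl
    simp [hbody, hb, writesArr, block, h1, h2]
  have hfor : ∀ y ∈ [0, 1, 2, 7, 21], (Cmd.forTo 25 twiceExp body).writesReg y = false := by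
    intro y hy
    rw [writesReg, hwr y (by fin_cases hy <;> simp)]
    fin_cases hy <;> rfl
  have key := run_for (x := 25) (e := twiceExp) (N := 2 * n) (s := s.setReg 20 0) (c := body)
    -- Either segment `i` is next, or all segments have been handled and register `20` is beyond the
    -- tour, so that later iterations do nothing.
    (fun i s' => s'.reg 20 = st i ∧ st i ≤ s.reg 7 ∧ J {y ∈ S | y < st i} s' ∨
      s.reg 7 < s'.reg 20 ∧ J S s')
    (hwr 25 (by simp)) h'.eval_twiceExp (by have := h.three_mul_le; rw [h'.reg_one]; omega) ?_ ?_
  · rcases key with ⟨_, h1, _⟩ | ⟨_, h1⟩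
    · have : 2 * n ≤ st (2 * n) := hmono.le_apply
      have := hT.reg_lt
      omega
    · exact h1
  · refine .inl ⟨by simp [hst, segmentStart], by simp [hst, segmentStart], ?_⟩
    have : ({y ∈ S | y < st 0} : Finset ℕ) = ∅ := by simp [hst, segmentStart]
    rw [this]
    refine congr _ s _ (fun y hy => ?_) (fun _ _ => rfl) zero
    simp only [List.mem_cons, List.not_mem_nil, or_false, not_or] at hy
    simp [hy]
  · intro i s₁ hi hx hfr ih
    have hE : Env G v s₁ := h'.frame hfr (hfor 0 (by simp)) (hfor 1 (by simp)) (hfor 2 (by simp))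
      (hwa 0 (by simp)) (hwa 3 (by simp))
    have e4 : s₁.arr 4 = s.arr 4 := hfr.arr 4 (hwa 4 (by simp))
    have e7 : s₁.reg 7 = s.reg 7 := (hfr.reg 7 (hfor 7 (by simp))).trans (by simp)
    have e21 : s₁.reg 21 = s.reg 21 := (hfr.reg 21 (hfor 21 (by simp))).trans (by simp)
    have hset : ∀ A s₂, J A s₂ → J A (s₂.setReg 25 (i + 1)) := fun A s₂ =>
      congr _ _ _ (fun y hy => by
        simp only [List.mem_cons, List.not_mem_nil, or_false, not_or] at hy
        simp [hy]) (fun _ _ => rfl)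
    rcases ih with ⟨h20, hle, hJ⟩ | ⟨hlt, hJ⟩
    · have hrun : body.run s₁ = b.run s₁ := by
        rw [hbody, run, if_pos]
        simp only [Exp.eval, e7, h20]
        omega
      have hfs := follow_spec (A := 10) (by decide) (by decide) (by decide) hE (hT.of_eq e7 e4)
        (by rw [h20, e7]; exact hle) (by rw [e21]; exact ht)
      have hff := frame_run (follow 10) s₁
      set s₂ := (follow 10).run s₁
      rw [e4, e7, e21, h20] at hfs
      have hJ₂ : J {y ∈ S | y < st i} s₂ := by
        refine congr _ _ _ (fun y hy => ?_) (fun B hB => ?_) hJ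
        · simp only [List.mem_cons, List.not_mem_nil, or_false, not_or] at hy
          refine hff.reg y ?_
          simp [follow, writesReg, block, Ne.symm hy.2.1, Ne.symm hy.2.2.1]
        · exact hff.arr B (by simp [follow, writesArr, block, hB.symm])
      have hmem : st i ∈ S := mem_starts.2 ⟨hle, i, rfl⟩
      have hJ₃ := step _ _ hmem s₂ (hE.run _) ⟨fun y hy => ?_, fun B hB => ?_⟩
        ((hff.reg 20 rfl).trans h20) hfs.1 hJ₂
      rotate_left
      · simp only [forSegments, block, writesReg, Bool.or_eq_false_iff] at hy
        rw [hff.reg y (by tauto), hfr.reg y, State.setReg_reg,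
          Function.update_of_ne (by rintro rfl; simp at hy)]
        simp only [hbody, hb, block, writesReg, Bool.or_eq_false_iff]
        tauto
      · simp only [forSegments, block, writesArr, Bool.or_eq_false_iff] at hB
        rw [hff.arr B (by tauto), hfr.arr B]
        · rfl
        · simp only [hbody, hb, block, writesArr, Bool.or_eq_false_iff]
          tauto
      have e22 : (c.run s₂).reg 22 + 1 = st (i + 1) := by
        rw [run_reg c (hreg 22 (by simp)), hfs.1]
        rfl
      have hrun' : b.run s₁ = (c.run s₂).setReg 20 (st (i + 1)) := by
        rw [← e22]
        rfl
      have hJ₄ : J (insert (st i) {y ∈ S | y < st i}) ((c.run s₂).setReg 20 (st (i + 1))) := by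
        refine congr _ (c.run s₂) _ (fun y hy => ?_) (fun _ _ => rfl) hJ₃
        simp only [List.mem_cons, List.not_mem_nil, or_false, not_or] at hy
        simp [hy]
      -- No segment starts strictly between `st i` and `st (i + 1)`.
      have hins : insert (st i) {y ∈ S | y < st i} = ({y ∈ S | y < st (i + 1)} : Finset ℕ) := by
        ext y
        simp only [Finset.mem_insert, Finset.mem_filter]
        constructor
        · rintro (rfl | ⟨h1, h2⟩)
          · exact ⟨hmem, hmono (Nat.lt_succ_self i)⟩
          · exact ⟨h1, h2.trans (hmono (Nat.lt_succ_self i))⟩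
        · rintro ⟨h1, h2⟩
          obtain ⟨_, l, rfl⟩ := mem_starts.1 h1
          have h3 : l < i + 1 := hmono.lt_iff_lt.1 h2
          rcases Nat.lt_succ_iff_lt_or_eq.1 h3 with h4 | rfl
          · exact .inr ⟨h1, hmono h4⟩
          · exact .inl rfl
      rw [hins] at hJ₄
      rw [hrun, hrun']
      by_cases h1 : st (i + 1) ≤ s.reg 7
      · exact .inl ⟨by simp, h1, hset _ _ hJ₄⟩
      · refine .inr ⟨by simp; omega, hset _ _ ?_⟩
        rwa [Finset.filter_true_of_mem] at hJ₄
        intro y hy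
        have := (mem_starts.1 hy).1
        omega
    · have hrun : body.run s₁ = s₁ := by
        rw [hbody, run, if_neg]
        · rfl
        · simp only [Exp.eval, e7]
          omega
      rw [hrun]
      exact .inr ⟨by simpa using hlt, hset _ _ hJ⟩

/-- The first positions of the segments of the first `M` phases. -/
noncomputable def allStarts (G : TemporalGraph (Fin n) L) (p : ℕ → ℕ) (m M : ℕ) : Finset ℕ :=
  (Finset.range M).biUnion fun j => starts G.NatAdj p m (2 * n) (3 * n * j + n)

theorem allStarts_succ (p : ℕ → ℕ) (m M : ℕ) : allStarts G p m (M + 1) =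
    allStarts G p m M ∪ starts G.NatAdj p m (2 * n) (3 * n * M + n) := by
  unfold allStarts
  rw [Finset.range_add_one, Finset.biUnion_insert, Finset.union_comm]

/-- The marks of all phases are known before the exploration begins, since the segments depend only
on the tour and the time window and not on the explorer. -/
theorem markStarts_spec (h : Env G v s) (hT : HasTour n s) (hM : 3 * n * s.reg 4 ≤ L) :
    ∀ y < 2 * n, (markStarts.run s).arr 7 y =
      if y ∈ allStarts G (s.arr 4) (s.reg 7) (s.reg 4) then 1 else 0 := by
  have hL := h.three_mul_le
  have hn := v.pos
  set s₁ := (Cmd.forTo 10 twiceExp (store 7 (reg 10) (const 0))).run s with hs₁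
  have k₁ := run_for (x := 10) (e := twiceExp) (N := 2 * n) (c := store 7 (reg 10) (const 0))
    (s := s) (fun i s' => ∀ j < i, s'.arr 7 j = 0)
    rfl h.eval_twiceExp (by rw [h.reg_one]; omega) (by simp) fun i s' hi hx hfr ih j hj => by
      rcases Nat.lt_succ_iff_lt_or_eq.1 hj with hj | rfl
      · simpa [run, hx, hj.ne] using ih j hj
      · simp [run, hx]
  have hf₁ := frame_run (.forTo 10 twiceExp (store 7 (reg 10) (const 0))) s
  rw [← hs₁] at k₁ hf₁
  have hE₁ : Env G v s₁ := h.frame hf₁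
  set s₂ := s₁.setReg 21 n with hs₂
  have hE₂ : Env G v s₂ := hE₁.setReg 21
  have f4 : s₂.reg 4 = s.reg 4 := (hf₁.reg 4 rfl)
  have f7 : s₂.reg 7 = s.reg 7 := (hf₁.reg 7 rfl)
  have fa4 : s₂.arr 4 = s.arr 4 := (hf₁.arr 4 rfl)
  set b : Cmd := block [forSegments (store 7 (reg 20) (const 1)),
    assign 21 (add (reg 21) thriceExp)] with hb
  have hrun : markStarts.run s = (Cmd.forTo 24 (reg 4) b).run s₂ := by
    rw [hs₂, ← hE₁.reg_zero]
    rfl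
  rw [hrun]
  have hML : s.reg 4 ≤ L := by nlinarith
  refine (run_for (x := 24) (e := reg 4) (s := s₂) (c := b) (N := s.reg 4) (fun j s' => s'.reg 21 = 3 * n * j + n ∧
    ∀ y < 2 * n, s'.arr 7 y = if y ∈ allStarts G (s.arr 4) (s.reg 7) j then 1 else 0)
    rfl f4 (by rw [hE₂.reg_one]; exact hML) ?_ ?_).2
  · refine ⟨by simp [hs₂], fun y hy => ?_⟩
    have : allStarts G (s.arr 4) (s.reg 7) 0 = ∅ := rfl
    rw [this]
    simpa [hs₂] using k₁ y hy
  · intro j s₃ hj _ hfr ⟨h21, h7⟩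
    have hE₃ : Env G v s₃ := hE₂.frame hfr
    have e7 : s₃.reg 7 = s.reg 7 := (hfr.reg 7 rfl).trans f7
    have e4 : s₃.arr 4 = s.arr 4 := (hfr.arr 4 rfl).trans fa4
    have hlt : 3 * n * j + 3 * n ≤ L := by
      calc 3 * n * j + 3 * n = 3 * n * (j + 1) := by ring
        _ ≤ 3 * n * s.reg 4 := Nat.mul_le_mul_left _ hj
        _ ≤ L := hM
    have key := forSegments_spec (c := store 7 (reg 20) (const 1)) hE₃ (hT.of_eq e7 e4)
      (by rw [h21]; omega) (fun _ _ => rfl) (by decide)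
      (fun A s' => ∀ y < 2 * n, s'.arr 7 y =
        if y ∈ allStarts G (s.arr 4) (s.reg 7) j ∪ A then 1 else 0)
      (fun A s₁ s₂ _ h2 h3 y hy => by rw [h2 7 (by decide), h3 y hy])
      (by simpa using h7)
      (fun A a ha s₄ _ _ h20 _ hJ y hy => by
        by_cases hya : y = a
        · simp [run, h20, hya]
        · simpa [run, h20, hya] using hJ y hy)
    have hff := frame_run (forSegments (store 7 (reg 20) (const 1))) s₃
    rw [e4, e7, h21, ← allStarts_succ] at key
    have hE₄ := hE₃.run (forSegments (store 7 (reg 20) (const 1)))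
    refine ⟨?_, ?_⟩
    · simp only [hb, block, run, Exp.eval, hE₄.eval_thriceExp, hff.reg 21 rfl, h21]
      simp
      ring
    · exact key

/-! ### Marks -/

/-- The positions in `U` are marked. -/
def Marks (n : ℕ) (U : Finset ℕ) (s : State) : Prop :=
  ∀ y < 2 * n, s.arr 7 y = if y ∈ U then 1 else 0

theorem Marks.of_eq {U : Finset ℕ} (h : Marks n U s) (h7 : s'.arr 7 = s.arr 7) :
    Marks n U s' := by
  intro y hy
  rw [h7, h y hy]

theorem compareSegment_spec {U : Finset ℕ} (h : Env G v s) (hU : Marks n U s)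
    (hab : s.reg 20 ≤ s.reg 22) (hb : s.reg 22 < 2 * n) :
    let s' := compareSegment.run s
    s'.reg 28 = max (s.reg 28) (Finset.card (U ∩ Finset.Icc (s.reg 20) (s.reg 22))) ∧
      (s'.reg 28 = s.reg 28 ∧ s'.reg 29 = s.reg 29 ∨
        s'.reg 28 = Finset.card (U ∩ Finset.Icc (s.reg 20) (s.reg 22)) ∧
          s'.reg 29 = s.reg 20) := by
  have hL := h.three_mul_le
  set c := Finset.card (U ∩ Finset.Icc (s.reg 20) (s.reg 22)) with hc
  set loop : Cmd := .forTo 31 (sub (add (reg 22) (const 1)) (reg 20))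
      (assign 30 (add (reg 30) (cell 7 (add (reg 20) (reg 31))))) with hloop
  set s₁ := loop.run (s.setReg 30 0) with hs₁
  have hf := frame_run loop (s.setReg 30 0)
  rw [← hs₁] at hf
  have key : s₁.reg 30 = Finset.card (U ∩ Finset.Ico (s.reg 20) (s.reg 20 +
      (s.reg 22 + 1 - s.reg 20))) :=
    run_for (N := s.reg 22 + 1 - s.reg 20) (s := s.setReg 30 0)
      (fun i s' => s'.reg 30 = Finset.card (U ∩ Finset.Ico (s.reg 20) (s.reg 20 + i)))
      rfl (by simp) (by simp [h.reg_one]; omega) (by simp) fun i s' hi hx hfr ih => by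
        have e7 : s'.arr 7 = s.arr 7 := hfr.arr 7 rfl
        have e20 : s'.reg 20 = s.reg 20 := hfr.reg 20 rfl
        simp only [run, Exp.eval, State.setReg_reg, Function.update_self, ne_eq,
          Nat.reduceEqDiff, not_false_eq_true, Function.update_of_ne, ih, e7, e20, hx]
        rw [hU _ (by omega), ← add_assoc, ← Finset.insert_Ico_right_eq_Ico_add_one (by omega)]
        split_ifs with h1
        · rw [Finset.inter_insert_of_mem h1, Finset.card_insert_of_notMem (by simp)]
        · rw [Finset.inter_insert_of_notMem h1, add_zero]
  rw [show s.reg 20 + (s.reg 22 + 1 - s.reg 20) = s.reg 22 + 1 by omega,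
    Finset.Ico_add_one_right_eq_Icc, ← hc] at key
  have e28 : s₁.reg 28 = s.reg 28 := hf.reg 28 rfl
  have e29 : s₁.reg 29 = s.reg 29 := hf.reg 29 rfl
  have e20 : s₁.reg 20 = s.reg 20 := hf.reg 20 rfl
  have hrun : compareSegment.run s = if c - s.reg 28 ≠ 0 then
      (s₁.setReg 28 c).setReg 29 (s.reg 20) else s₁ := by
    have : compareSegment.run s = if s₁.reg 30 - s₁.reg 28 ≠ 0 then
      (s₁.setReg 28 (s₁.reg 30)).setReg 29 ((s₁.setReg 28 (s₁.reg 30)).reg 20) else s₁ := rfl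
    rw [this, key, e28]
    simp [e20]
  simp only [hrun]
  split_ifs with h1
  · refine ⟨?_, .inr ⟨by simp, by simp⟩⟩
    simp
    omega
  · exact ⟨by omega, .inl ⟨e28, e29⟩⟩

theorem clearSegment_spec {U : Finset ℕ} (h : Env G v s) (hU : Marks n U s)
    (hb : s.reg 22 < 2 * n) :
    Marks n (U \ Finset.Icc (s.reg 20) (s.reg 22)) (clearSegment.run s) := by
  have hL := h.three_mul_le
  have key : Marks n (U \ Finset.Ico (s.reg 20) (s.reg 20 + (s.reg 22 + 1 - s.reg 20)))
      (clearSegment.run s) :=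
    run_for (N := s.reg 22 + 1 - s.reg 20) (s := s)
      (fun i => Marks n (U \ Finset.Ico (s.reg 20) (s.reg 20 + i)))
      rfl rfl (by rw [h.reg_one]; omega) (by simpa using hU.of_eq (s' := s.setReg 31 0) rfl) fun i s' hi hx hfr ih y hy => by
        have e20 : s'.reg 20 = s.reg 20 := hfr.reg 20 rfl
        by_cases hya : y = s.reg 20 + i
        · have : y ∈ Finset.Ico (s.reg 20) (s.reg 20 + (i + 1)) := Finset.mem_Ico.2 (by omega)
          simp [run, hx, e20, hya]
        · have h1 := ih y hy
          have h2 : y ∈ Finset.Ico (s.reg 20) (s.reg 20 + (i + 1)) ↔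
              y ∈ Finset.Ico (s.reg 20) (s.reg 20 + i) := by
            simp only [Finset.mem_Ico]
            omega
          simp only [run, Exp.eval, State.setReg_arr, State.setCell_arr, Function.update_self,
            hx, e20, Function.update_of_ne hya, h1, Finset.mem_sdiff, h2]
  by_cases hab : s.reg 20 ≤ s.reg 22 + 1
  · rwa [show s.reg 20 + (s.reg 22 + 1 - s.reg 20) = s.reg 22 + 1 by omega,
      Finset.Ico_add_one_right_eq_Icc] at key
  · rw [Finset.Icc_eq_empty (by omega)]
    rwa [show s.reg 20 + (s.reg 22 + 1 - s.reg 20) = s.reg 20 by omega,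
      Finset.Ico_self] at key

/-! ### Reachability -/

theorem mul_add_ne {d d' u u' : ℕ} (hd : d < d') (hu : u < n) : d' * n + u' ≠ d * n + u := by
  have : (d + 1) * n ≤ d' * n := Nat.mul_le_mul_right _ hd
  rw [Nat.succ_mul] at this
  omega

/-- The rows of the table from `d₀` on are correct. -/
def Table (G : TemporalGraph (Fin n) L) (y T d₀ : ℕ) (s : State) : Prop :=
  ∀ d, d₀ ≤ d → d ≤ n → ∀ u < n,
    (s.arr 8 (d * n + u) ≠ 0 ↔ CanReach G.NatAdj n y (T + d) (n - d) u)

/-- The program follows the recursion of `CanReach`: either waiting or moving to some neighbour must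
lead to a good entry of the next row. -/
theorem reachEntry_spec {y : ℕ} (h : Env G v s) (hT : s.reg 27 + n ≤ L) (hd : s.reg 33 < n)
    (hu : s.reg 10 < n) (htab : Table G y (s.reg 27) (s.reg 33 + 1) s) :
    ∃ a, (reachEntry.run s).arr 8 = Function.update (s.arr 8) (s.reg 33 * n + s.reg 10) a ∧
      (a ≠ 0 ↔ CanReach G.NatAdj n y (s.reg 27 + s.reg 33) (n - s.reg 33) (s.reg 10)) := by
  have hL := h.three_mul_le
  set T := s.reg 27 with hT'
  set d := s.reg 33 with hd'
  set u := s.reg 10 with hu'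
  have hm1 : s.arr 3 (d + 1) = (d + 1) * n := h.multiple (by omega)
  have hm0 : s.arr 3 d = d * n := h.multiple (by omega)
  have hnd : n - (d + 1) + 1 = n - d := by omega
  set t₀ := s.setReg 34 (s.arr 8 ((d + 1) * n + u)) with ht₀
  set inner : Cmd := ite (adjExp (add (reg 27) (reg 33)) (reg 10) (reg 11))
    (ite (cell 8 (add (cell 3 (add (reg 33) (const 1))) (reg 11)))
      (assign 34 (const 1)) skip) skip with hinner
  have hE : Env G v t₀ := h.setReg 34
  have key := run_for (x := 11) (e := reg 0) (s := t₀) (N := n) (c := inner)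
    (fun j s' => s'.reg 34 ≠ 0 ↔ CanReach G.NatAdj n y (T + d + 1) (n - (d + 1)) u ∨
      ∃ w < j, G.NatAdj (T + d) u w ∧ CanReach G.NatAdj n y (T + d + 1) (n - (d + 1)) w)
    rfl hE.reg_zero (by rw [hE.reg_one]; omega) ?_ ?_
  · have hff := frame_run (.forTo 11 (reg 0) inner) t₀
    have e1 : reachEntry.run s = (store 8 (add (cell 3 (reg 33)) (reg 10)) (reg 34)).run
        ((Cmd.forTo 11 (reg 0) inner).run t₀) := by
      have : t₀ = s.setReg 34 (s.arr 8 (s.arr 3 (s.reg 33 + 1) + s.reg 10)) := by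
        rw [← hd', ← hu', hm1]
      rw [this]
      rfl
    rw [e1]
    generalize (Cmd.forTo 11 (reg 0) inner).run t₀ = t₁ at key hff
    have f3 : t₁.arr 3 = s.arr 3 := hff.arr 3 rfl
    have f33 : t₁.reg 33 = d := hff.reg 33 rfl
    have f10 : t₁.reg 10 = u := hff.reg 10 rfl
    have f8 : t₁.arr 8 = s.arr 8 := hff.arr 8 rfl
    refine ⟨t₁.reg 34, ?_, ?_⟩
    · simp only [run, Exp.eval, State.setCell_arr, Function.update_self, f3, f33, f10, hm0, f8]
    · rw [key, ← hnd]
      rfl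
  · have := htab (d + 1) le_rfl (by omega) u hu
    rw [← add_assoc] at this
    simpa [ht₀] using this
  · intro j s₁ hj hx hfr ih
    have hE₁ : Env G v s₁ := hE.frame hfr
    have g27 : s₁.reg 27 = T := hfr.reg 27 rfl
    have g33 : s₁.reg 33 = d := hfr.reg 33 rfl
    have g10 : s₁.reg 10 = u := hfr.reg 10 rfl
    have g8 : s₁.arr 8 = s.arr 8 := hfr.arr 8 rfl
    have g3 : s₁.arr 3 (d + 1) = (d + 1) * n := hE₁.multiple (by omega)
    have hj' := htab (d + 1) le_rfl (by omega) j hj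
    rw [← add_assoc] at hj'
    rw [Nat.exists_lt_succ_right, hinner, run, hE₁.eval_adjExp (t := T + d) (u := u) (w := j)
      (by simp [g27, g33]) (by simp [g10]) (by simp [hx]) (by omega) hu hj]
    have hskip (hno : ¬(G.NatAdj (T + d) u j ∧
        CanReach G.NatAdj n y (T + d + 1) (n - (d + 1)) j)) :
        s₁.reg 34 ≠ 0 ↔ CanReach G.NatAdj n y (T + d + 1) (n - (d + 1)) u ∨
          (∃ w < j, G.NatAdj (T + d) u w ∧
            CanReach G.NatAdj n y (T + d + 1) (n - (d + 1)) w) ∨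
          G.NatAdj (T + d) u j ∧ CanReach G.NatAdj n y (T + d + 1) (n - (d + 1)) j := by
      rw [ih, or_iff_left hno]
    by_cases h1 : G.NatAdj (T + d) u j
    · rw [if_pos h1, if_pos one_ne_zero, run]
      simp only [Exp.eval, g33, g3, hx, g8]
      by_cases h2 : CanReach G.NatAdj n y (T + d + 1) (n - (d + 1)) j
      · rw [if_pos (hj'.2 h2)]
        simp [run, h1, h2]
      · rw [if_neg (mt hj'.1 h2)]
        exact hskip fun h => h2 h.2
    · rw [if_neg h1, if_neg (by simp)]
      exact hskip fun h => h1 h.1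

theorem reachTable_spec (h : Env G v s) (hT : s.reg 27 + n ≤ L) :
    Table G (s.arr 4 (s.reg 29)) (s.reg 27) 0 (reachTable.run s) := by
  have hL := h.three_mul_le
  have hn := v.pos
  set y := s.arr 4 (s.reg 29) with hy
  set T := s.reg 27 with hT'
  set c₁ : Cmd := ite (neExp (reg 10) (cell 4 (reg 29)))
      (store 8 (add (cell 3 (reg 0)) (reg 10)) (const 0))
      (store 8 (add (cell 3 (reg 0)) (reg 10)) (const 1)) with hc₁
  set s₁ := (Cmd.forTo 10 (reg 0) c₁).run s with hs₁
  have hf₁ := frame_run (.forTo 10 (reg 0) c₁) s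
  rw [← hs₁] at hf₁
  have k₁ := run_for (x := 10) (e := reg 0) (N := n) (c := c₁) (s := s)
    (fun i s' => ∀ j < i, s'.arr 8 (n * n + j) ≠ 0 ↔ j = y)
    rfl h.reg_zero (by rw [h.reg_one]; omega) (by simp) fun i s' hi hx hfr ih j hj => by
      have hE : Env G v s' := h.frame hfr
      have e4 : s'.arr 4 = s.arr 4 := hfr.arr 4 rfl
      have e29 : s'.reg 29 = s.reg 29 := hfr.reg 29 rfl
      have hrun : c₁.run s' = s'.setCell 8 (n * n + i) (if i ≠ y then 0 else 1) := by
        rw [hc₁, run, if_congr (eval_neExp _ _) rfl rfl]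
        simp only [run, Exp.eval, hx, e4, e29, hE.reg_zero, hE.multiple (show n < L by omega),
          ← hy]
        split_ifs <;> rfl
      rw [hrun]
      rcases Nat.lt_succ_iff_lt_or_eq.1 hj with hj | rfl
      · simpa [hj.ne] using ih j hj
      · simp
  rw [← hs₁] at k₁
  have hE₁ : Env G v s₁ := h.frame hf₁
  -- The rows are filled from the last one, which describes the arrival, backwards in time.
  have key : Table G y T (n - n) (reachTable.run s) :=
    run_for (x := 32) (e := reg 0) (s := s₁) (N := n)
    (c := block [assign 33 (sub (sub (reg 0) (const 1)) (reg 32)), .forTo 10 (reg 0) reachEntry])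
    (fun i => Table G y T (n - i))
    rfl hE₁.reg_zero (by rw [hE₁.reg_one]; omega) ?_ ?_
  · rwa [Nat.sub_self] at key
  · intro d h1 h2 u hu
    obtain rfl : d = n := by omega
    rw [Nat.sub_self]
    exact k₁ u hu
  · intro i s₂ hi hx hfr ih
    have hE₂ : Env G v s₂ := hE₁.frame hfr
    set d := n - 1 - i with hd
    have hE₂' : Env G v (s₂.setReg 33 d) := hE₂.setReg 33
    have hrun : (block [assign 33 (sub (sub (reg 0) (const 1)) (reg 32)),
        .forTo 10 (reg 0) reachEntry]).run s₂ = (Cmd.forTo 10 (reg 0) reachEntry).run (s₂.setReg 33 d) := by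
      simp only [block, run, Exp.eval, hE₂.reg_zero, hx, hd]
    rw [hrun]
    have key2 := run_for (x := 10) (e := reg 0) (s := s₂.setReg 33 d) (N := n) (c := reachEntry)
      (fun u s' => Table G y T (d + 1) s' ∧ ∀ u' < u,
        (s'.arr 8 (d * n + u') ≠ 0 ↔ CanReach G.NatAdj n y (T + d) (n - d) u'))
      rfl hE₂'.reg_zero (by rw [hE₂'.reg_one]; omega) ?_ ?_
    · intro d' h1 h2 u hu
      by_cases hdd : d' = d
      · rw [hdd]
        exact key2.2 u hu
      · exact key2.1 d' (by omega) h2 u hu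
    · refine ⟨?_, by simp⟩
      rw [show d + 1 = n - i by omega]
      exact ih
    · intro u s₃ hu hx₃ hfr₃ ⟨htab, hcur⟩
      have e27 : s₃.reg 27 = T := (hfr₃.reg 27 rfl).trans ((hfr.reg 27 rfl).trans (hf₁.reg 27 rfl))
      have e33 : s₃.reg 33 = d := hfr₃.reg 33 rfl
      obtain ⟨a, h1, h2⟩ := reachEntry_spec (hE₂'.frame hfr₃) (by omega)
        (by rw [e33]; omega) (by rw [hx₃]; exact hu) (by rw [e27, e33]; exact htab)
      rw [e27, e33, hx₃] at h2
      rw [e33, hx₃] at h1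
      refine ⟨fun d' h3 h4 u' hu' => ?_, fun u' hu' => ?_⟩
      · rw [State.setReg_arr, h1, Function.update_of_ne (mul_add_ne (by omega) hu)]
        exact htab d' h3 h4 u' hu'
      · rw [State.setReg_arr, h1]
        rcases Nat.lt_succ_iff_lt_or_eq.1 hu' with hu' | rfl
        · rw [Function.update_of_ne (by omega)]
          exact hcur u' hu'
        · rw [Function.update_self]
          exact h2

/-- The explorer keeps the property that the target can be reached in the remaining time; when no
time is left, it stands on the target. -/
theorem approach_spec {y : ℕ} (h : Env G v s) (hT : s.reg 27 + n ≤ L)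
    (htab : Table G y (s.reg 27) 0 s) (hcur : s.reg 26 < n)
    (hreach : CanReach G.NatAdj n y (s.reg 27) n (s.reg 26))
    (hpos : s.arr 9 (s.reg 27) = s.reg 26) :
    let p := (approach.run s).arr 9
    (∀ i, i ≤ s.reg 27 ∨ s.reg 27 + n < i → p i = s.arr 9 i) ∧
      (∀ d < n, p (s.reg 27 + d + 1) = p (s.reg 27 + d) ∨
        G.NatAdj (s.reg 27 + d) (p (s.reg 27 + d)) (p (s.reg 27 + d + 1))) ∧
      p (s.reg 27 + n) = y := by
  have hL := h.three_mul_le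
  have hn := v.pos
  set T := s.reg 27 with hT'
  set inner : Cmd := ite (adjExp (add (reg 27) (reg 32)) (reg 26) (reg 11))
        (ite (cell 8 (add (cell 3 (add (reg 32) (const 1))) (reg 11)))
          (assign 35 (reg 11)) skip) skip with hinner
  have key := run_for (x := 32) (e := reg 0) (s := s) (N := n)
    (c := block [assign 35 (reg 26), .forTo 11 (reg 0) inner, assign 26 (reg 35),
      store 9 (add (add (reg 27) (reg 32)) (const 1)) (reg 26)])
    (fun d s' => s'.reg 26 < n ∧ CanReach G.NatAdj n y (T + d) (n - d) (s'.reg 26) ∧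
      s'.arr 9 (T + d) = s'.reg 26 ∧
      (∀ i, i ≤ T ∨ T + n < i → s'.arr 9 i = s.arr 9 i) ∧
      ∀ d' < d, s'.arr 9 (T + d' + 1) = s'.arr 9 (T + d') ∨
        G.NatAdj (T + d') (s'.arr 9 (T + d')) (s'.arr 9 (T + d' + 1)))
    rfl h.reg_zero (by rw [h.reg_one]; omega)
    ⟨hcur, by simpa using hreach, by simpa using hpos, by simp, by simp⟩ ?_
  · obtain ⟨-, h1, h2, h3, h4⟩ := key
    rw [Nat.sub_self] at h1
    exact ⟨h3, h4, h2.trans h1⟩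
  · intro d s₁ hd hx hfr ⟨h1, h2, h3, h4, h5⟩
    have hE₁ : Env G v s₁ := h.frame hfr
    have e27 : s₁.reg 27 = T := hfr.reg 27 rfl
    have e8 : s₁.arr 8 = s.arr 8 := hfr.arr 8 rfl
    set u := s₁.reg 26 with hu
    set s₂ := s₁.setReg 35 u with hs₂
    have hE₂ : Env G v s₂ := hE₁.setReg 35
    have hnd : n - (d + 1) + 1 = n - d := by omega
    have key2 := run_for (x := 11) (e := reg 0) (s := s₂) (N := n) (c := inner)
      (fun j s' => s'.reg 35 = u ∧ (∀ w < j, ¬(G.NatAdj (T + d) u w ∧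
          CanReach G.NatAdj n y (T + d + 1) (n - (d + 1)) w)) ∨
        s'.reg 35 < n ∧ G.NatAdj (T + d) u (s'.reg 35) ∧
          CanReach G.NatAdj n y (T + d + 1) (n - (d + 1)) (s'.reg 35))
      rfl hE₂.reg_zero (by rw [hE₂.reg_one]; omega) (by simp [hs₂]) ?_
    · have hff := frame_run (.forTo 11 (reg 0) inner) s₂
      set s₃ := (Cmd.forTo 11 (reg 0) inner).run s₂ with hs₃
      have f27 : s₃.reg 27 = T := (hff.reg 27 rfl).trans e27
      have f32 : s₃.reg 32 = d := (hff.reg 32 rfl).trans hx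
      have f9 : s₃.arr 9 = s₁.arr 9 := hff.arr 9 rfl
      set u' := s₃.reg 35 with hu'
      have hrun : (block [assign 35 (reg 26), .forTo 11 (reg 0) inner, assign 26 (reg 35),
          store 9 (add (add (reg 27) (reg 32)) (const 1)) (reg 26)]).run s₁ =
          (s₃.setReg 26 u').setCell 9 (T + d + 1) u' := by
        have : (block [assign 35 (reg 26), .forTo 11 (reg 0) inner, assign 26 (reg 35),
          store 9 (add (add (reg 27) (reg 32)) (const 1)) (reg 26)]).run s₁ =
          (block [assign 26 (reg 35),
            store 9 (add (add (reg 27) (reg 32)) (const 1)) (reg 26)]).run s₃ := rfl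
        rw [this]
        simp [block, run, f27, f32, hu']
      have hgood : u' < n ∧ (u' = u ∨ G.NatAdj (T + d) u u') ∧
          CanReach G.NatAdj n y (T + d + 1) (n - (d + 1)) u' := by
        -- If no neighbour is suitable, then reachability can only come from waiting.
        rcases key2 with ⟨g1, g2⟩ | ⟨g1, g2, g3⟩
        · rw [← hnd] at h2
          rcases h2 with h2 | ⟨w, hw, h2⟩
          · rw [g1]
            exact ⟨h1, .inl rfl, h2⟩
          · exact absurd h2 (g2 w hw)
        · exact ⟨g1, .inr g2, g3⟩
      have hold : ∀ i, i ≠ T + d + 1 →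
          (((s₃.setReg 26 u').setCell 9 (T + d + 1) u').setReg 32 (d + 1)).arr 9 i =
            s₁.arr 9 i := by
        intro i hi
        simp [hi, f9]
      have hnew : (((s₃.setReg 26 u').setCell 9 (T + d + 1) u').setReg 32 (d + 1)).arr 9
          (T + d + 1) = u' := by simp
      rw [hrun]
      refine ⟨by simpa using hgood.1, by simpa [add_assoc] using hgood.2.2, ?_, ?_, ?_⟩
      · rw [← add_assoc, hnew]
        simp
      · intro i hi
        rw [hold i (by omega)]
        exact h4 i hi
      · intro d' hd'
        rcases Nat.lt_succ_iff_lt_or_eq.1 hd' with hd' | rfl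
        · rw [hold _ (by omega), hold _ (by omega)]
          exact h5 d' hd'
        · rw [hnew, hold _ (by omega), h3]
          exact hgood.2.1
    · intro j s₄ hj hx₄ hfr₄ ih₄
      have hE₄ : Env G v s₄ := hE₂.frame hfr₄
      have g27 : s₄.reg 27 = T := (hfr₄.reg 27 rfl).trans e27
      have g32 : s₄.reg 32 = d := (hfr₄.reg 32 rfl).trans hx
      have g26 : s₄.reg 26 = u := (hfr₄.reg 26 rfl)
      have g8 : s₄.arr 8 = s.arr 8 := (hfr₄.arr 8 rfl).trans e8
      have g3 : s₄.arr 3 (d + 1) = (d + 1) * n := hE₄.multiple (by omega)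
      have hj' := htab (d + 1) (Nat.zero_le _) (by omega) j hj
      rw [← add_assoc] at hj'
      rw [hinner, run, hE₄.eval_adjExp (t := T + d) (u := u) (w := j)
          (by simp [g27, g32]) (by simp [g26]) (by simp [hx₄]) (by omega) h1 hj]
      have hskip (hno : ¬(G.NatAdj (T + d) u j ∧
          CanReach G.NatAdj n y (T + d + 1) (n - (d + 1)) j)) :
          s₄.reg 35 = u ∧ (∀ w < j + 1, ¬(G.NatAdj (T + d) u w ∧
            CanReach G.NatAdj n y (T + d + 1) (n - (d + 1)) w)) ∨
          s₄.reg 35 < n ∧ G.NatAdj (T + d) u (s₄.reg 35) ∧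
            CanReach G.NatAdj n y (T + d + 1) (n - (d + 1)) (s₄.reg 35) := by
        refine ih₄.imp_left fun h => ⟨h.1, fun w hw => ?_⟩
        rcases Nat.lt_succ_iff_lt_or_eq.1 hw with hw | rfl
        exacts [h.2 w hw, hno]
      by_cases g1 : G.NatAdj (T + d) u j
      · rw [if_pos g1, if_pos one_ne_zero, run]
        simp only [Exp.eval, g32, g3, hx₄, g8]
        by_cases g2 : CanReach G.NatAdj n y (T + d + 1) (n - (d + 1)) j
        · rw [if_pos (hj'.2 g2)]
          right
          simp [run, hx₄, hj, g1, g2]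
        · rw [if_neg (mt hj'.1 g2)]
          simpa [run] using hskip fun h => g2 h.2
      · rw [if_neg g1, if_neg (by simp)]
        simpa [run] using hskip fun h => g1 h.1

/-! ### Phases -/

/-- After comparing all segments, register `29` contains the first position of a segment with the largest
number of marks. -/
theorem chooseSegment_spec {U : Finset ℕ} (h : Env G v s) (hT : HasTour n s)
    (ht : s.reg 21 + 2 * n ≤ L) (hU : Marks n U s) (h28 : s.reg 28 = 0) (h29 : s.reg 29 = 0) :
    let a := ((forSegments compareSegment).run s).reg 29
    let w := fun a => walker G.NatAdj (s.arr 4) (s.reg 7) (s.reg 21) a (2 * n)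
    let S := starts G.NatAdj (s.arr 4) (s.reg 7) (2 * n) (s.reg 21)
    a ∈ S ∧ ∀ a' ∈ S, Finset.card (U ∩ Finset.Icc a' (w a')) ≤
      Finset.card (U ∩ Finset.Icc a (w a)) := by
  intro a w S
  have key := forSegments_spec (c := compareSegment) h hT ht (by decide) (by decide)
    (fun A s' => s'.reg 29 ∈ S ∧
      s'.reg 28 ≤ Finset.card (U ∩ Finset.Icc (s'.reg 29) (w (s'.reg 29))) ∧
      ∀ a' ∈ A, Finset.card (U ∩ Finset.Icc a' (w a')) ≤ s'.reg 28)
    (fun A s₁ s₂ h1 _ h3 => by rwa [h1 28 (by decide), h1 29 (by decide)])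
    (by simp [h28, h29, S, zero_mem_starts]) ?_
  · exact ⟨key.1, fun a' ha' => (key.2.2 a' ha').trans key.2.1⟩
  · intro A a ha s₁ hE hfr h20 h22 ⟨j1, j2, j3⟩
    have ham := (mem_starts.1 ha).1
    have hle : s₁.reg 22 ≤ s.reg 7 := by
      rw [h22]
      exact walker_le ham _
    have hTm := hT.reg_lt
    obtain ⟨c1, c2⟩ := compareSegment_spec hE (hU.of_eq (hfr.arr 7 rfl))
      (by rw [h20, h22]; exact le_walker _ _ _) (by omega)
    rw [h20, h22] at c1 c2
    refine ⟨?_, ?_, fun a' ha' => ?_⟩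
    · rcases c2 with ⟨_, c2⟩ | ⟨_, c2⟩ <;> rw [c2]
      exacts [j1, ha]
    · rcases c2 with ⟨c3, c2⟩ | ⟨c3, c2⟩ <;> rw [c2, c3]
      exact j2
    · rw [c1]
      rcases Finset.mem_insert.1 ha' with rfl | ha'
      · exact le_max_right _ _
      · exact (j3 a' ha').trans (le_max_left _ _)

/-- The state of the exploration after `j` phases, when the positions in `U` are still marked. -/
structure Explored (G : TemporalGraph (Fin n) L) (v : Fin n) (p : ℕ → ℕ) (m M j : ℕ)
    (U : Finset ℕ) (s : State) : Prop where
  marks : Marks n U s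
  subset : U ⊆ allStarts G p m M
  time : s.reg 27 = 3 * n * j
  position : s.arr 9 (3 * n * j) = s.reg 26
  position_lt : s.reg 26 < n
  start : s.arr 9 0 = v
  step : ∀ t < 3 * n * j, s.arr 9 (t + 1) = s.arr 9 t ∨
    G.NatAdj t (s.arr 9 t) (s.arr 9 (t + 1))
  cover : ∀ y₀ ∈ allStarts G p m M, y₀ ∉ U → ∀ y, y₀ ≤ y → y ≤ m →
    (∀ z ∈ allStarts G p m M, z ≤ y → z ≤ y₀) → ∃ t ≤ 3 * n * j, s.arr 9 t = p y
  card_le : (U.card : ℝ) ≤ (allStarts G p m M).card * Real.exp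
    (-∑ i ∈ Finset.range j, 1 / ((starts G.NatAdj p m (2 * n) (3 * n * i + n)).card : ℝ))

theorem Explored.of_eq {p : ℕ → ℕ} {m M j : ℕ} {U : Finset ℕ} (h : Explored G v p m M j U s)
    (h26 : s'.reg 26 = s.reg 26) (h27 : s'.reg 27 = s.reg 27) (ha : s'.arr = s.arr) :
    Explored G v p m M j U s' := by
  obtain ⟨h1, h2, h3, h4, h5, h6, h7, h8, h9⟩ := h
  rw [← h26] at h4 h5
  rw [← h27] at h3
  rw [← ha] at h4 h6 h7 h8
  exact ⟨h1.of_eq (by rw [ha]), h2, h3, h4, h5, h6, h7, h8, h9⟩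

theorem allStarts_subset (p : ℕ → ℕ) (m M : ℕ) : allStarts G p m M ⊆ Finset.range (m + 1) := by
  intro y hy
  obtain ⟨j, -, hy⟩ := Finset.mem_biUnion.1 hy
  exact Finset.mem_range.2 (Nat.lt_succ_of_le (mem_starts.1 hy).1)

/-- A phase extends the recorded positions by `n` steps of approach and `2n` steps on the tour. It
removes the marks of the chosen segment, and these marks satisfy the covering property from now on.
-/
theorem phase_spec {M j : ℕ} {U : Finset ℕ} (hG : G.AlwaysConnected) (h : Env G v s)
    (hT : HasTour n s) (hM : 3 * n * M ≤ L) (hj : j < M)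
    (hs : Explored G v (s.arr 4) (s.reg 7) M j U s) :
    ∃ U', Explored G v (s.arr 4) (s.reg 7) M (j + 1) U' (phase.run s) := by
  have hn := v.pos
  set p := s.arr 4 with hp
  set m := s.reg 7 with hm
  set T := 3 * n * j with hTj
  have hlt : T + 3 * n ≤ L := by
    calc T + 3 * n = 3 * n * (j + 1) := by rw [hTj]; ring
      _ ≤ 3 * n * M := Nat.mul_le_mul_left _ hj
      _ ≤ L := hM
  have hTm : m < 2 * n := hT.reg_lt
  set s₀ := ((s.setReg 21 (T + n)).setReg 28 0).setReg 29 0 with hs₀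
  have hE₀ : Env G v s₀ := ((h.setReg 21).setReg 28).setReg 29
  have e21 : s₀.reg 21 = T + n := rfl
  obtain ⟨ha, hmax⟩ := chooseSegment_spec (U := U) hE₀ (hT.of_eq rfl rfl) (by rw [e21]; omega)
    (hs.marks.of_eq rfl) rfl rfl
  have hf₁ := frame_run (forSegments compareSegment) s₀
  have hrun : phase.run s = (block [assign 20 (reg 29), follow 9, clearSegment, reachTable,
      approach, assign 26 (cell 4 (reg 22)), assign 27 (add (reg 27) thriceExp)]).run
      ((forSegments compareSegment).run s₀) := by
    have h27 : s.reg 27 = T := hs.time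
    rw [hs₀, ← h27, ← h.reg_zero]
    rfl
  rw [hrun]
  have hE₁ := hE₀.run (forSegments compareSegment)
  generalize (forSegments compareSegment).run s₀ = s₁ at *
  have ea4 : s₀.arr 4 = p := rfl
  have er7 : s₀.reg 7 = m := rfl
  rw [e21, ea4, er7] at ha hmax
  set a := s₁.reg 29 with hadef
  set w := walker G.NatAdj p m (T + n) a with hw
  set S := starts G.NatAdj p m (2 * n) (T + n) with hS
  have ham : a ≤ m := (mem_starts.1 ha).1
  have hSall : S ⊆ allStarts G p m M := fun y hy =>
    Finset.mem_biUnion.2 ⟨j, Finset.mem_range.2 hj, hy⟩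
  have a20 : (s₁.setReg 20 a).reg 20 = a := rfl
  have a7 : (s₁.setReg 20 a).reg 7 = m := hf₁.reg 7 rfl
  have a21 : (s₁.setReg 20 a).reg 21 = T + n := hf₁.reg 21 rfl
  have a4 : (s₁.setReg 20 a).arr 4 = p := hf₁.arr 4 rfl
  have a9 : (s₁.setReg 20 a).arr 9 = s.arr 9 := hf₁.arr 9 rfl
  have am7 : (s₁.setReg 20 a).arr 7 = s.arr 7 := hf₁.arr 7 rfl
  have a26 : (s₁.setReg 20 a).reg 26 = s.reg 26 := hf₁.reg 26 rfl
  have a27 : (s₁.setReg 20 a).reg 27 = T := (hf₁.reg 27 rfl).trans hs.time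
  have a29 : (s₁.setReg 20 a).reg 29 = a := rfl
  have hrun₁ : (block [assign 20 (reg 29), follow 9, clearSegment, reachTable,
      approach, assign 26 (cell 4 (reg 22)), assign 27 (add (reg 27) thriceExp)]).run s₁ =
      (block [clearSegment, reachTable, approach, assign 26 (cell 4 (reg 22)),
        assign 27 (add (reg 27) thriceExp)]).run ((follow 9).run (s₁.setReg 20 a)) := rfl
  rw [hrun₁]
  have hE₂ : Env G v (s₁.setReg 20 a) := hE₁.setReg 20
  have hfol := follow_spec (A := 9) (by decide) (by decide) (by decide) hE₂
    (hT.of_eq a7 a4) (by rw [a20, a7]; exact ham) (by rw [a21]; omega)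
  have hff := frame_run (follow 9) (s₁.setReg 20 a)
  have hE₃ := hE₂.run (follow 9)
  generalize s₁.setReg 20 a = s₂ at *
  generalize (follow 9).run s₂ = s₃ at *
  rw [a4, a7, a21, a20, a9] at hfol
  obtain ⟨f22, ftrace, fold⟩ := hfol
  have b20 : s₃.reg 20 = a := (hff.reg 20 rfl).trans a20
  have b26 : s₃.reg 26 = s.reg 26 := (hff.reg 26 rfl).trans a26
  have b27 : s₃.reg 27 = T := (hff.reg 27 rfl).trans a27
  have b29 : s₃.reg 29 = a := (hff.reg 29 rfl).trans a29
  have b4 : s₃.arr 4 = p := (hff.arr 4 rfl).trans a4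
  have b7 : s₃.arr 7 = s.arr 7 := (hff.arr 7 rfl).trans am7
  have hwm : w (2 * n) ≤ m := walker_le ham _
  have hmarks := clearSegment_spec hE₃ (hs.marks.of_eq b7)
    (by rw [f22]; exact hwm.trans_lt hTm)
  rw [b20, f22] at hmarks
  have hfc := frame_run clearSegment s₃
  have hrun₂ : (block [clearSegment, reachTable, approach, assign 26 (cell 4 (reg 22)),
        assign 27 (add (reg 27) thriceExp)]).run s₃ = (block [reachTable, approach,
        assign 26 (cell 4 (reg 22)), assign 27 (add (reg 27) thriceExp)]).run
        (clearSegment.run s₃) := rfl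
  rw [hrun₂]
  have hE₄ := hE₃.run clearSegment
  generalize clearSegment.run s₃ = s₄ at *
  have c22 : s₄.reg 22 = w (2 * n) := (hfc.reg 22 rfl).trans f22
  have c26 : s₄.reg 26 = s.reg 26 := (hfc.reg 26 rfl).trans b26
  have c27 : s₄.reg 27 = T := (hfc.reg 27 rfl).trans b27
  have c29 : s₄.reg 29 = a := (hfc.reg 29 rfl).trans b29
  have c4 : s₄.arr 4 = p := (hfc.arr 4 rfl).trans b4
  have c9 : s₄.arr 9 = s₃.arr 9 := hfc.arr 9 rfl
  have htab := reachTable_spec hE₄ (by rw [c27]; omega)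
  rw [c4, c27, c29] at htab
  have hfr := frame_run reachTable s₄
  have hrun₃ : (block [reachTable, approach, assign 26 (cell 4 (reg 22)),
        assign 27 (add (reg 27) thriceExp)]).run s₄ = (block [approach,
        assign 26 (cell 4 (reg 22)), assign 27 (add (reg 27) thriceExp)]).run
        (reachTable.run s₄) := rfl
  rw [hrun₃]
  have hE₅ := hE₄.run reachTable
  generalize reachTable.run s₄ = s₅ at *
  have d7 : s₅.arr 7 = s₄.arr 7 := hfr.arr 7 rfl
  have d22 : s₅.reg 22 = w (2 * n) := (hfr.reg 22 rfl).trans c22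
  have d26 : s₅.reg 26 = s.reg 26 := (hfr.reg 26 rfl).trans c26
  have d27 : s₅.reg 27 = T := (hfr.reg 27 rfl).trans c27
  have d4 : s₅.arr 4 = p := (hfr.arr 4 rfl).trans c4
  have d9 : s₅.arr 9 = s₃.arr 9 := (hfr.arr 9 rfl).trans c9
  have happ := approach_spec (y := p a) hE₅ (by rw [d27]; omega) (by rw [d27]; exact htab)
    (by rw [d26]; exact hs.position_lt)
    (canReach_of_connected (hT.arr_lt _ ham)
      (fun t ht S' h1 h2 h3 => hG.exists_natAdj (by omega) h1 h2 h3) (by omega)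
      (by rw [d26]; exact hs.position_lt))
    (by rw [d9, d27, d26, fold T (by omega)]; exact hs.position)
  have hfa := frame_run approach s₅
  have hE₆ := hE₅.run approach
  have hrun₄ : (block [approach, assign 26 (cell 4 (reg 22)),
      assign 27 (add (reg 27) thriceExp)]).run s₅ =
      ((approach.run s₅).setReg 26 (p (w (2 * n)))).setReg 27 (T + 3 * n) := by
    have e4 : (approach.run s₅).arr 4 = p := (hfa.arr 4 rfl).trans d4
    have e22 : (approach.run s₅).reg 22 = w (2 * n) := (hfa.reg 22 rfl).trans d22
    have e27 : (approach.run s₅).reg 27 = T := (hfa.reg 27 rfl).trans d27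
    have e3 := (hE₆.setReg 26 (a := p (w (2 * n)))).eval_thriceExp
    simp only [block, run, Exp.eval, e4, e22, e3]
    simp [e27]
  rw [hrun₄]
  have g7 : (approach.run s₅).arr 7 = s₄.arr 7 := (hfa.arr 7 rfl).trans d7
  generalize approach.run s₅ = s₆ at *
  rw [d27, d9] at happ
  obtain ⟨hold, hstep, hend⟩ := happ
  set q := s₆.arr 9 with hq
  have hqold : ∀ t ≤ T, q t = s.arr 9 t := fun t ht => by
    rw [hold t (by omega), fold t (by omega)]
  -- For `d = 0` this is the end of the approach; the later entries were written while following the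
  -- tour.
  have hqnew : ∀ d ≤ 2 * n, q (T + n + d) = p (w d) := by
    intro d hd
    rcases Nat.eq_zero_or_pos d with rfl | hd0
    · exact hend
    · obtain ⟨d, rfl⟩ := Nat.exists_eq_succ_of_ne_zero hd0.ne'
      rw [hold _ (by omega), ← ftrace d (by omega)]
      congr 1
  have hT1 : 3 * n * (j + 1) = T + 3 * n := by rw [hTj]; ring
  have hend' : T + 3 * n = T + n + 2 * n := by ring
  refine ⟨U \ Finset.Icc a (w (2 * n)), ?_, ?_, ?_, ?_, ?_, ?_, ?_, ?_, ?_⟩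
  · exact hmarks.of_eq g7
  · exact Finset.sdiff_subset.trans hs.subset
  · simp [hT1]
  · simp only [State.setReg_arr, ← hq]
    rw [hT1, hend', hqnew _ le_rfl]
    simp
  · simpa using hT.arr_lt _ hwm
  · simp only [State.setReg_arr, ← hq]
    rw [hqold 0 (Nat.zero_le _)]
    exact hs.start
  · intro t ht
    simp only [State.setReg_arr, ← hq]
    rw [hT1] at ht
    rcases lt_or_ge t T with h1 | h1
    · rw [hqold t h1.le, hqold (t + 1) h1]
      exact hs.step t h1
    rcases lt_or_ge t (T + n) with h2 | h2
    · obtain ⟨d, rfl⟩ := Nat.exists_eq_add_of_le h1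
      exact hstep d (by omega)
    · obtain ⟨d, rfl⟩ := Nat.exists_eq_add_of_le h2
      rw [hqnew d (by omega), add_assoc (T + n) d 1, hqnew (d + 1) (by omega)]
      exact walker_step (T + n) a d
  · intro y₀ hy₀ hU₀ y hy hym hmark
    simp only [State.setReg_arr, ← hq]
    rw [hT1]
    by_cases h1 : y₀ ∈ U
    · have h2 : y₀ ∈ Finset.Icc a (w (2 * n)) := by
        by_contra h2
        exact hU₀ (Finset.mem_sdiff.2 ⟨h1, h2⟩)
      have h3 := Finset.mem_Icc.1 h2
      -- Otherwise the position after the segment would be a mark in the interval from `y₀` to `y`,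
      -- different from `y₀`.
      have h4 : y ≤ w (2 * n) := by
        by_contra h4
        have := hmark (w (2 * n) + 1)
          (hSall (succ_walker_mem_starts ha (by rw [← hw]; omega))) (by omega)
        omega
      obtain ⟨d, hd, hdy⟩ := exists_walker_eq (E := G.NatAdj) (p := p) (m := m)
        (t₀ := T + n) (h3.1.trans hy) (2 * n) h4
      exact ⟨T + n + d, by omega, by rw [hqnew d hd, ← hdy]⟩
    · obtain ⟨t, ht, h2⟩ := hs.cover y₀ hy₀ h1 y hy hym hmark
      exact ⟨t, by omega, by rw [hqold t ht, h2]⟩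
  · have h1 := card_sdiff_segment_le (E := G.NatAdj) (p := p) (D := 2 * n) (t₀ := T + n)
      (hs.subset.trans (allStarts_subset p m M)) hmax
    rw [Finset.sum_range_succ, neg_add, Real.exp_add, ← mul_assoc]
    refine h1.trans ?_
    gcongr
    exact hs.card_le

theorem phases_spec (hG : G.AlwaysConnected) (h : Env G v s)
    (hT : HasTour n s) (hM : 3 * n * s.reg 4 ≤ L)
    (hU : Marks n (allStarts G (s.arr 4) (s.reg 7) (s.reg 4)) s) :
    ∃ U, Explored G v (s.arr 4) (s.reg 7) (s.reg 4) (s.reg 4) U (phases.run s) := by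
  have hn := v.pos
  have hML : s.reg 4 ≤ L := by nlinarith
  set s₁ := ((s.setReg 26 v).setReg 27 0).setCell 9 0 v with hs₁
  have hE₁ : Env G v s₁ := ((h.setReg 26).setReg 27).setCell 9
  have hrun : phases.run s = (Cmd.forTo 24 (reg 4) phase).run s₁ := by
    rw [hs₁, ← h.reg_two]
    rfl
  rw [hrun]
  have f4 : s₁.reg 4 = s.reg 4 := rfl
  have f7 : s₁.reg 7 = s.reg 7 := rfl
  have fa4 : s₁.arr 4 = s.arr 4 := rfl
  refine run_for (x := 24) (e := reg 4) (s := s₁) (c := phase) (N := s.reg 4)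
    (fun j s' => ∃ U, Explored G v (s.arr 4) (s.reg 7) (s.reg 4) j U s') rfl rfl
    (by rw [hE₁.reg_one]; exact hML) ?_ ?_
  · refine ⟨allStarts G (s.arr 4) (s.reg 7) (s.reg 4), hU.of_eq rfl, Finset.Subset.refl _,
      by simp [hs₁], by simp [hs₁], by simp [hs₁], by simp [hs₁], by simp, ?_, by simp⟩
    intro y₀ h1 h2
    exact absurd h1 h2
  · rintro j s₂ hj - hfr ⟨U, hU⟩
    have e7 : s₂.reg 7 = s.reg 7 := (hfr.reg 7 rfl).trans f7
    have e4 : s₂.arr 4 = s.arr 4 := (hfr.arr 4 rfl).trans fa4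
    rw [← e7, ← e4] at hU
    obtain ⟨U', hU'⟩ := phase_spec hG (hE₁.frame hfr) (hT.of_eq e7 e4) hM hj hU
    rw [e7, e4] at hU'
    exact ⟨U', hU'.of_eq (by simp) (by simp) (State.setReg_arr _ _ _)⟩

theorem testMarks_spec {U : Finset ℕ} (h : Env G v s) (hU : Marks n U s)
    (hU' : U ⊆ Finset.range (2 * n)) :
    (testMarks.run s).reg 3 = if U = ∅ then 1 else 0 := by
  have hL := h.three_mul_le
  have hE : Env G v (s.setReg 30 0) := h.setReg 30
  have key := run_for (x := 31) (e := twiceExp) (N := 2 * n) (s := s.setReg 30 0)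
    (c := assign 30 (add (reg 30) (cell 7 (reg 31))))
    (fun i s' => s'.reg 30 = ∑ y ∈ Finset.range i, s.arr 7 y)
    rfl hE.eval_twiceExp (by rw [hE.reg_one]; omega) (by simp) fun i s' _ hx hfr ih => by
      have e7 : s'.arr 7 = s.arr 7 := hfr.arr 7 rfl
      simp [run, ih, hx, e7, Finset.sum_range_succ]
  have hrun : (testMarks.run s).reg 3 = 1 - ((Cmd.forTo 31 twiceExp
      (assign 30 (add (reg 30) (cell 7 (reg 31))))).run (s.setReg 30 0)).reg 30 := rfl
  have hsum : ∑ y ∈ Finset.range (2 * n), s.arr 7 y = U.card := by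
    rw [Finset.sum_congr rfl fun y hy => hU y (Finset.mem_range.1 hy), Finset.sum_ite_mem,
      Finset.inter_eq_right.2 hU', Finset.sum_const, smul_eq_mul, mul_one]
  rw [hrun, key, hsum]
  split_ifs with h1
  · simp [h1]
  · have := Finset.card_pos.2 (Finset.nonempty_iff_ne_empty.2 h1)
    omega

/-! ### Attempts -/

/-- The array `9` contains the sequence of positions of an exploration in `H` time steps. -/
structure Solved (G : TemporalGraph (Fin n) L) (v : Fin n) (H : ℕ) (s : State) : Prop where
  start : s.arr 9 0 = v
  step : ∀ t < H, s.arr 9 (t + 1) = s.arr 9 t ∨ G.NatAdj t (s.arr 9 t) (s.arr 9 (t + 1))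
  cover : ∀ x < n, ∃ t ≤ H, s.arr 9 t = x

theorem Solved.of_eq {H : ℕ} (h : Solved G v H s) (h9 : s'.arr 9 = s.arr 9) :
    Solved G v H s' := by
  obtain ⟨h1, h2, h3⟩ := h
  rw [← h9] at h1 h2 h3
  exact ⟨h1, h2, h3⟩

/-- Success is meaningful for every `M`, and guaranteed once `M` is large; this allows a search for
`M` without knowing `k`. -/
theorem attempt_spec {k M : ℕ} (hk : 1 ≤ k) (hG : G.AlwaysConnected) (hD : G.EdgeDeficient k)
    (h : Env G v s) (hM : 1 ≤ M) (h4 : s.reg 4 = M) (h5 : s.reg 5 = 3 * n * M)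
    (hL : 3 * n * M ≤ L) :
    ((attempt.run s).reg 3 ≠ 0 → Solved G v (3 * n * M) (attempt.run s)) ∧
      (80 * (k * Real.log (k + 1)) ≤ M → (attempt.run s).reg 3 ≠ 0) := by
  have hn := v.pos
  obtain ⟨T, -, hT, hTd⟩ := hD
  obtain ⟨t7, tp, tcov, tcard, F, -, tsum⟩ := buildTour_spec h (by omega) hT.connected
  have hf₁ := frame_run buildTour s
  have hE₁ := h.run buildTour
  have hrun : attempt.run s = testMarks.run (phases.run (markStarts.run (buildTour.run s))) := rfl
  rw [hrun]
  generalize buildTour.run s = s₁ at *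
  have hf₂ := frame_run markStarts s₁
  have hTour : HasTour n s₁ := ⟨by omega, fun q hq => (tp q (by omega)).1⟩
  have e4 : s₁.reg 4 = M := (hf₁.reg 4 rfl).trans h4
  have hmarks := markStarts_spec hE₁ hTour (by rw [e4]; exact hL)
  have hE₂ := hE₁.run markStarts
  generalize markStarts.run s₁ = s₂ at *
  have g4 : s₂.reg 4 = s₁.reg 4 := hf₂.reg 4 rfl
  have g7 : s₂.reg 7 = s₁.reg 7 := hf₂.reg 7 rfl
  have ga4 : s₂.arr 4 = s₁.arr 4 := hf₂.arr 4 rfl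
  have hTour₂ : HasTour n s₂ := hTour.of_eq g7 ga4
  obtain ⟨U, hU⟩ := phases_spec hG hE₂ hTour₂ (by rw [g4, e4]; exact hL)
    (by rw [g4, g7, ga4]; exact hmarks)
  have hE₃ := hE₂.run phases
  generalize phases.run s₂ = s₃ at *
  rw [g4, g7, ga4, e4] at hU
  have hm2 : s₁.reg 7 + 1 ≤ 2 * n := by omega
  have htest := testMarks_spec hE₃ hU.marks
    (hU.subset.trans ((allStarts_subset _ _ _).trans (Finset.range_subset_range.2 hm2)))
  have hf₄ := frame_run testMarks s₃
  generalize testMarks.run s₃ = s₄ at *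
  have h9 : s₄.arr 9 = s₃.arr 9 := hf₄.arr 9 rfl
  rw [htest]
  set p := s₁.arr 4 with hp
  set m := s₁.reg 7 with hm
  constructor
  · intro hne
    have hU0 : U = ∅ := by
      by_contra hc
      simp [hc] at hne
    refine Solved.of_eq ⟨hU.start, hU.step, fun x hx => ?_⟩ h9
    -- After `n - 1` extensions the tour contains all `n` vertices.
    have hall : Finset.filter (fun x => s₁.arr 6 x ≠ 0) (Finset.range n) = Finset.range n :=
      Finset.eq_of_subset_of_card_le (Finset.filter_subset _ _)
        (by rw [Finset.card_range]; exact (le_of_eq (by omega)).trans tcard.ge)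
    have hSx : s₁.arr 6 x ≠ 0 := by
      have := Finset.mem_range.2 hx
      rw [← hall] at this
      exact (Finset.mem_filter.1 this).2
    obtain ⟨y, hy, rfl⟩ := tcov x hx hSx
    -- The largest mark up to `y` exists because position `0` starts a segment in every phase, and
    -- there is a phase as `M ≥ 1`.
    have hne' : (Finset.filter (· ≤ y) (allStarts G p m M)).Nonempty :=
      ⟨0, Finset.mem_filter.2 ⟨Finset.mem_biUnion.2 ⟨0, Finset.mem_range.2 hM,
        zero_mem_starts _⟩, Nat.zero_le _⟩⟩
    have hmax := Finset.mem_filter.1 (Finset.max'_mem _ hne')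
    exact hU.cover _ hmax.1 (by simp [hU0]) y hmax.2 (by omega) fun z hz hzy =>
      Finset.le_max' _ _ (Finset.mem_filter.2 ⟨hz, hzy⟩)
  · intro hMk
    have hsum : ∑ q ∈ Finset.range m, missing G.NatAdj 0 (3 * n * M) (p q) (p (q + 1)) ≤
        2 * k * (3 * n * M) := by
      rw [t7, ← h5]
      exact (Nat.le_add_left _ _).trans (tsum.trans (pairSum_missing_le hTd (by omega)))
    have hstarts := sum_card_starts_le hn hk (by omega) hsum
    have hcard : (allStarts G p m M).card ≤ 5 * k * M := Finset.card_biUnion_le.trans hstarts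
    have hexp := neg_sum_inv_le (M := M) (c := 5 * k)
      (r := fun j => ((starts G.NatAdj p m (2 * n) (3 * n * j + n)).card : ℝ))
      (fun j => by exact_mod_cast Finset.card_pos.2 ⟨0, zero_mem_starts _⟩)
      (by have : (1 : ℝ) ≤ k := by exact_mod_cast hk
          positivity) (by exact_mod_cast hstarts)
    have hlt : (U.card : ℝ) < 1 := by
      calc (U.card : ℝ) ≤ _ := hU.card_le
        _ ≤ (5 * k * M : ℝ) * Real.exp (-(M / (5 * k : ℝ))) := by
            gcongr
            exact_mod_cast hcard
        _ < 1 := mul_exp_lt_one hk hMk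
    have hU0 : U = ∅ := by
      rw [← Finset.card_eq_zero]
      exact Nat.lt_one_iff.1 (by exact_mod_cast hlt)
    rw [if_pos hU0]
    exact one_ne_zero

/-- Numbering the moves by `Nat.count` identifies the `i`-th entry with the `i`-th change of
position, as `exists_walk_of_positions` requires. -/
theorem writeMoves_spec (h : Env G v s) (hH : s.reg 5 ≤ L) :
    let P := fun t => s.arr 9 (t + 1) ≠ s.arr 9 t
    let s' := writeMoves.run s
    s'.reg 0 = Nat.count P (s.reg 5) ∧ ∀ i < Nat.count P (s.reg 5),
      (s'.arr 1 i < s.reg 5 ∧ P (s'.arr 1 i) ∧ Nat.count P (s'.arr 1 i) = i) ∧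
        s'.arr 2 i = s.arr 9 (s'.arr 1 i + 1) := by
  intro P s₁
  set move : Cmd := ite (neExp (cell 9 (add (reg 38) (const 1))) (cell 9 (reg 38)))
      (block [store 1 (reg 37) (reg 38), store 2 (reg 37) (cell 9 (add (reg 38) (const 1))),
        assign 37 (add (reg 37) (const 1))]) skip with hmove
  have hrun : s₁ = ((Cmd.forTo 38 (reg 5) move).run (s.setReg 37 0)).setReg 0
      (((Cmd.forTo 38 (reg 5) move).run (s.setReg 37 0)).reg 37) := rfl
  have key := run_for (x := 38) (e := reg 5) (N := s.reg 5) (s := s.setReg 37 0) (c := move)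
    (fun i s' => s'.reg 37 = Nat.count P i ∧ ∀ l < Nat.count P i,
      (s'.arr 1 l < i ∧ P (s'.arr 1 l) ∧ Nat.count P (s'.arr 1 l) = l) ∧
        s'.arr 2 l = s.arr 9 (s'.arr 1 l + 1))
    rfl (by simp) (by simpa [h.reg_one] using hH) (by simp) ?_
  · rw [hrun]
    exact key
  · intro i s' hi hx hfr ⟨h1, h2⟩
    have e9 : s'.arr 9 = s.arr 9 := hfr.arr 9 rfl
    have hc : move.run s' = if P i then
        ((s'.setCell 1 (Nat.count P i) i).setCell 2 (Nat.count P i) (s.arr 9 (i + 1))).setReg 37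
          (Nat.count P i + 1) else s' := by
      rw [hmove, run, if_congr (eval_neExp _ _) rfl rfl]
      simp only [block, run, Exp.eval, hx, e9, h1, State.setCell_reg,
        State.setCell_arr, P, ne_eq, not_false_eq_true,
        Function.update_of_ne, OfNat.ofNat_ne_one]
    rw [hc]
    by_cases hP : P i
    · rw [if_pos hP]
      refine ⟨by simp [Nat.count_succ, hP], fun l hl => ?_⟩
      rw [Nat.count_succ, if_pos hP] at hl
      by_cases hli : l = Nat.count P i
      · simp [hli, hP]
      · obtain ⟨⟨g1, g2, g3⟩, g4⟩ := h2 l (by omega)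
        have e1 : ((((s'.setCell 1 (Nat.count P i) i).setCell 2 (Nat.count P i)
          (s.arr 9 (i + 1))).setReg 37 (Nat.count P i + 1)).setReg 38 (i + 1)).arr 1 l =
            s'.arr 1 l := by simp [hli]
        have e2 : ((((s'.setCell 1 (Nat.count P i) i).setCell 2 (Nat.count P i)
          (s.arr 9 (i + 1))).setReg 37 (Nat.count P i + 1)).setReg 38 (i + 1)).arr 2 l =
            s'.arr 2 l := by simp [hli]
        rw [e1, e2]
        exact ⟨⟨by omega, g2, g3⟩, g4⟩
    · rw [if_neg hP]
      have e1 : Nat.count P (i + 1) = Nat.count P i := by rw [Nat.count_succ, if_neg hP, add_zero]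
      rw [e1]
      refine ⟨by simpa using h1, fun l hl => ?_⟩
      obtain ⟨⟨g1, g2, g3⟩, g4⟩ := h2 l hl
      exact ⟨⟨by simp only [State.setReg_arr]; omega, g2, g3⟩, g4⟩

/-! ### The search for the number of phases -/

theorem main_spec {k M : ℕ} (hk : 1 ≤ k) (hG : G.AlwaysConnected) (hD : G.EdgeDeficient k)
    (hM : 1 ≤ M) (hMk : 80 * (k * Real.log (k + 1)) ≤ M) (hL : 3 * n * M ≤ L) :
    ∃ W : G.Walk v, Describes (main.run (G.input v)) W ∧ Function.Surjective W.vertex ∧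
      W.length ≤ 3 * n * M ∧ ∀ i, (W.time i : ℕ) + 1 ≤ 3 * n * M := by
  have hn := v.pos
  have hE₁ : Env G v (multiples.run (G.input v)) := multiples_env (by nlinarith)
  have hf₁ := frame_run multiples (G.input v)
  set tryNext : Cmd := ite (reg 3) skip (block
      [assign 4 (add (reg 4) (const 1)), assign 5 (add (reg 5) thriceExp), attempt]) with htry
  have hrun : main.run (G.input v) =
      writeMoves.run ((Cmd.forTo 36 (reg 1) tryNext).run (multiples.run (G.input v))) := rfl
  have i3 : (multiples.run (G.input v)).reg 3 = 0 := hf₁.reg 3 rfl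
  have i4 : (multiples.run (G.input v)).reg 4 = 0 := hf₁.reg 4 rfl
  have i5 : (multiples.run (G.input v)).reg 5 = 0 := hf₁.reg 5 rfl
  rw [hrun]
  generalize multiples.run (G.input v) = s₁ at *
  have key := run_for (x := 36) (e := reg 1) (s := s₁) (c := tryNext) (N := L)
    -- Either all attempts so far have failed, and there were fewer than `M`, or one with `M' ≤ M`
    -- phases has succeeded and its result is kept.
    (fun i s' => s'.reg 3 = 0 ∧ i < M ∧ s'.reg 4 = i ∧ s'.reg 5 = 3 * n * i ∨
      s'.reg 3 ≠ 0 ∧ ∃ M' ≤ M, s'.reg 5 = 3 * n * M' ∧ Solved G v (3 * n * M') s')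
    rfl hE₁.reg_one hE₁.reg_one.ge (.inl ⟨by simpa using i3, hM, by simpa using i4,
      by simpa using i5⟩) ?_
  · have hE₂ : Env G v ((Cmd.forTo 36 (reg 1) tryNext).run s₁) := hE₁.run _
    generalize (Cmd.forTo 36 (reg 1) tryNext).run s₁ = s₂ at *
    rcases key with ⟨-, h1, -⟩ | ⟨-, M', hM', h5, hS⟩
    -- The loop makes `L ≥ 3nM ≥ M` iterations, so it cannot end with fewer than `M` failures.
    · nlinarith
    · have hle : 3 * n * M' ≤ 3 * n * M := Nat.mul_le_mul_left _ hM'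
      obtain ⟨w1, w2⟩ := writeMoves_spec hE₂ (by omega)
      rw [h5] at w1 w2
      obtain ⟨W, W1, W2, W3, W4, W5⟩ := exists_walk_of_positions G v
        (τ := (writeMoves.run s₂).arr 1) (hle.trans hL) hS.start hS.step hS.cover
        fun i hi => (w2 i hi).1
      refine ⟨W, ⟨w1.trans W1.symm, fun i => ?_⟩, W3, W4.trans hle,
        fun i => (W5 i).trans hle⟩
      have hi : (i : ℕ) < Nat.count (fun t => s₂.arr 9 (t + 1) ≠ s₂.arr 9 t) (3 * n * M') := by
        rw [← W1]
        exact i.2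
      exact ⟨(W2 i).1.symm, (w2 i hi).2.trans (W2 i).2.symm⟩
  · intro i s₂ hi _ hfr ih
    have hE₂ : Env G v s₂ := hE₁.frame hfr
    rcases ih with ⟨h3, hiM, h4, h5⟩ | ⟨h3, M', hM', h5, hS⟩
    · set s₃ := (s₂.setReg 4 (i + 1)).setReg 5 (3 * n * (i + 1)) with hs₃
      have hE₃ : Env G v s₃ := (hE₂.setReg 4).setReg 5
      have hrun₃ : tryNext.run s₂ = attempt.run s₃ := by
        have e3 := (hE₂.setReg 4 (a := i + 1)).eval_thriceExp
        rw [htry, run, if_neg (by simpa using h3)]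
        simp only [block, run, Exp.eval, h4, e3, State.setReg_reg, ne_eq, Nat.reduceEqDiff,
          not_false_eq_true, Function.update_of_ne, h5]
        rw [hs₃, Nat.mul_succ]
      have hle : 3 * n * (i + 1) ≤ L := (Nat.mul_le_mul_left _ hiM).trans hL
      obtain ⟨a1, a2⟩ := attempt_spec (M := i + 1) hk hG hD hE₃ (by omega) rfl rfl hle
      have hfa := frame_run attempt s₃
      rw [hrun₃]
      generalize attempt.run s₃ = s₄ at *
      have f4 : s₄.reg 4 = i + 1 := hfa.reg 4 rfl
      have f5 : s₄.reg 5 = 3 * n * (i + 1) := hfa.reg 5 rfl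
      by_cases h : s₄.reg 3 = 0
      · refine .inl ⟨by simpa using h, ?_, by simpa using f4, by simpa using f5⟩
        refine lt_of_le_of_ne hiM fun he => a2 ?_ h
        rw [he]
        exact hMk
      · exact .inr ⟨by simpa using h, i + 1, hiM, by simpa using f5, (a1 h).of_eq rfl⟩
    · have hrun₃ : tryNext.run s₂ = s₂ := by
        rw [htry, run, if_pos (by simpa using h3)]
        rfl
      rw [hrun₃]
      exact .inr ⟨by simpa using h3, M', hM', by simpa using h5, hS.of_eq rfl⟩

end Explore

end TemporalGraph

namespace TemporalGraph

/-! ## Renaming the vertices -/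

section Rename

variable {V V' : Type*} {L : ℕ} {G : TemporalGraph V L}

/-- The temporal graph with renamed vertices. -/
def rename (e : V' ≃ V) (G : TemporalGraph V L) : TemporalGraph V' L := fun i => (G i).comap e

theorem AlwaysConnected.rename (e : V' ≃ V) (h : G.AlwaysConnected) :
    (G.rename e).AlwaysConnected :=
  fun i => (SimpleGraph.Iso.comap e (G i)).connected_iff.2 (h i)

theorem EdgeDeficient.rename {k : ℕ} (e : V' ≃ V) (h : G.EdgeDeficient k) :
    (G.rename e).EdgeDeficient k := by
  obtain ⟨T, hT, hT', hd⟩ := h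
  have hmem : ∀ (F : SimpleGraph V) (z : Sym2 V'), z ∈ (F.comap e).edgeSet ↔
      Sym2.map e z ∈ F.edgeSet := fun F z => by
    induction z using Sym2.ind
    rfl
  refine ⟨T.comap e, fun a b hab => ?_, (SimpleGraph.Iso.comap e T).isTree_iff.2 hT',
    fun i => le_trans ?_ (hd i)⟩
  · obtain ⟨i, hi⟩ := SimpleGraph.iSup_adj.1 (hT hab)
    exact SimpleGraph.iSup_adj.2 ⟨i, hi⟩
  · refine Set.encard_le_encard_of_injOn (f := Sym2.map e) (fun z hz => ?_)
      (Sym2.map.injective e.injective).injOn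
    exact ⟨(hmem T z).1 hz.1, fun h => hz.2 ((hmem (G i) z).2 h)⟩

/-- The walk with the original names of the vertices. -/
def Walk.ofRename (e : V' ≃ V) {v' : V'} (W : (G.rename e).Walk v') {v : V} (hv : e v' = v) :
    G.Walk v where
  length := W.length
  vertex i := e (W.vertex i)
  time := W.time
  start := by rw [W.start, hv]
  time_strictMono := W.time_strictMono
  adj := W.adj

end Rename

/-- A sufficient number of phases. -/
theorem exists_phases {k : ℕ} (hk : 1 ≤ k) : ∃ M : ℕ, 1 ≤ M ∧
    80 * (k * Real.log (k + 1)) ≤ M ∧ (M : ℝ) ≤ 82 * (k * Real.log (k + 1)) := by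
  have hk' : (1 : ℝ) ≤ k := by exact_mod_cast hk
  -- Rounding up costs at most `1 ≤ 2 * (k * log (k + 1))`, which turns the factor `80` into `82`.
  have h1 : (1 / 2 : ℝ) ≤ k * Real.log (k + 1) := by
    have h2 : Real.log 2 ≤ Real.log (k + 1) := Real.log_le_log (by norm_num) (by linarith)
    nlinarith [Real.log_two_gt_d9]
  refine ⟨⌈80 * (k * Real.log (k + 1))⌉₊, Nat.one_le_ceil_iff.2 (by linarith), Nat.le_ceil _, ?_⟩
  have := Nat.ceil_lt_add_one (show 0 ≤ 80 * (k * Real.log (k + 1)) by linarith)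
  linarith

/-- The constant is `246 = 3 * 82`: at most `82 k log(k+1)` phases of `3n` time steps. -/
theorem explore_spec {n L k : ℕ} {G : TemporalGraph (Fin n) L} (hk : 1 ≤ k)
    (hG : G.AlwaysConnected) (hD : G.EdgeDeficient k)
    (hL : 246 * (n * k * Real.log (k + 1)) ≤ L) (v : Fin n) :
    ∃ W : G.Walk v, Describes (Explore.main.run (G.input v)) W ∧
      W.ExploresWithin (246 * (n * k * Real.log (k + 1))) := by
  obtain ⟨M, h1, h2, h3⟩ := exists_phases hk
  have h4 : ((3 * n * M : ℕ) : ℝ) ≤ 246 * (n * k * Real.log (k + 1)) := by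
    push_cast
    calc (3 * n * M : ℝ) ≤ 3 * n * (82 * (k * Real.log (k + 1))) := by gcongr
      _ = _ := by ring
  obtain ⟨W, W1, W2, W3, W4⟩ := Explore.main_spec (v := v) hk hG hD h1 h2
    (by exact_mod_cast h4.trans hL)
  exact ⟨W, W1, W2, le_trans (by exact_mod_cast W3) h4,
    fun i => le_trans (by exact_mod_cast W4 i) h4⟩

theorem explore_correct {n L k : ℕ} {G : TemporalGraph (Fin n) L} (hk : 1 ≤ k)
    (hG : G.AlwaysConnected) (hD : G.EdgeDeficient k)
    (hL : 246 * (n * k * Real.log (k + 1)) ≤ L) (v : Fin n) :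
    Correct Explore.main.toProgram G v (246 * (n * k * Real.log (k + 1))) := by
  intro ω s t hrun
  obtain ⟨t', h, -⟩ := RAM.Cmd.exists_run ω Explore.main_wf (G.input v)
  obtain ⟨rfl, -⟩ := hrun.unique h
  exact explore_spec hk hG hD hL v

end TemporalGraph

/-! ### Running time and the final statement -/

theorem Polynomial.eval_nat_mono (p : Polynomial ℕ) : Monotone fun x => p.eval x := by
  intro a b hab
  simp only [Polynomial.eval_eq_sum_range]
  gcongr

/-- The time is polynomial in `L` alone, and `L` is at most the input size because a start vertex
forces `n ≥ 1`. -/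
theorem TemporalGraph.explore_time {n L : ℕ} (G : TemporalGraph (Fin n) L) (v : Fin n)
    (ω : ℕ → Bool) : ∃ (s : RAM.State) (t : ℕ),
      RAM.Run ω Explore.main.toProgram (G.input v) s t ∧
        t ≤ Explore.main.time.eval (inputSize n L) := by
  obtain ⟨t, h, ht⟩ := RAM.Cmd.exists_run ω Explore.main_wf (G.input v)
  refine ⟨_, t, h, ht.trans (Polynomial.eval_nat_mono _ ?_)⟩
  have hn := v.pos
  change L ≤ L * n * n + 3
  calc L = L * 1 * 1 := by ring
    _ ≤ L * n * n := by gcongr <;> exact hn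
    _ ≤ L * n * n + 3 := Nat.le_add_right _ _

/-- A bound that is valid for all coin flips bounds the expectation, as the coin flips form a
probability space. -/
theorem RAM.expectedTime_le {P : RAM.Program} {s : RAM.State} {b : ℕ}
    (h : ∀ ω : ℕ → Bool, ∃ (s' : RAM.State) (t : ℕ), RAM.Run ω P s s' t ∧ t ≤ b) :
    RAM.expectedTime P s ≤ b := by
  have : MeasureTheory.IsProbabilityMeasure RAM.fairCoins := by
    unfold RAM.fairCoins
    infer_instance
  calc RAM.expectedTime P s ≤ MeasureTheory.lintegral RAM.fairCoins fun _ => b := by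
        refine MeasureTheory.lintegral_mono fun ω => ?_
        obtain ⟨s', t, hr, ht⟩ := h ω
        exact (iInf₂_le_of_le s' t (iInf_le_of_le hr le_rfl)).trans (by exact_mod_cast ht)
    _ = b := by simp

theorem corollary1 :
    ∃ C : ℝ, 0 < C ∧
      -- existence of the schedule
      (∀ (V : Type*) [Fintype V] (k L : ℕ) (G : TemporalGraph V L), 1 ≤ k →
        G.AlwaysConnected → G.EdgeDeficient k →
        C * (Fintype.card V * k * Real.log (k + 1)) ≤ L →
        ∀ v : V, ∃ W : G.Walk v,
          W.ExploresWithin (C * (Fintype.card V * k * Real.log (k + 1)))) ∧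
      -- Las Vegas algorithm with expected polynomial time
      (∃ (P : RAM.Program) (p : Polynomial ℕ),
        ∀ (k n L : ℕ) (G : TemporalGraph (Fin n) L), 1 ≤ k →
          G.AlwaysConnected → G.EdgeDeficient k →
          C * (n * k * Real.log (k + 1)) ≤ L →
          ∀ v : Fin n,
            TemporalGraph.Correct P G v (C * (n * k * Real.log (k + 1))) ∧
            RAM.expectedTime P (G.input v) ≤ (p.eval (TemporalGraph.inputSize n L) : ℕ)) ∧
      -- deterministic algorithm, in polynomial time for every fixed `k`
      (∃ P : RAM.Program, P.Deterministic ∧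
        ∀ k : ℕ, 1 ≤ k → ∃ p : Polynomial ℕ,
          ∀ (n L : ℕ) (G : TemporalGraph (Fin n) L),
            G.AlwaysConnected → G.EdgeDeficient k →
            C * (n * k * Real.log (k + 1)) ≤ L →
            ∀ v : Fin n,
              TemporalGraph.Correct P G v (C * (n * k * Real.log (k + 1))) ∧
              ∀ ω : ℕ → Bool, ∃ (s : RAM.State) (t : ℕ), RAM.Run ω P (G.input v) s t ∧
                t ≤ p.eval (TemporalGraph.inputSize n L)) := by
  refine ⟨246, by norm_num, ?_, ?_, ?_⟩
  · intro V _ k L G hk hG hD hL v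
    -- The algorithm works on `Fin n`; for an arbitrary vertex set its walk is carried over along a
    -- bijection.
    let e := (Fintype.equivFin V).symm
    obtain ⟨W, -, h1, h2, h3⟩ := TemporalGraph.explore_spec hk (hG.rename e) (hD.rename e) hL
      (e.symm v)
    exact ⟨W.ofRename e (e.apply_symm_apply v), e.surjective.comp h1, h2, h3⟩
  · refine ⟨TemporalGraph.Explore.main.toProgram, TemporalGraph.Explore.main.time,
      fun k n L G hk hG hD hL v => ⟨TemporalGraph.explore_correct hk hG hD hL v, ?_⟩⟩
    exact RAM.expectedTime_le (G.explore_time v)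
  · refine ⟨TemporalGraph.Explore.main.toProgram, RAM.Cmd.toProgram_deterministic _,
      fun k hk => ⟨TemporalGraph.Explore.main.time, fun n L G hG hD hL v =>
        ⟨TemporalGraph.explore_correct hk hG hD hL v, G.explore_time v⟩⟩⟩
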